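/- Conventions. A germ of $n$-web $\mathcal W$ on $(\mathbb C^2,0)$ is given, up to multiplication by a holomorphic unit, by a germ of holomorphic $n$-symmetric $1$-form $\omega=\sum_{i+j=n}a_{ij}(x,y)\,dx^i dy^j$ with isolated zeros and not identically zero discriminant; $\mathcal W\boxtimes\mathcal W'$ is the web given by $\omega\,\omega'$, and $\Delta(\mathcal W)$ is the divisor defined by the discriminant of $\omega$. It is smooth (not necessarily reduced) if it is a multiple $mC$ of a germ $C$ of smooth curve, and a divisor is invariant by $\mathcal W$ if, at every regular point $p$ of its support, the tangent line of the support is one of the directions of $\mathcal W$ at $p$. The curvature of a completely decomposable web $\mathcal F_1\boxtimes\cdots\boxtimes\mathcal F_n$, $\mathcal F_i=[\omega_i]$, $\omega_i\wedge\omega_j=\delta_{ij}\,dx\wedge dy$, is $K=\sum_{r<s<t}d\eta_{rst}$, where $\eta_{rst}$ is the unique meromorphic $1$-form with $d(\delta_{st}\omega_r)=\eta_{rst}\wedge\delta_{st}\omega_r$ and likewise for the cyclic permutations of $(r,s,t)$. It depends only on the web, so that for an arbitrary web it is defined locally outside the discriminant, and it is a meromorphic $2$-form with poles contained in the discriminant.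 A deformation of $\mathcal W$ is a family $\mathcal W^\varepsilon$, $\varepsilon\in(\mathbb C,0)$, of webs on a fixed neighbourhood of $0\in\mathbb C^2$, given by symmetric forms that depend holomorphically on $(\varepsilon,x,y)$, with $\mathcal W^0=\mathcal W$. Statement. Let $k\ge 1$ and let $\mathcal W=\mathcal W_2\boxtimes\mathcal W_k$ be a germ of $(k+2)$-web on $(\mathbb C^2,0)$, where $\mathcal W_2$ is a $2$-web and $\mathcal W_k$ is a $k$-web, such that $\Delta(\mathcal W_2)=\Delta(\mathcal W)$ (as divisors) is smooth and invariant by $\mathcal W_2$. Let $\mathcal W^\varepsilon$ be a deformation of $\mathcal W$ such that, on a fixed neighbourhood of $0$ and for all $\varepsilon$ close to $0$, the curvature of $\mathcal W^\varepsilon$ is holomorphic. Then there are deformations $\mathcal W_2^\varepsilon$ of $\mathcal W_2$ and $\mathcal W_k^\varepsilon$ of $\mathcal W_k$ such that, on a fixed neighbourhood of $0$ and for all $\varepsilon$ close to $0$, $\mathcal W^\varepsilon=\mathcal W_2^\varepsilon\boxtimes\mathcal W_k^\varepsilon$, the divisors $\Delta(\mathcal W_2^\varepsilon)$ and $\Delta(\mathcal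 W^\varepsilon)$ are equal, and this discriminant is invariant by $\mathcal W_2^\varepsilon$. -/

import Mathlib

open Polynomial Topology Filter

namespace PlaneWeb

noncomputable section

/-!
Webs on open subsets of `ℂ × ℂ`, with coordinates `(x, y)`.

A binary form `∑ i, aᵢ dx ^ (n - i) dy ^ i` of degree `n` is encoded by the polynomial `∑ i, aᵢ X ^ i`
of degree at most `n`, so that the product of symmetric forms is the product of polynomials; the
number `n` is always carried along, because the leading coefficients may vanish. A symmetric
`n`-form on an open set is a function `W` with values in such polynomials.
-/

/-- The value of the binary form `∑ i, aᵢ dx ^ (n - i) dy ^ i` at the vector `v`. -/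
def formEval (n : ℕ) (F : ℂ[X]) (v : ℂ × ℂ) : ℂ :=
  ∑ i ∈ Finset.range (n + 1), F.coeff i * v.1 ^ (n - i) * v.2 ^ i

/-- The discriminant of a binary form `F` of degree `n`, up to a nonzero constant that depends only
on `n`: the resultant of the two partial derivatives `∂F/∂(dx)` and `∂F/∂(dy)`, which are binary
forms of degree `n - 1`. -/
def formDiscr (n : ℕ) (F : ℂ[X]) : ℂ :=
  resultant ((n : ℂ[X]) * F - X * derivative F) (derivative F) (n - 1) (n - 1)

/-- `W` is near `p` a holomorphic family of binary forms of degree `n`. -/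
def AnalyticFormAt {E : Type*} [NormedAddCommGroup E] [NormedSpace ℂ E]
    (n : ℕ) (W : E → ℂ[X]) (p : E) : Prop :=
  (∀ᶠ q in 𝓝 p, (W q).natDegree ≤ n) ∧ ∀ i, AnalyticAt ℂ (fun q => (W q).coeff i) p

/-- `W` defines an `n`-web near `p`: it is a holomorphic symmetric `n`-form with isolated zeros whose
discriminant does not vanish identically. -/
def IsWebAt (n : ℕ) (W : ℂ × ℂ → ℂ[X]) (p : ℂ × ℂ) : Prop :=
  AnalyticFormAt n W p ∧ (∀ᶠ q in 𝓝[≠] p, W q ≠ 0) ∧ ∃ᶠ q in 𝓝 p, formDiscr n (W q) ≠ 0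

/-- Near `p` the symmetric forms `W` and `W'` differ by a nowhere zero holomorphic factor, that is,
they define the same web. -/
def SameWebAt (W W' : ℂ × ℂ → ℂ[X]) (p : ℂ × ℂ) : Prop :=
  ∃ u : ℂ × ℂ → ℂ, AnalyticAt ℂ u p ∧ u p ≠ 0 ∧ ∀ᶠ q in 𝓝 p, W q = C (u q) * W' q

/-- Near `p` the functions `f` and `g` define the same divisor. -/
def SameDivisorAt (f g : ℂ × ℂ → ℂ) (p : ℂ × ℂ) : Prop :=
  ∃ u : ℂ × ℂ → ℂ, AnalyticAt ℂ u p ∧ u p ≠ 0 ∧ ∀ᶠ q in 𝓝 p, f q = u q * g q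

/-- The divisor of `f` near `p` is smooth, but not necessarily reduced: it is `m` times a smooth
curve through `p` (`m = 0` is the empty divisor). -/
def SmoothDivisorAt (f : ℂ × ℂ → ℂ) (p : ℂ × ℂ) : Prop :=
  ∃ (g : ℂ × ℂ → ℂ) (m : ℕ), AnalyticAt ℂ g p ∧ g p = 0 ∧ fderiv ℂ g p ≠ 0 ∧
    SameDivisorAt f (fun q => g q ^ m) p

/-- If `p` is a regular point of the curve `{D = 0}`, then the tangent line of this curve at `p` is
one of the directions at `p` of the `n`-web `W`. -/
def InvariantAt (n : ℕ) (W : ℂ × ℂ → ℂ[X]) (D : ℂ × ℂ → ℂ) (p : ℂ × ℂ) : Prop :=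
  ∀ g : ℂ × ℂ → ℂ, AnalyticAt ℂ g p → g p = 0 → fderiv ℂ g p ≠ 0 →
    (∀ᶠ q in 𝓝 p, D q = 0 ↔ g q = 0) →
      ∀ v : ℂ × ℂ, fderiv ℂ g p v = 0 → formEval n (W p) v = 0

/-!
A `1`-form `A dx + B dy` is encoded by the function `(A, B)`, and a `2`-form `κ dx ∧ dy` by `κ`.
-/

/-- The coefficient of `α ∧ β`. -/
def wedge (α β : ℂ × ℂ) : ℂ := α.1 * β.2 - α.2 * β.1

/-- The coefficient at `p` of the exterior derivative of the `1`-form `α`. -/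
def extD (α : ℂ × ℂ → ℂ × ℂ) (p : ℂ × ℂ) : ℂ :=
  fderiv ℂ (fun q => (α q).2) p (1, 0) - fderiv ℂ (fun q => (α q).1) p (0, 1)

/-- Near `p`, `d (δ α) = η ∧ δ α`, where `δ` is the coefficient of `β ∧ γ`. -/
def EtaEq (α β γ η : ℂ × ℂ → ℂ × ℂ) (p : ℂ × ℂ) : Prop :=
  ∀ᶠ q in 𝓝 p, extD (fun z => wedge (β z) (γ z) • α z) q =
    wedge (η q) (wedge (β q) (γ q) • α q)

/-- The holomorphic `1`-form `η` near `p` is the form `η` of the `3`-web defined by the `1`-forms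
`α`, `β`, `γ`. (It is unique where these are pairwise independent.) -/
def IsEta (α β γ η : ℂ × ℂ → ℂ × ℂ) (p : ℂ × ℂ) : Prop :=
  AnalyticAt ℂ η p ∧ EtaEq α β γ η p ∧ EtaEq β γ α η p ∧ EtaEq γ α β η p

/-- The curvature of the `n`-web `W` at a point `p` outside its discriminant is `κ dx ∧ dy`: near `p`
the web is a product of foliations `ω j`, and its curvature is `∑ r < s < t, d η_{rst}`. -/
def HasCurvatureAt (n : ℕ) (W : ℂ × ℂ → ℂ[X]) (p : ℂ × ℂ) (κ : ℂ) : Prop :=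
  ∃ (ω : Fin n → ℂ × ℂ → ℂ × ℂ) (η : Fin n → Fin n → Fin n → ℂ × ℂ → ℂ × ℂ),
    (∀ j, AnalyticAt ℂ (ω j) p) ∧
    (∀ᶠ q in 𝓝 p, W q = ∏ j, (C (ω j q).1 + C (ω j q).2 * X)) ∧
    (∀ r s t, r < s → s < t → IsEta (ω r) (ω s) (ω t) (η r s t) p) ∧
    κ = ∑ r, ∑ s, ∑ t, if r < s ∧ s < t then extD (η r s t) p else 0

/-- The curvature of `W`, a holomorphic `2`-form outside the discriminant of `W`, extends to a
holomorphic `2`-form on a neighbourhood of `p`. -/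
def HolomorphicCurvatureAt (n : ℕ) (W : ℂ × ℂ → ℂ[X]) (p : ℂ × ℂ) : Prop :=
  ∃ κ : ℂ × ℂ → ℂ, AnalyticAt ℂ κ p ∧
    ∀ᶠ q in 𝓝 p, formDiscr n (W q) ≠ 0 → HasCurvatureAt n W q (κ q)

/-- `W ε`, for `ε` near `0` in `ℂ`, is a deformation of the germ at the origin of the `n`-web `W₀`:
a family of `n`-webs on a fixed neighbourhood of the origin that depends holomorphically on `ε`,
with `W 0` equal to `W₀` near the origin. -/
def IsDeformation (n : ℕ) (W₀ : ℂ × ℂ → ℂ[X]) (W : ℂ → ℂ × ℂ → ℂ[X]) : Prop :=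
  AnalyticFormAt n (fun z : ℂ × (ℂ × ℂ) => W z.1 z.2) 0 ∧
  (∀ᶠ z : ℂ × (ℂ × ℂ) in 𝓝 0, IsWebAt n (W z.1) z.2) ∧
  SameWebAt (W 0) W₀ 0

end

end PlaneWeb

/-! The equality of discriminants makes `Wk` harmless. Up to a constant, the discriminant of a
product is Δ(W₂) Δ(W_k) Res², so Δ(W₂) = Δ(W) forces the discriminant of `Wk` and the resultant to
be nonzero at the origin: `Wk` is a product of regular foliations, pairwise transverse and
transverse to `W₂`. By the inverse function theorem (`AnalyticFormAt.exists_eq_mul`) the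
factorization extends to the deformation, W = V G. The discriminant of W is then D = disc V times a
unit, and only the invariance of {D = 0} uses the curvature.

Fix a vector e with V(e) ≠ 0 at the origin and let ω be the polar form of V at e. Where D = 0, the
form V is a constant times the square of a linear form whose kernel is that of ω. So it suffices
that f, the coefficient of dD ∧ ω, be divisible by D: then the kernel of ω is tangent to {D = 0}
(`invariantAt_of_wedge_grad_eq_mul`). Summing the forms η over all triples and discarding closed
terms (1/2) d log D, `HasCurvatureAt.eq_extD` gives K = dR + d((f/D) B), with R and B analytic in
(ε, x, y). Holomorphy of K therefore says that f/D solves a first order linear equation along the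
kernel ξ of B, with holomorphic right hand side. On the fibre ε = 0, D is a unit times g ^ m, and
invariance of {g = 0} makes ξ transverse to this curve (`wedge_polarPart_ne_zero`).

Differentiating along a transverse field raises the order of a pole, so f/D has no pole on the fibre
ε = 0. For ε ≠ 0 nothing is known about the shape of {D = 0}, so the argument is made ε-adically: f
= q D + ε r, where r satisfies an equation of the same type, hence f is a multiple of D modulo every
power of ε (`exists_eq_mul_add_pow_mul`). A Krull intersection argument with Cauchy integrals
(`exists_analyticAt_eq_mul`) then gives divisibility. The curvature is assumed holomorphic only
fibre by fibre; `exists_analyticAt_of_fiberwise` first makes the right hand side jointly analytic.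
-/

namespace PlaneWeb

noncomputable section

/-! ### Superposition operators on spaces of continuous functions. -/

section Superposition

variable {K E F : Type*} [TopologicalSpace K] [CompactSpace K]
  [NormedAddCommGroup E] [NormedSpace ℂ E] [NormedAddCommGroup F] [NormedSpace ℂ F]

/-- A continuous multilinear map acts pointwise on continuous maps. -/
def pointwiseMultilinear {n : ℕ} (p : E [×n]→L[ℂ] F) : C(K, E) [×n]→L[ℂ] C(K, F) :=
  MultilinearMap.mkContinuous
    { toFun := fun c => ⟨fun t => p (fun i => c i t),
        p.cont.comp (continuous_pi fun i => (c i).continuous)⟩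
      map_update_add' := by
        intro _ m i x y
        ext t
        have h : ∀ z : C(K, E), (fun j => (Function.update m i z) j t)
            = Function.update (fun j => m j t) i (z t) := by
          intro z; ext j
          by_cases hj : j = i
          · subst hj; simp
          · simp [hj]
        simp only [ContinuousMap.coe_mk, ContinuousMap.add_apply]
        rw [h, h, h]
        simp
      map_update_smul' := by
        intro _ m i a x
        ext t
        have h : ∀ z : C(K, E), (fun j => (Function.update m i z) j t)
            = Function.update (fun j => m j t) i (z t) := by
          intro z; ext j
          by_cases hj : j = i
          · subst hj; simp
          · simp [hj]
        simp only [ContinuousMap.coe_mk, ContinuousMap.smul_apply]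
        rw [h, h]
        simp }
    ‖p‖ (by
      intro c
      rw [ContinuousMap.norm_le _ (by positivity)]
      intro t
      refine (p.le_opNorm _).trans ?_
      gcongr with i
      exact (c i).norm_coe_le_norm t)

lemma norm_pointwiseMultilinear_le {n : ℕ} (p : E [×n]→L[ℂ] F) :
    ‖pointwiseMultilinear (K := K) p‖ ≤ ‖p‖ :=
  MultilinearMap.mkContinuous_norm_le _ (norm_nonneg _) _

/-- The superposition operator of an analytic function is analytic on continuous maps with values
in the ball of convergence. -/
theorem exists_analyticAt_superposition [CompleteSpace F] {f : E → F}
    {p : FormalMultilinearSeries ℂ E F} {r : ENNReal} (hf : HasFPowerSeriesOnBall f p 0 r)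
    (c₀ : C(K, E)) (hc : ‖c₀‖ₑ < r) :
    ∃ N : C(K, E) → C(K, F), AnalyticAt ℂ N c₀ ∧ ∀ᶠ c in 𝓝 c₀, ∀ t, N c t = f (c t) := by
  -- Each Taylor coefficient acts pointwise without increase of norm, so the radius of convergence
  -- does not shrink.
  let P : FormalMultilinearSeries ℂ C(K, E) C(K, F) := fun n => pointwiseMultilinear (p n)
  have hrad : r ≤ P.radius := hf.r_le.trans
    (FormalMultilinearSeries.radius_le_of_le fun n => norm_pointwiseMultilinear_le _)
  have hpos : 0 < P.radius := hf.r_pos.trans_le hrad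
  have hP := P.hasFPowerSeriesOnBall hpos
  refine ⟨P.sum, ?_, ?_⟩
  · exact hP.analyticAt_of_mem (by simpa using hc.trans_le hrad)
  · have : ∀ᶠ c in 𝓝 c₀, ‖c‖ₑ < r :=
      (continuous_enorm.tendsto c₀).eventually (gt_mem_nhds hc)
    filter_upwards [this] with c hcr t
    have h1 := hP.hasSum (y := c) (by simpa using hcr.trans_le hrad)
    have h2 : HasSum (fun n => (P n fun _ => c) t) ((P.sum (0 + c)) t) :=
      h1.mapL (ContinuousMap.evalCLM ℂ t)
    have h3 : ‖c t‖ₑ < r := lt_of_le_of_lt (by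
      rw [enorm_le_iff_norm_le]; exact c.norm_coe_le_norm t) hcr
    have h4 := hf.hasSum (y := c t) (by simpa using h3)
    rw [zero_add] at h2 h4
    exact h2.unique h4

end Superposition

/-! ### Circle averages that depend analytically on parameters. -/

section CircleFamily

variable {E E' : Type*} [NormedAddCommGroup E] [NormedSpace ℂ E]
  [NormedAddCommGroup E'] [NormedSpace ℂ E']

/-- The restrictions of the functions `F z` to the circle of radius `s` around the origin depend
analytically on `z` near the origin, as continuous functions on this circle. -/
def AnalyticCircleFamily (s : ℝ) (F : E → ℂ → ℂ) : Prop :=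
  ∃ N : E → C(Metric.sphere (0 : ℂ) s, ℂ), AnalyticAt ℂ N 0 ∧ ∀ᶠ z in 𝓝 0, ∀ t, N z t = F z t

lemma AnalyticCircleFamily.mul {s : ℝ} {F G : E → ℂ → ℂ} (hF : AnalyticCircleFamily s F)
    (hG : AnalyticCircleFamily s G) : AnalyticCircleFamily s (fun z t => F z t * G z t) := by
  obtain ⟨N, hN, hNF⟩ := hF
  obtain ⟨M, hM, hMG⟩ := hG
  refine ⟨fun z => N z * M z, hN.mul hM, ?_⟩
  filter_upwards [hNF, hMG] with z h1 h2 t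
  simp [h1, h2]

lemma AnalyticCircleFamily.inv {s : ℝ} {F : E → ℂ → ℂ} (hF : AnalyticCircleFamily s F)
    (h0 : ∀ t ∈ Metric.sphere (0 : ℂ) s, F 0 t ≠ 0) :
    AnalyticCircleFamily s (fun z t => (F z t)⁻¹) := by
  obtain ⟨N, hN, hNF⟩ := hF
  have hu : IsUnit (N 0) := by
    rw [ContinuousMap.isUnit_iff_forall_ne_zero]
    intro t
    rw [hNF.self_of_nhds t]
    exact h0 t t.2
  refine ⟨fun z => Ring.inverse (N z), ?_, ?_⟩
  · obtain ⟨u, hu⟩ := hu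
    have h := analyticAt_inverse (𝕜 := ℂ) u
    rw [hu] at h
    exact h.comp hN
  · have hopen : ∀ᶠ z in 𝓝 0, IsUnit (N z) :=
      hN.continuousAt.eventually (Units.isOpen.mem_nhds hu)
    filter_upwards [hNF, hopen] with z h1 h2 t
    have h3 : Ring.inverse (N z) t * N z t = 1 := by
      rw [← ContinuousMap.mul_apply, Ring.inverse_mul_cancel _ h2, ContinuousMap.one_apply]
    rw [← h1 t]
    exact eq_inv_of_mul_eq_one_left h3

/-- The path t ↦ L z + t e depends affinely on z as a continuous function on the circle, and f acts
on it by superposition. The radius does not depend on L, which selects the parameters that f sees.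
-/
lemma exists_analyticCircleFamily_comp {f : E' → ℂ} (hf : AnalyticAt ℂ f 0) (e : E') :
    ∃ r > 0, ∀ s, 0 ≤ s → s < r → ∀ L : E →L[ℂ] E',
      AnalyticCircleFamily s (fun z t => f (L z + t • e)) := by
  obtain ⟨p, R, hR⟩ := hf
  obtain ⟨ρ, hρ, hρR⟩ : ∃ ρ : ℝ, 0 < ρ ∧ ENNReal.ofReal ρ ≤ R := by
    obtain ⟨ρ, hρ, hρR⟩ := ENNReal.lt_iff_exists_nnreal_btwn.1 hR.r_pos
    exact ⟨ρ, by exact_mod_cast hρ, by simp [hρR.le]⟩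
  -- This keeps t e inside the ball of convergence; adding 1 covers e = 0.
  refine ⟨ρ / (‖e‖ + 1), by positivity, fun s hs0 hs L => ?_⟩
  let c₀ : C(Metric.sphere (0 : ℂ) s, E') := ⟨fun t => (t : ℂ) • e, by fun_prop⟩
  have hc : ‖c₀‖ₑ < R := by
    have h1 : ‖c₀‖ ≤ s * ‖e‖ := by
      rw [ContinuousMap.norm_le _ (by positivity)]
      intro t
      have : ‖(t : ℂ)‖ = s := by simp
      simp [c₀, norm_smul, this]
    have h2 : s * ‖e‖ < ρ := by
      rw [lt_div_iff₀ (by positivity)] at hs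
      nlinarith [norm_nonneg e]
    refine lt_of_lt_of_le ?_ hρR
    rw [← ofReal_norm]
    exact (ENNReal.ofReal_lt_ofReal_iff hρ).2 (h1.trans_lt h2)
  obtain ⟨N, hN, hNf⟩ := exists_analyticAt_superposition hR c₀ hc
  let T : E → C(Metric.sphere (0 : ℂ) s, E') :=
    fun z => ContinuousLinearMap.const ℂ (Metric.sphere (0 : ℂ) s) (L z) + c₀
  have hT : AnalyticAt ℂ T 0 :=
    (((ContinuousLinearMap.const ℂ (Metric.sphere (0 : ℂ) s)).comp L).analyticAt 0).add
      analyticAt_const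
  have hT0 : T 0 = c₀ := by simp [T]
  refine ⟨fun z => N (T z), ?_, ?_⟩
  · rw [← hT0] at hN
    exact hN.comp hT
  · have := hT.continuousAt.tendsto
    rw [hT0] at this
    filter_upwards [this.eventually hNf] with z hz t
    rw [hz t]
    rfl

/-- The average over a circle, as a continuous linear map. -/
def sphereAverage {s : ℝ} (hs : 0 ≤ s) : C(Metric.sphere (0 : ℂ) s, ℂ) →L[ℂ] ℂ :=
  have hmem : ∀ θ, circleMap 0 s θ ∈ Metric.sphere (0 : ℂ) s := circleMap_mem_sphere 0 hs
  have hcont : ∀ c : C(Metric.sphere (0 : ℂ) s, ℂ), Continuous fun θ => c ⟨circleMap 0 s θ, hmem θ⟩ :=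
    fun c => c.continuous.comp ((continuous_circleMap 0 s).subtype_mk hmem)
  LinearMap.mkContinuous
    { toFun := fun c => (2 * Real.pi)⁻¹ • ∫ θ in 0..2 * Real.pi, c ⟨circleMap 0 s θ, hmem θ⟩
      map_add' := by
        intro a b
        simp only [ContinuousMap.add_apply]
        rw [intervalIntegral.integral_add ((hcont a).intervalIntegrable _ _)
          ((hcont b).intervalIntegrable _ _), smul_add]
      map_smul' := by
        intro a b
        simp only [ContinuousMap.smul_apply, smul_eq_mul, RingHom.id_apply]
        rw [intervalIntegral.integral_const_mul, mul_smul_comm] }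
    1 (by
      intro c
      have h := intervalIntegral.norm_integral_le_of_norm_le_const (a := 0) (b := 2 * Real.pi)
        (C := ‖c‖) (f := fun θ => c ⟨circleMap 0 s θ, hmem θ⟩)
        (fun θ _ => c.norm_coe_le_norm _)
      simp only [LinearMap.coe_mk, AddHom.coe_mk]
      rw [norm_smul, norm_inv, Real.norm_of_nonneg Real.two_pi_pos.le]
      rw [sub_zero, abs_of_pos Real.two_pi_pos] at h
      rw [inv_mul_le_iff₀ Real.two_pi_pos]
      linarith)

lemma AnalyticCircleFamily.analyticAt_circleAverage {s : ℝ} (hs : 0 ≤ s) {F : E → ℂ → ℂ}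
    (hF : AnalyticCircleFamily s F) :
    AnalyticAt ℂ (fun z => Real.circleAverage (F z) 0 s) 0 := by
  obtain ⟨N, hN, hNF⟩ := hF
  refine (((sphereAverage hs).analyticAt _).comp hN).congr ?_
  filter_upwards [hNF] with z hz
  simp only [Real.circleAverage, Function.comp, sphereAverage, LinearMap.mkContinuous_apply,
    LinearMap.coe_mk, AddHom.coe_mk]
  simp [hz]

/-- Only the circle around the origin has to avoid the zeros of D: invertibility is an open
condition in the Banach algebra of continuous functions on the circle, and inversion is analytic
there. -/
theorem exists_analyticAt_circleAverage_div {f D : E → ℂ} (hf : AnalyticAt ℂ f 0)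
    (hD : AnalyticAt ℂ D 0) (e : E) :
    ∃ r > 0, ∀ s, 0 ≤ s → s < r → (∀ t ∈ Metric.sphere (0 : ℂ) s, D (t • e) ≠ 0) →
      AnalyticAt ℂ
        (fun z => Real.circleAverage (fun t => f (z + t • e) / D (z + t • e)) 0 s) 0 := by
  obtain ⟨r₁, hr₁, h₁⟩ := exists_analyticCircleFamily_comp (E := E) hf e
  obtain ⟨r₂, hr₂, h₂⟩ := exists_analyticCircleFamily_comp (E := E) hD e
  refine ⟨min r₁ r₂, lt_min hr₁ hr₂, fun s hs0 hs hne => ?_⟩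
  have := ((h₁ s hs0 (hs.trans_le (min_le_left _ _)) (.id ℂ E)).mul
    ((h₂ s hs0 (hs.trans_le (min_le_right _ _)) (.id ℂ E)).inv
      (by simpa using hne))).analyticAt_circleAverage hs0
  simpa [div_eq_mul_inv] using this

/-- An analytic function vanishing on the hyperplane `ε = 0` is divisible by `ε`. -/
theorem exists_analyticAt_eq_fst_mul {f : ℂ × E → ℂ} (hf : AnalyticAt ℂ f 0)
    (h0 : ∀ᶠ p in 𝓝 (0 : E), f (0, p) = 0) :
    ∃ h : ℂ × E → ℂ, AnalyticAt ℂ h 0 ∧ ∀ᶠ z in 𝓝 0, f z = z.1 * h z := by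
  obtain ⟨r₁, hr₁, h₁⟩ := exists_analyticCircleFamily_comp (E := ℂ × E) hf (1, 0)
  obtain ⟨r₂, hr₂, h₂⟩ := exists_analyticCircleFamily_comp (E := ℂ × E)
    (f := fun t : ℂ => t) analyticAt_id 1
  obtain ⟨δ, hδ, hball⟩ := Metric.eventually_nhds_iff_ball.1 hf.eventually_analyticAt
  obtain ⟨s, hs0, hs⟩ := exists_between (lt_min (lt_min hr₁ hr₂) hδ)
  have hs1 : s < r₁ := hs.trans_le ((min_le_left _ _).trans (min_le_left _ _))
  have hs2 : s < r₂ := hs.trans_le ((min_le_left _ _).trans (min_le_right _ _))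
  have hs3 : s < δ := hs.trans_le (min_le_right _ _)
  -- The quotient f / ε will be the mean of f (t, p) / (t - ε): the first factor forgets ε, the
  -- second evaluates the identity at -ε + t.
  have hfam := (h₁ s hs0.le hs1
    ((ContinuousLinearMap.inr ℂ ℂ E).comp (ContinuousLinearMap.snd ℂ ℂ E))).mul
    ((h₂ s hs0.le hs2 (-ContinuousLinearMap.fst ℂ ℂ E)).inv (by
      intro t ht
      have : ‖t‖ = s := by simpa using ht
      simp only [map_zero, zero_add, smul_eq_mul, mul_one]
      exact norm_pos_iff.1 (this ▸ hs0)))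
  refine ⟨_, hfam.analyticAt_circleAverage hs0.le, ?_⟩
  have hsmall : ∀ᶠ z : ℂ × E in 𝓝 0, ‖z‖ < min s δ :=
    by
    filter_upwards [Metric.ball_mem_nhds (0 : ℂ × E) (lt_min hs0 hδ)] with z hz
    exact mem_ball_zero_iff.1 hz
  filter_upwards [hsmall, (continuous_snd.tendsto (0 : ℂ × E)).eventually h0] with z hz hz0
  have hzs : ‖z.1‖ < s := (norm_fst_le z).trans_lt (hz.trans_le (min_le_left _ _))
  have hzδ : ‖z.2‖ < δ := (norm_snd_le z).trans_lt (hz.trans_le (min_le_right _ _))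
  have hd : DifferentiableOn ℂ (fun t => f (t, z.2)) (Metric.ball 0 δ) := by
    intro t ht
    refine DifferentiableAt.differentiableWithinAt ?_
    have : DifferentiableAt ℂ f (t, z.2) := (hball _ (by
      simp only [mem_ball_zero_iff, Prod.norm_def, sup_lt_iff]
      exact ⟨by simpa using ht, hzδ⟩)).differentiableAt
    exact this.comp t (by fun_prop)
  have hdc : DiffContOnCl ℂ (fun t => f (t, z.2)) (Metric.ball 0 |s|) := by
    rw [abs_of_pos hs0]
    exact (hd.mono (Metric.closedBall_subset_ball hs3)).diffContOnCl_ball subset_rfl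
  -- By Cauchy's formula the mean of t f (t, p) / (t - ε) is f (ε, p), while the mean of f (t, p) is
  -- f (0, p) = 0. Their difference is ε times the mean of f (t, p) / (t - ε).
  have e1 := hdc.circleAverage_smul_div (w := z.1) (by simpa [abs_of_pos hs0] using hzs)
  have e2 := hdc.circleAverage
  have hne : ∀ t ∈ Metric.sphere (0 : ℂ) |s|, t - z.1 ≠ 0 := by
    intro t ht h
    have : ‖t‖ = s := by simpa [abs_of_pos hs0] using ht
    rw [sub_eq_zero.1 h] at this
    linarith
  have hcs : ContinuousOn (fun t => f (t, z.2)) (Metric.sphere 0 |s|) :=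
    hd.continuousOn.mono (by
      rw [abs_of_pos hs0]
      exact Metric.sphere_subset_closedBall.trans (Metric.closedBall_subset_ball hs3))
  have i1 : CircleIntegrable (fun t => ((t - 0) / (t - z.1)) • f (t, z.2)) 0 s :=
    ContinuousOn.circleIntegrable' (((continuousOn_id.sub continuousOn_const).div
      (continuousOn_id.sub continuousOn_const) hne).smul hcs)
  have i2 : CircleIntegrable (fun t => f (t, z.2)) 0 s := hcs.circleIntegrable'
  have e3 := Real.circleAverage_sub i1 i2
  rw [e1, e2, hz0, sub_zero] at e3
  have e4 : f z = f (z.1, z.2) := rfl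
  rw [e4, ← e3, ← smul_eq_mul, ← Real.circleAverage_smul]
  apply Real.circleAverage_congr_sphere
  intro t ht
  have h1 := hne t ht
  have h2 : -z.1 + t ≠ 0 := by rwa [neg_add_eq_sub]
  simp only [Pi.sub_apply, Pi.smul_apply, smul_eq_mul, ContinuousLinearMap.comp_apply,
    ContinuousLinearMap.inr_apply, ContinuousLinearMap.coe_snd', Prod.smul_mk, mul_one, smul_zero,
    Prod.mk_add_mk, zero_add, add_zero, neg_apply,
    ContinuousLinearMap.coe_fst', sub_zero]
  field_simp
  ring

end CircleFamily

/-! ### Division of germs by Cauchy integrals along a line. -/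

section Division

variable {E F : Type*} [NormedAddCommGroup E] [NormedSpace ℂ E]
  [NormedAddCommGroup F] [NormedSpace ℂ F]

lemma exists_ball_line {P : E → Prop} (h : ∀ᶠ z in 𝓝 0, P z) (e : E) :
    ∃ r > 0, ∀ s, s < r → ∀ᶠ z in 𝓝 (0 : E), ∀ t : ℂ, ‖t‖ ≤ s → P (z + t • e) := by
  obtain ⟨δ, hδ, hball⟩ := Metric.eventually_nhds_iff_ball.1 h
  refine ⟨δ / 2 / (‖e‖ + 1), by positivity, fun s hs => ?_⟩
  filter_upwards [Metric.ball_mem_nhds (0 : E) (half_pos hδ)] with z hz t ht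
  refine hball _ (mem_ball_zero_iff.2 ?_)
  have h1 : s * ‖e‖ ≤ δ / 2 := by
    rw [lt_div_iff₀ (by positivity)] at hs
    rcases le_or_gt s 0 with h | h
    · nlinarith [norm_nonneg e]
    · nlinarith [norm_nonneg e]
  calc ‖z + t • e‖ ≤ ‖z‖ + ‖t‖ * ‖e‖ := by rw [← norm_smul]; exact norm_add_le _ _
    _ < δ / 2 + s * ‖e‖ := by
        have := mem_ball_zero_iff.1 hz
        have := mul_le_mul_of_nonneg_right ht (norm_nonneg e)
        linarith
    _ ≤ δ := by linarith

lemma eventually_forall_mem_ne_zero {D : E → ℂ} {e : E} {S : Set ℂ} (hS : IsCompact S)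
    (hD : ∀ t ∈ S, ContinuousAt D (t • e)) (hne : ∀ t ∈ S, D (t • e) ≠ 0) :
    ∀ᶠ z in 𝓝 (0 : E), ∀ t ∈ S, D (z + t • e) ≠ 0 := by
  refine hS.eventually_forall_of_forall_eventually fun t ht => ?_
  have h1 : Tendsto (fun p : E × ℂ => p.1 + p.2 • e) (𝓝 (0, t)) (𝓝 (t • e)) := by
    have : Continuous fun p : E × ℂ => p.1 + p.2 • e := by fun_prop
    simpa using this.tendsto (0, t)
  exact h1.eventually ((hD t ht).eventually_ne (hne t ht))

lemma exists_radius_ne_zero {D : E → ℂ} {e : E} (h : ∀ᶠ t : ℂ in 𝓝[≠] 0, D (t • e) ≠ 0) :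
    ∃ r > 0, ∀ t : ℂ, t ≠ 0 → ‖t‖ < r → D (t • e) ≠ 0 := by
  rw [eventually_nhdsWithin_iff, Metric.eventually_nhds_iff_ball] at h
  obtain ⟨r, hr, h⟩ := h
  exact ⟨r, hr, fun t h0 ht => h t (mem_ball_zero_iff.2 ht) h0⟩

/-- A quotient of analytic functions that extends holomorphically to all lines with direction `e`,
a direction on which the denominator does not vanish identically, is analytic. -/
theorem analyticAt_of_eq_mul {A D K : E → ℂ} (hA : AnalyticAt ℂ A 0) (hD : AnalyticAt ℂ D 0)
    {e : E} (hDe : ∀ᶠ t : ℂ in 𝓝[≠] 0, D (t • e) ≠ 0)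
    (hK : ∀ᶠ z in 𝓝 0, DifferentiableAt ℂ (fun t : ℂ => K (z + t • e)) 0)
    (hAK : ∀ᶠ z in 𝓝 0, A z = D z * K z) : AnalyticAt ℂ K 0 := by
  obtain ⟨r₁, hr₁, h₁⟩ := exists_analyticAt_circleAverage_div hA hD e
  obtain ⟨r₂, hr₂, h₂⟩ := exists_radius_ne_zero hDe
  obtain ⟨r₃, hr₃, h₃⟩ := exists_ball_line (hD.eventually_analyticAt.and (hK.and hAK)) e
  obtain ⟨s, hs0, hs⟩ := exists_between (lt_min (lt_min hr₁ hr₂) hr₃)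
  have hs1 : s < r₁ := hs.trans_le ((min_le_left _ _).trans (min_le_left _ _))
  have hs2 : s < r₂ := hs.trans_le ((min_le_left _ _).trans (min_le_right _ _))
  have hs3 : s < r₃ := hs.trans_le (min_le_right _ _)
  have hne : ∀ t ∈ Metric.sphere (0 : ℂ) s, D (t • e) ≠ 0 := by
    intro t ht
    have ht' : ‖t‖ = s := by simpa using ht
    exact h₂ t (norm_pos_iff.1 (ht' ▸ hs0)) (ht' ▸ hs2)
  have hcont : ∀ t ∈ Metric.sphere (0 : ℂ) s, ContinuousAt D (t • e) := by
    intro t ht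
    have ht' : ‖t‖ = s := by simpa using ht
    have := ((h₃ s hs3).self_of_nhds t ht'.le).1
    rw [zero_add] at this
    exact this.continuousAt
  -- By the mean value property K z is the mean of K on a circle in the direction e, where D has no
  -- zero and K = A / D.
  refine (h₁ s hs0.le hs1 hne).congr ?_
  filter_upwards [h₃ s hs3, eventually_forall_mem_ne_zero (isCompact_sphere 0 s) hcont hne]
    with z hz hzne
  have hdc : DiffContOnCl ℂ (fun t : ℂ => K (z + t • e)) (Metric.ball 0 |s|) := by
    rw [abs_of_pos hs0]
    refine DifferentiableOn.diffContOnCl_ball (U := Metric.closedBall 0 s) ?_ subset_rfl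
    intro t ht
    refine DifferentiableAt.differentiableWithinAt ?_
    have h := (hz t (by simpa using ht)).2.1
    -- The hypothesis gives differentiability at parameter 0 only; moving the base point along the
    -- line gives it at every t.
    have h2 : DifferentiableAt ℂ (fun t' : ℂ => K (z + t • e + t' • e)) (t - t) := by
      rwa [sub_self]
    have h3 := DifferentiableAt.comp (f := fun t' : ℂ => t' - t) t h2
      (differentiableAt_id.sub_const t)
    refine h3.congr_of_eventuallyEq (Eventually.of_forall fun t' => ?_)
    simp only [Function.comp, sub_smul]
    congr 1
    abel
  have h4 := hdc.circleAverage
  simp only [zero_smul, add_zero] at h4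
  rw [← h4]
  apply Real.circleAverage_congr_sphere
  intro t ht
  rw [abs_of_pos hs0] at ht
  have ht' : ‖t‖ = s := by simpa using ht
  have h5 := (hz t ht'.le).2.2
  simp only
  rw [h5, mul_div_cancel_left₀ _ (hzne t ht)]

/-- The first nonzero homogeneous term of the Taylor series, of degree n, would be O(‖y‖ ^ (n + 1)).
-/
lemma eventually_eq_zero_of_forall_isBigO {f : E → F} (hf : AnalyticAt ℂ f 0)
    (h : ∀ n : ℕ, f =O[𝓝 0] fun y => ‖y‖ ^ n) : ∀ᶠ z in 𝓝 0, f z = 0 := by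
  obtain ⟨p, hp⟩ := hf
  have key : ∀ n : ℕ, ∀ y : E, p n (fun _ => y) = 0 := by
    intro n
    induction n using Nat.strong_induction_on with
    | _ n ih =>
      refine Asymptotics.IsBigO.continuousMultilinearMap_apply_eq_zero ?_
      have h1 := hp.isBigO_sub_partialSum_pow (n + 1)
      simp only [zero_add] at h1
      have h2 : ∀ y : E, p.partialSum (n + 1) y = p n fun _ => y := by
        intro y
        rw [FormalMultilinearSeries.partialSum, Finset.sum_range_succ,
          Finset.sum_eq_zero fun k hk => ih k (Finset.mem_range.1 hk) y, zero_add]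
      simp only [h2] at h1
      simpa using (h (n + 1)).sub h1
  obtain ⟨r, hr⟩ := hp
  filter_upwards [Metric.eball_mem_nhds (0 : E) hr.r_pos] with z hz
  have h1 := hr.hasSum hz
  simp only [key, zero_add] at h1
  exact (h1.unique hasSum_zero)

/-- Krull intersection for the ideal of multiples of `D` in the powers of a linear form, for germs
of analytic functions. -/
theorem exists_analyticAt_eq_mul {f D : E → ℂ} (hf : AnalyticAt ℂ f 0) (hD : AnalyticAt ℂ D 0)
    {e : E} (hDe : ∀ᶠ t : ℂ in 𝓝[≠] 0, D (t • e) ≠ 0) (l : E →L[ℂ] ℂ) (hl : l e = 0)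
    (h : ∀ n : ℕ, ∃ q r : E → ℂ, AnalyticAt ℂ q 0 ∧ AnalyticAt ℂ r 0 ∧
      ∀ᶠ z in 𝓝 0, f z = q z * D z + l z ^ n * r z) :
    ∃ q : E → ℂ, AnalyticAt ℂ q 0 ∧ ∀ᶠ z in 𝓝 0, f z = q z * D z := by
  obtain ⟨r₁, hr₁, h₁⟩ := exists_analyticAt_circleAverage_div hf hD e
  obtain ⟨r₂, hr₂, h₂⟩ := exists_radius_ne_zero hDe
  obtain ⟨r₃, hr₃, h₃⟩ := exists_ball_line (hf.eventually_analyticAt.and hD.eventually_analyticAt) e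
  obtain ⟨s, hs0, hs⟩ := exists_between (lt_min (lt_min hr₁ hr₂) hr₃)
  have hs1 : s < r₁ := hs.trans_le ((min_le_left _ _).trans (min_le_left _ _))
  have hs2 : s < r₂ := hs.trans_le ((min_le_left _ _).trans (min_le_right _ _))
  have hs3 : s < r₃ := hs.trans_le (min_le_right _ _)
  have hne : ∀ t : ℂ, t ≠ 0 → ‖t‖ ≤ s → D (t • e) ≠ 0 := fun t h0 ht =>
    h₂ t h0 (ht.trans_lt hs2)
  have hsph : ∀ {s' : ℝ}, 0 < s' → s' ≤ s → ∀ t ∈ Metric.sphere (0 : ℂ) s', D (t • e) ≠ 0 := by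
    intro s' h0 h1 t ht
    have ht' : ‖t‖ = s' := by simpa using ht
    exact hne t (norm_pos_iff.1 (ht' ▸ h0)) (ht' ▸ h1)
  -- The candidate does not depend on n; the difference f - q D will be shown to vanish to every
  -- order.
  set q : E → ℂ := fun z => Real.circleAverage (fun t => f (z + t • e) / D (z + t • e)) 0 s
    with hq
  have hqa : AnalyticAt ℂ q 0 := h₁ s hs0.le hs1 (hsph hs0 le_rfl)
  refine ⟨q, hqa, ?_⟩
  have hR : AnalyticAt ℂ (fun z => f z - q z * D z) 0 := hf.sub (hqa.mul hD)
  suffices H : ∀ᶠ z in 𝓝 0, f z - q z * D z = 0 by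
    filter_upwards [H] with z hz
    exact sub_eq_zero.1 hz
  refine eventually_eq_zero_of_forall_isBigO hR fun n => ?_
  -- The domain of `qn` and `rn` may shrink with n, so they are integrated over a smaller circle, of
  -- a radius depending on n.
  obtain ⟨qn, rn, hqn, hrn, hfn⟩ := h n
  obtain ⟨ρ₁, hρ₁, g₁⟩ := exists_analyticAt_circleAverage_div hrn hD e
  obtain ⟨ρ₂, hρ₂, g₂⟩ := exists_ball_line
    (hfn.and (hqn.eventually_analyticAt.and hrn.eventually_analyticAt)) e
  obtain ⟨s', hs0', hs'⟩ := exists_between (lt_min (lt_min hρ₁ hρ₂) hs0)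
  have hs1' : s' < ρ₁ := hs'.trans_le ((min_le_left _ _).trans (min_le_left _ _))
  have hs2' : s' < ρ₂ := hs'.trans_le ((min_le_left _ _).trans (min_le_right _ _))
  have hs3' : s' < s := hs'.trans_le (min_le_right _ _)
  set a : E → ℂ := fun z => Real.circleAverage (fun t => rn (z + t • e) / D (z + t • e)) 0 s'
  have ha : AnalyticAt ℂ a 0 := g₁ s' hs0'.le hs1' (hsph hs0' hs3'.le)
  set S : Set ℂ := Metric.closedBall 0 s \ Metric.ball 0 s' with hS
  have hScomp : IsCompact S := (isCompact_closedBall _ _).diff Metric.isOpen_ball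
  have hSprop : ∀ t ∈ S, t ≠ 0 ∧ ‖t‖ ≤ s := by
    intro t ht
    have h1 : ‖t‖ ≤ s := by simpa using ht.1
    have h2 : s' ≤ ‖t‖ := by simpa using ht.2
    exact ⟨norm_pos_iff.1 (hs0'.trans_le h2), h1⟩
  have hcont : ∀ t ∈ S, ContinuousAt D (t • e) := by
    intro t ht
    have := ((h₃ s hs3).self_of_nhds t (hSprop t ht).2).2
    rw [zero_add] at this
    exact this.continuousAt
  have hcmp : ∀ᶠ z in 𝓝 0, f z - q z * D z = l z ^ n * (rn z - a z * D z) := by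
    filter_upwards [h₃ s hs3, g₂ s' hs2', eventually_forall_mem_ne_zero hScomp hcont
      (fun t ht => hne t (hSprop t ht).1 (hSprop t ht).2)] with z hz3 hz2 hzne
    have hdiff : ∀ t : ℂ, ‖t‖ ≤ s → D (z + t • e) ≠ 0 →
        DifferentiableAt ℂ (fun t : ℂ => f (z + t • e) / D (z + t • e)) t := by
      intro t ht h0
      have hline : DifferentiableAt ℂ (fun t : ℂ => z + t • e) t := by fun_prop
      exact ((hz3 t ht).1.differentiableAt.comp t hline).div
        ((hz3 t ht).2.differentiableAt.comp t hline) h0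
    -- D has no zero on the annulus between the two circles, so f / D has the same mean on both.
    have e1 : q z = Real.circleAverage (fun t => f (z + t • e) / D (z + t • e)) 0 s' := by
      rw [hq]
      simp only
      rw [Real.circleAverage_eq_circleIntegral hs0.ne',
        Real.circleAverage_eq_circleIntegral hs0'.ne']
      congr 1
      refine Complex.circleIntegral_sub_center_inv_smul_eq_of_differentiable_on_annulus_off_countable
        hs0' hs3'.le Set.countable_empty ?_ ?_
      · intro t ht
        exact (hdiff t (hSprop t ht).2 (hzne t ht)).continuousAt.continuousWithinAt
      · intro t ht
        have ht' : t ∈ S := ⟨Metric.ball_subset_closedBall ht.1.1,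
          fun h => ht.1.2 (Metric.ball_subset_closedBall h)⟩
        exact hdiff t (hSprop t ht').2 (hzne t ht')
    have hdc : DiffContOnCl ℂ (fun t : ℂ => qn (z + t • e)) (Metric.ball 0 |s'|) := by
      rw [abs_of_pos hs0']
      refine DifferentiableOn.diffContOnCl_ball (U := Metric.closedBall 0 s') ?_ subset_rfl
      intro t ht
      have hline : DifferentiableAt ℂ (fun t : ℂ => z + t • e) t := by fun_prop
      exact ((hz2 t (by simpa using ht)).2.1.differentiableAt.comp t
        hline).differentiableWithinAt
    have e2 := hdc.circleAverage
    simp only [zero_smul, add_zero] at e2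
    have hsub : ∀ t ∈ Metric.sphere (0 : ℂ) |s'|, ‖t‖ = s' ∧ t ∈ S := by
      intro t ht
      have : ‖t‖ = s' := by simpa [abs_of_pos hs0'] using ht
      exact ⟨this, by simp [hS, this, hs3'.le]⟩
    have i1 : CircleIntegrable (fun t : ℂ => qn (z + t • e)) 0 s' := by
      refine ContinuousOn.circleIntegrable' fun t ht => ?_
      have hline : ContinuousAt (fun t : ℂ => z + t • e) t := by fun_prop
      exact (ContinuousAt.comp (f := fun t : ℂ => z + t • e) (x := t) (g := qn) (hz2 t (hsub t ht).1.le).2.1.continuousAt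
        hline).continuousWithinAt
    have i2 : CircleIntegrable (l z ^ n • fun t : ℂ => rn (z + t • e) / D (z + t • e)) 0 s' := by
      refine ContinuousOn.circleIntegrable' fun t ht => ?_
      have hline : ContinuousAt (fun t : ℂ => z + t • e) t := by fun_prop
      have c1 := ContinuousAt.comp (f := fun t : ℂ => z + t • e) (x := t) (g := rn) (hz2 t (hsub t ht).1.le).2.2.continuousAt hline
      have c2 := ContinuousAt.comp (f := fun t : ℂ => z + t • e) (x := t) (g := D)
        (hz3 t ((hsub t ht).1.le.trans hs3'.le)).2.continuousAt hline
      exact ((c1.div c2 (hzne t (hsub t ht).2)).const_smul _).continuousWithinAt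
    -- Since l e = 0, the factor l ^ n is constant along the line and leaves the mean of f / D = qn
    -- + l ^ n rn / D.
    have e3 : q z = qn z + l z ^ n * a z := by
      rw [e1, ← e2, ← smul_eq_mul, ← Real.circleAverage_smul, ← Real.circleAverage_add i1 i2]
      apply Real.circleAverage_congr_sphere
      intro t ht
      have h0 := hzne t (hsub t ht).2
      have h1 := (hz2 t (hsub t ht).1.le).1
      simp only [Pi.add_apply, Pi.smul_apply, smul_eq_mul]
      rw [h1, map_add, map_smul, hl]
      simp only [smul_zero, add_zero]
      field_simp
    have h4 := (hz2 0 (by simpa using hs0'.le)).1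
    simp only [zero_smul, add_zero] at h4
    rw [e3, h4]
    ring
  have hO1 : (fun z => l z ^ n) =O[𝓝 0] fun y : E => ‖y‖ ^ n := by
    simpa using (l.isBigO_id (𝓝 0)).norm_right.pow n
  have hO2 : (fun z => rn z - a z * D z) =O[𝓝 0] fun _ : E => (1 : ℝ) :=
    (hrn.sub (ha.mul hD)).continuousAt.isBigO_one ℝ
  refine Asymptotics.IsBigO.congr' (by simpa using hO1.mul hO2) ?_ EventuallyEq.rfl
  filter_upwards [hcmp] with z hz
  exact hz.symm

/-- The ring of germs of analytic functions has no zero divisors. -/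
theorem eventually_eq_zero_or_of_mul {f g : E → ℂ} {p : E} (hf : AnalyticAt ℂ f p)
    (hg : AnalyticAt ℂ g p) (h : ∀ᶠ z in 𝓝 p, f z * g z = 0) :
    (∀ᶠ z in 𝓝 p, f z = 0) ∨ ∀ᶠ z in 𝓝 p, g z = 0 := by
  by_contra! hcon
  obtain ⟨hf0, hg0⟩ := hcon
  obtain ⟨δ, hδ, hball⟩ := Metric.eventually_nhds_iff_ball.1
    (h.and (hf.eventually_analyticAt.and hg.eventually_analyticAt))
  obtain ⟨z, hfz, hz⟩ := (hf0.and_eventually (Metric.ball_mem_nhds p hδ)).exists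
  have hgz : g =ᶠ[𝓝 z] 0 := by
    filter_upwards [(hball z hz).2.1.continuousAt.eventually_ne hfz,
      Metric.isOpen_ball.mem_nhds hz] with w hw hwb
    exact (mul_eq_zero.1 (hball w hwb).1).resolve_left hw
  have hga : AnalyticOnNhd ℂ g (Metric.ball p δ) := fun w hw => (hball w hw).2.2
  have := hga.eqOn_zero_of_preconnected_of_eventuallyEq_zero
    (convex_ball p δ).isPreconnected hz hgz
  refine hg0 ?_
  filter_upwards [Metric.ball_mem_nhds p hδ] with w hw using not_not.2 (this hw)

end Division

/-! ### Algebra: poles of solutions of a linear equation, modulo powers of ε. -/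

section DerivationDivisibility

variable {R : Type*} [CommRing R] (δ : Derivation ℤ R R)

lemma mul_derivation_pow (g : R) (j : ℕ) : g * δ (g ^ j) = j * g ^ j * δ g := by
  cases j with
  | zero => simp
  | succ j =>
    rw [Derivation.leibniz_pow]
    simp only [nsmul_eq_mul, smul_eq_mul, Nat.add_sub_cancel]
    ring

variable {δ} {ε g u D : R} {m : ℕ}

/-- The condition `hp` is the only part of the primality of ε that is needed. -/
lemma dvd_of_dvd_pow_mul (hp : ∀ a b, ε ∣ a * b → ε ∣ a ∨ ε ∣ b) (hg : ¬ ε ∣ g) (n : ℕ) (a : R)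
    (h : ε ∣ g ^ n * a) : ε ∣ a := by
  induction n with
  | zero => simpa using h
  | succ n ih =>
    rw [pow_succ', mul_assoc] at h
    exact ih ((hp _ _ h).resolve_left hg)

/-- Reduction of the differential equation modulo ε. It is applied to the equation multiplied by g,
with g δ r and g δ D in the roles of x and y, so that no exponent j - 1 appears. -/
lemma remainder_dvd {D₀ d r₀ w A a B b x y e K r : R} (hD : D = D₀ + ε * d) (hr : r = r₀ + ε * w)
    (hx : x = A + ε * a) (hy : y = B + ε * b) (h : D * x - r * y + e * D * r = D ^ 2 * K) :
    ε ∣ D₀ * A - r₀ * B + e * D₀ * r₀ - D₀ ^ 2 * K := by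
  subst hD hr hx hy
  exact ⟨-(d * A + (D₀ + ε * d) * a - w * B - (r₀ + ε * w) * b
    + e * (d * r₀ + (D₀ + ε * d) * w)) + (2 * D₀ * d + ε * d ^ 2) * K, by linear_combination h⟩

/-- If `D` is `g ^ m` up to a unit modulo `ε`, and `δ g` is a unit, then a first order linear equation
for `r / D` forces `r` to be divisible by `D` modulo `ε`. -/
lemma exists_eq_mul_add_mul (hε : δ ε = 0) (hp : ∀ a b, ε ∣ a * b → ε ∣ a ∨ ε ∣ b)
    (hg : ¬ ε ∣ g) (hu : IsUnit u) (hδg : IsUnit (δ g))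
    (hm : ∀ j : ℕ, j < m → IsUnit ((j : R) - m)) (hD : ε ∣ D - g ^ m * u) {r e K : R}
    (h : D * δ r - r * δ D + e * D * r = D ^ 2 * K) : ∃ s w, r = D * s + ε * w := by
  obtain ⟨d, hd⟩ := hD
  have hd' : D = g ^ m * u + ε * d := by linear_combination hd
  -- If j < m and r is g ^ j s modulo ε, then r / D has a pole of order at most m - j, and the
  -- lowest order terms of the equation are (j - m) u δ(g) s. The right hand side has no pole, so g
  -- divides this term modulo ε; its coefficient is a unit, so g divides s.
  have key : ∀ j ≤ m, ∃ s w, r = g ^ j * s + ε * w := by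
    intro j hj
    induction j with
    | zero => exact ⟨r, 0, by simp⟩
    | succ j ih =>
      obtain ⟨s, w, hr⟩ := ih (by lia)
      have hjm := hm j (by lia)
      have h1 : g * δ r = j * g ^ j * δ g * s + g ^ (j + 1) * δ s + ε * (g * δ w) := by
        have := mul_derivation_pow δ g j
        rw [hr, map_add, Derivation.leibniz, Derivation.leibniz, hε]
        simp only [smul_eq_mul]
        linear_combination s * this
      have h2 : g * δ D = m * g ^ m * δ g * u + g ^ (m + 1) * δ u + ε * (g * δ d) := by
        have := mul_derivation_pow δ g m
        rw [hd', map_add, Derivation.leibniz, Derivation.leibniz, hε]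
        simp only [smul_eq_mul]
        linear_combination u * this
      obtain ⟨i, rfl⟩ : ∃ i, m = j + i := ⟨m - j, by lia⟩
      have h3 : ε ∣ g ^ (j + i + j) * (((j : R) - ((j + i : ℕ) : R)) * (u * δ g) * s
          + g * (u * δ s - s * δ u + e * u * s - g ^ i * u ^ 2 * K)) := by
        have h4 := remainder_dvd (ε := ε) (K := g * K) (e := g * e) hd' hr h1 h2
          (by linear_combination g * h)
        refine h4.trans (dvd_of_eq ?_)
        ring
      obtain ⟨c, hc⟩ := dvd_of_dvd_pow_mul hp hg _ _ h3
      obtain ⟨v, hv⟩ := ((hjm.mul (hu.mul hδg)).exists_left_inv)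
      refine ⟨-(v * (u * δ s - s * δ u + e * u * s - g ^ i * u ^ 2 * K)), g ^ j * v * c + w, ?_⟩
      linear_combination hr + g ^ j * v * hc - g ^ j * s * hv
  obtain ⟨s, w, hr⟩ := key m le_rfl
  -- Modulo ε, g ^ m is D divided by u.
  obtain ⟨v, hv⟩ := hu.exists_left_inv
  exact ⟨v * s, w - d * (v * s), by linear_combination hr - g ^ m * s * hv - v * s * hd'⟩

/-- The equation reproduces itself: replacing r = D s + ε w by w removes the multiple D s, which
contributes D² (δ s + e s), and divides by ε. This is legitimate because δ ε = 0 and ε is a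
nonzerodivisor. -/
theorem exists_eq_mul_add_pow_mul (hε : δ ε = 0) (hreg : ∀ a, ε * a = 0 → a = 0)
    (hp : ∀ a b, ε ∣ a * b → ε ∣ a ∨ ε ∣ b)
    (hg : ¬ ε ∣ g) (hu : IsUnit u) (hδg : IsUnit (δ g))
    (hm : ∀ j : ℕ, j < m → IsUnit ((j : R) - m)) (hD : ε ∣ D - g ^ m * u) {f e K : R}
    (h : D * δ f - f * δ D + e * D * f = D ^ 2 * K) (n : ℕ) :
    ∃ q r, f = q * D + ε ^ n * r := by
  have hεD : ¬ ε ∣ D := by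
    intro h1
    have h2 : ε ∣ g ^ m * u := by simpa using dvd_sub h1 hD
    obtain ⟨v, hv⟩ := hu.exists_right_inv
    refine hg ?_
    have h3 := dvd_of_dvd_pow_mul hp hg m _ h2
    exact (h3.mul_right v).trans (by rw [hv]; exact one_dvd g)
  suffices H : ∃ q r K', f = q * D + ε ^ n * r ∧
      D * δ r - r * δ D + e * D * r = D ^ 2 * K' by
    obtain ⟨q, r, _, h, _⟩ := H
    exact ⟨q, r, h⟩
  induction n with
  | zero => exact ⟨0, f, K, by simp, h⟩
  | succ n ih =>
    obtain ⟨q, r, K', h1, h2⟩ := ih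
    obtain ⟨s, w, hr⟩ := exists_eq_mul_add_mul hε hp hg hu hδg hm hD h2
    have h3 : δ r = D * δ s + s * δ D + ε * δ w := by
      rw [hr, map_add, Derivation.leibniz, Derivation.leibniz, hε]
      simp only [smul_eq_mul]
      ring
    have h4 : ε * (D * δ w - w * δ D + e * D * w) = D ^ 2 * (K' - δ s - e * s) := by
      rw [h3, hr] at h2
      linear_combination h2
    -- Primality of ε, which does not divide D, moves the divisibility to the new right hand side.
    obtain ⟨K'', hK⟩ : ε ∣ K' - δ s - e * s := by
      have h5 : ε ∣ D ^ 2 * (K' - δ s - e * s) := ⟨_, h4.symm⟩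
      exact dvd_of_dvd_pow_mul hp hεD 2 _ h5
    refine ⟨q + ε ^ n * s, w, K'', ?_, ?_⟩
    · rw [h1, hr]; ring
    · rw [hK] at h4
      exact sub_eq_zero.1 (hreg _ (by linear_combination h4))

end DerivationDivisibility

/-! ### The ring of analytic germs and its derivations. -/

section GermRing

variable (E : Type*) [NormedAddCommGroup E] [NormedSpace ℂ E]

/-- The ring of germs at the origin of analytic functions. -/
def analyticGerm : Subring (Germ (𝓝 (0 : E)) ℂ) where
  carrier := {γ | ∃ F : E → ℂ, AnalyticAt ℂ F 0 ∧ γ = (F : Germ (𝓝 (0 : E)) ℂ)}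
  mul_mem' := by
    rintro _ _ ⟨F, hF, rfl⟩ ⟨G, hG, rfl⟩
    exact ⟨F * G, hF.mul hG, rfl⟩
  one_mem' := ⟨1, analyticAt_const, rfl⟩
  add_mem' := by
    rintro _ _ ⟨F, hF, rfl⟩ ⟨G, hG, rfl⟩
    exact ⟨F + G, hF.add hG, rfl⟩
  zero_mem' := ⟨0, analyticAt_const, rfl⟩
  neg_mem' := by
    rintro _ ⟨F, hF, rfl⟩
    exact ⟨-F, hF.neg, rfl⟩

variable {E}

/-- The germ of an analytic function. -/
def toGerm (F : E → ℂ) (hF : AnalyticAt ℂ F 0) : analyticGerm E := ⟨F, F, hF, rfl⟩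

lemma exists_toGerm (a : analyticGerm E) : ∃ F hF, a = toGerm F hF := by
  obtain ⟨_, F, hF, rfl⟩ := a
  exact ⟨F, hF, rfl⟩

lemma toGerm_eq_iff {F G : E → ℂ} {hF : AnalyticAt ℂ F 0} {hG : AnalyticAt ℂ G 0} :
    toGerm F hF = toGerm G hG ↔ ∀ᶠ z in 𝓝 0, F z = G z := by
  refine Subtype.ext_iff.trans ?_
  change (F : Germ (𝓝 (0 : E)) ℂ) = (G : Germ (𝓝 (0 : E)) ℂ) ↔ _
  rw [Germ.coe_eq]
  rfl

lemma toGerm_mul {F G : E → ℂ} (hF : AnalyticAt ℂ F 0) (hG : AnalyticAt ℂ G 0) :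
    toGerm F hF * toGerm G hG = toGerm (fun z => F z * G z) (hF.mul hG) := rfl

lemma toGerm_add {F G : E → ℂ} (hF : AnalyticAt ℂ F 0) (hG : AnalyticAt ℂ G 0) :
    toGerm F hF + toGerm G hG = toGerm (fun z => F z + G z) (hF.add hG) := rfl

lemma toGerm_sub {F G : E → ℂ} (hF : AnalyticAt ℂ F 0) (hG : AnalyticAt ℂ G 0) :
    toGerm F hF - toGerm G hG = toGerm (fun z => F z - G z) (hF.sub hG) := rfl

lemma toGerm_pow {F : E → ℂ} (hF : AnalyticAt ℂ F 0) (n : ℕ) :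
    toGerm F hF ^ n = toGerm (fun z => F z ^ n) (hF.pow n) := rfl

lemma toGerm_zero : (0 : analyticGerm E) = toGerm (fun _ => 0) analyticAt_const := rfl

lemma toGerm_one : (1 : analyticGerm E) = toGerm (fun _ => 1) analyticAt_const := rfl

lemma natCast_eq_toGerm (n : ℕ) : (n : analyticGerm E) = toGerm (fun _ => (n : ℂ))
    analyticAt_const := rfl

lemma isUnit_toGerm {F : E → ℂ} (hF : AnalyticAt ℂ F 0) (h0 : F 0 ≠ 0) :
    IsUnit (toGerm F hF) := by
  refine IsUnit.of_mul_eq_one (toGerm (fun z => (F z)⁻¹) (hF.inv h0)) ?_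
  rw [toGerm_mul, toGerm_one, toGerm_eq_iff]
  filter_upwards [hF.continuousAt.eventually_ne h0] with z hz using mul_inv_cancel₀ hz

/-- The derivative of a function along a vector field. -/
def fieldDeriv (ξ : E → E) (F : E → ℂ) (z : E) : ℂ := fderiv ℂ F z (ξ z)

lemma _root_.AnalyticAt.fieldDeriv {ξ : E → E} {F : E → ℂ} {z : E} (hF : AnalyticAt ℂ F z)
    (hξ : AnalyticAt ℂ ξ z) : AnalyticAt ℂ (fieldDeriv ξ F) z :=
  ((ContinuousLinearMap.id ℂ (E →L[ℂ] ℂ)).analyticAt_bilinear (fderiv ℂ F z, ξ z)).comp₂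
    hF.fderiv hξ

/-- The derivation of the ring of germs of analytic functions defined by a vector field. -/
def germDerivation (ξ : E → E) (hξ : AnalyticAt ℂ ξ 0) :
    Derivation ℤ (analyticGerm E) (analyticGerm E) :=
  let d : Germ (𝓝 (0 : E)) ℂ → Germ (𝓝 (0 : E)) ℂ := fun γ =>
    γ.liftOn (fun F => ((fieldDeriv ξ F : E → ℂ) : Germ (𝓝 (0 : E)) ℂ)) (by
      intro F G h
      rw [Germ.coe_eq]
      filter_upwards [EventuallyEq.fderiv (𝕜 := ℂ) h] with z hz
      simp [fieldDeriv, hz])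
  Derivation.mk' (AddMonoidHom.toIntLinearMap
    { toFun := fun a => ⟨d a, by
        obtain ⟨_, F, hF, rfl⟩ := a
        exact ⟨_, hF.fieldDeriv hξ, rfl⟩⟩
      map_zero' := by
        rw [toGerm_zero]
        refine Subtype.ext ?_
        change ((fieldDeriv ξ fun _ => 0 : E → ℂ) : Germ (𝓝 (0 : E)) ℂ) = ((fun _ => 0 : E → ℂ) : _)
        rw [Germ.coe_eq]
        exact Eventually.of_forall fun z => by simp [fieldDeriv]
      map_add' := by
        rintro ⟨_, F, hF, rfl⟩ ⟨_, G, hG, rfl⟩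
        refine Subtype.ext ?_
        change ((fieldDeriv ξ (F + G) : E → ℂ) : Germ (𝓝 (0 : E)) ℂ)
          = ((fieldDeriv ξ F + fieldDeriv ξ G : E → ℂ) : Germ (𝓝 (0 : E)) ℂ)
        rw [Germ.coe_eq]
        filter_upwards [hF.eventually_analyticAt, hG.eventually_analyticAt] with z h1 h2
        simp [fieldDeriv, fderiv_add h1.differentiableAt h2.differentiableAt] })
    (by
      rintro ⟨_, F, hF, rfl⟩ ⟨_, G, hG, rfl⟩
      refine Subtype.ext ?_
      change ((fieldDeriv ξ (F * G) : E → ℂ) : Germ (𝓝 (0 : E)) ℂ)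
        = ((F * fieldDeriv ξ G + G * fieldDeriv ξ F : E → ℂ) : Germ (𝓝 (0 : E)) ℂ)
      rw [Germ.coe_eq]
      filter_upwards [hF.eventually_analyticAt, hG.eventually_analyticAt] with z h1 h2
      simp [fieldDeriv, fderiv_mul h1.differentiableAt h2.differentiableAt])

lemma germDerivation_toGerm {ξ : E → E} (hξ : AnalyticAt ℂ ξ 0) {F : E → ℂ}
    (hF : AnalyticAt ℂ F 0) :
    germDerivation ξ hξ (toGerm F hF) = toGerm (fieldDeriv ξ F) (hF.fieldDeriv hξ) := rfl

variable {P : Type*} [NormedAddCommGroup P] [NormedSpace ℂ P]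

/-- Divisibility by ε becomes vanishing on the fibre ε = 0; in particular ε is prime because germs
on this fibre have no zero divisors. -/
lemma toGerm_fst_dvd_iff {F : ℂ × P → ℂ} (hF : AnalyticAt ℂ F 0) :
    toGerm (fun z : ℂ × P => z.1) analyticAt_fst ∣ toGerm F hF ↔
      ∀ᶠ p in 𝓝 (0 : P), F (0, p) = 0 := by
  constructor
  · rintro ⟨c, hc⟩
    obtain ⟨G, hG, rfl⟩ := exists_toGerm c
    rw [toGerm_mul, toGerm_eq_iff] at hc
    have : Tendsto (fun p : P => ((0 : ℂ), p)) (𝓝 0) (𝓝 0) := by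
      have h : Continuous fun p : P => ((0 : ℂ), p) := by fun_prop
      exact h.tendsto 0
    filter_upwards [this.eventually hc] with p hp
    simpa using hp
  · intro h
    obtain ⟨G, hG, hGF⟩ := exists_analyticAt_eq_fst_mul hF h
    exact ⟨toGerm G hG, by rw [toGerm_mul, toGerm_eq_iff]; exact hGF⟩

end GermRing

/-! ### From holomorphy on the fibres to joint divisibility. -/

section Extension

variable {P : Type*} [NormedAddCommGroup P] [NormedSpace ℂ P]

/-- A quotient `A / D` that extends analytically along the fibres of a family is jointly analytic. -/
lemma exists_analyticAt_of_fiberwise {A D : ℂ × P → ℂ} (hA : AnalyticAt ℂ A 0)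
    (hD : AnalyticAt ℂ D 0) {e : P} (hDe : ∀ᶠ t : ℂ in 𝓝[≠] 0, D (0, t • e) ≠ 0)
    (hdense : ∀ᶠ z in 𝓝 (0 : ℂ × P), ∃ᶠ p in 𝓝 z.2, D (z.1, p) ≠ 0)
    (hκ : ∀ᶠ z in 𝓝 (0 : ℂ × P), ∃ κ : P → ℂ, AnalyticAt ℂ κ z.2 ∧
      ∀ᶠ p in 𝓝 z.2, D (z.1, p) ≠ 0 → A (z.1, p) = D (z.1, p) * κ p) :
    ∃ K, AnalyticAt ℂ K 0 ∧ ∀ᶠ z in 𝓝 0, A z = D z * K z := by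
  classical
  let good : ℂ × P → Prop := fun z => ∃ κ : P → ℂ, AnalyticAt ℂ κ z.2 ∧
      ∀ᶠ p in 𝓝 z.2, D (z.1, p) ≠ 0 → A (z.1, p) = D (z.1, p) * κ p
  have hχ : ∃ χ : ℂ × P → P → ℂ, ∀ z, good z → AnalyticAt ℂ (χ z) z.2 ∧
      ∀ᶠ p in 𝓝 z.2, D (z.1, p) ≠ 0 → A (z.1, p) = D (z.1, p) * χ z p := by
    -- The extensions are chosen point by point, with no regularity in z.
    refine ⟨fun z => if h : good z then h.choose else 0, fun z hz => ?_⟩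
    simp only [dif_pos hz]
    exact hz.choose_spec
  obtain ⟨χ, hχ⟩ := hχ
  have hfib : ∀ z : ℂ × P, Tendsto (fun p : P => (z.1, p)) (𝓝 z.2) (𝓝 z) := by
    intro z
    have h : Continuous fun p : P => (z.1, p) := by fun_prop
    exact h.tendsto z.2
  -- Two extensions on the same fibre agree where D ≠ 0, a dense set of this fibre, hence agree by
  -- continuity. So the diagonal value of `χ` is analytic along each fibre.
  have hloc : ∀ᶠ z in 𝓝 (0 : ℂ × P), (fun p => χ (z.1, p) p) =ᶠ[𝓝 z.2] χ z := by
    filter_upwards [hκ.eventually_nhds, hdense.eventually_nhds] with z h1 h2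
    obtain ⟨h3, h4⟩ := hχ z h1.self_of_nhds
    filter_upwards [(hfib z).eventually h1, (hfib z).eventually h2, h3.eventually_analyticAt,
      h4.eventually_nhds] with p h5 h6 h7 h8
    obtain ⟨h9, h10⟩ := hχ (z.1, p) h5
    have hne : (𝓝 p ⊓ 𝓟 {p | D (z.1, p) ≠ 0}).NeBot := frequently_mem_iff_neBot.1 h6
    refine tendsto_nhds_unique (f := χ (z.1, p)) (l := 𝓝 p ⊓ 𝓟 {p | D (z.1, p) ≠ 0})
      (h9.continuousAt.tendsto.mono_left inf_le_left) ?_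
    refine (h7.continuousAt.tendsto.mono_left inf_le_left).congr' ?_
    filter_upwards [mem_inf_of_left h8, mem_inf_of_left h10, mem_inf_of_right (mem_principal_self _)]
      with p' g1 g2 g3
    exact mul_left_cancel₀ g3 ((g1 g3).symm.trans (g2 g3))
  have hDe' : ∀ᶠ t : ℂ in 𝓝[≠] 0, D (t • ((0 : ℂ), e)) ≠ 0 := by
    simpa [Prod.smul_mk] using hDe
  have hAK : ∀ᶠ z in 𝓝 (0 : ℂ × P), A z = D z * χ z z.2 := by
    filter_upwards [hκ, hdense, hA.eventually_analyticAt, hD.eventually_analyticAt]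
      with z h1 h2 h3 h4
    obtain ⟨h5, h6⟩ := hχ z h1
    have hne : (𝓝 z.2 ⊓ 𝓟 {p | D (z.1, p) ≠ 0}).NeBot := frequently_mem_iff_neBot.1 h2
    have t1 : Tendsto (fun p => A (z.1, p)) (𝓝 z.2) (𝓝 (A z)) :=
      h3.continuousAt.tendsto.comp (hfib z)
    have t2 : Tendsto (fun p => D (z.1, p) * χ z p) (𝓝 z.2) (𝓝 (D z * χ z z.2)) :=
      (h4.continuousAt.tendsto.comp (hfib z)).mul h5.continuousAt.tendsto
    refine tendsto_nhds_unique (l := 𝓝 z.2 ⊓ 𝓟 {p | D (z.1, p) ≠ 0})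
      (t1.mono_left inf_le_left) ((t2.mono_left inf_le_left).congr' ?_)
    filter_upwards [mem_inf_of_left h6, mem_inf_of_right (mem_principal_self _)] with p g1 g2
    exact (g1 g2).symm
  -- No regularity in ε is needed: holomorphy along the direction (0, e) suffices to recover the
  -- quotient from a Cauchy integral.
  refine ⟨fun z => χ z z.2, analyticAt_of_eq_mul hA hD hDe' ?_ hAK, hAK⟩
  filter_upwards [hloc, hκ] with z h1 h2
  obtain ⟨h3, -⟩ := hχ z h2
  have hline : Tendsto (fun t : ℂ => z.2 + t • e) (𝓝 0) (𝓝 z.2) := by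
    have h : Continuous fun t : ℂ => z.2 + t • e := by fun_prop
    simpa using h.tendsto 0
  have h4 : DifferentiableAt ℂ (fun t : ℂ => χ z (z.2 + t • e)) 0 := by
    have h5 : DifferentiableAt ℂ (χ z) (z.2 + (0 : ℂ) • e) := by
      simpa using h3.differentiableAt
    exact DifferentiableAt.comp (f := fun t : ℂ => z.2 + t • e) 0 h5 (by fun_prop)
  refine h4.congr_of_eventuallyEq ?_
  filter_upwards [hline.eventually h1] with t ht
  have h6 : z + t • ((0 : ℂ), e) = (z.1, z.2 + t • e) := by ext <;> simp
  rw [h6]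
  exact ht

/-- Consider the logarithmic derivative `f / D` in a family of discriminants `D` that degenerates to
a multiple of a smooth curve transverse to the field `ξ`. If it satisfies a first order linear
equation along `ξ` whose right hand side is holomorphic on the fibres, then it is holomorphic. -/
theorem exists_analyticAt_eq_mul_of_transverse {D f e : ℂ × P → ℂ} {ξ : ℂ × P → ℂ × P}
    (hD : AnalyticAt ℂ D 0) (hf : AnalyticAt ℂ f 0) (he : AnalyticAt ℂ e 0)
    (hξ : AnalyticAt ℂ ξ 0) (hξ0 : ∀ z, (ξ z).1 = 0)
    (hdense : ∀ᶠ z in 𝓝 (0 : ℂ × P), ∃ᶠ p in 𝓝 z.2, D (z.1, p) ≠ 0)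
    (hκ : ∀ᶠ z in 𝓝 (0 : ℂ × P), ∃ κ : P → ℂ, AnalyticAt ℂ κ z.2 ∧
      ∀ᶠ p in 𝓝 z.2, D (z.1, p) ≠ 0 →
        D (z.1, p) * fieldDeriv ξ f (z.1, p) - f (z.1, p) * fieldDeriv ξ D (z.1, p)
          + e (z.1, p) * D (z.1, p) * f (z.1, p) = D (z.1, p) ^ 2 * κ p)
    {g u : P → ℂ} {m : ℕ} (hg : AnalyticAt ℂ g 0) (hu : AnalyticAt ℂ u 0)
    (hu0 : u 0 ≠ 0) (hgξ : fderiv ℂ g 0 (ξ 0).2 ≠ 0)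
    (hDg : ∀ᶠ p in 𝓝 (0 : P), D (0, p) = g p ^ m * u p) :
    ∃ q : ℂ × P → ℂ, AnalyticAt ℂ q 0 ∧ ∀ᶠ z in 𝓝 0, f z = q z * D z := by
  set v : P := (ξ 0).2 with hv
  have hline : Tendsto (fun t : ℂ => t • v) (𝓝 0) (𝓝 (0 : P)) := by
    have h : Continuous fun t : ℂ => t • v := by fun_prop
    simpa using h.tendsto 0
  have hgv : ∀ᶠ t : ℂ in 𝓝[≠] 0, g (t • v) ≠ 0 := by
    have h1 : HasDerivAt (fun t : ℂ => t • v) v 0 := by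
      simpa using (hasDerivAt_id (0 : ℂ)).smul_const v
    have h2 : HasFDerivAt g (fderiv ℂ g 0) ((0 : ℂ) • v) := by
      simpa using hg.differentiableAt.hasFDerivAt
    exact (h2.comp_hasDerivAt (0 : ℂ) h1).eventually_ne hgξ
  have hDv : ∀ᶠ t : ℂ in 𝓝[≠] 0, D (0, t • v) ≠ 0 := by
    filter_upwards [hgv, (hline.eventually hDg).filter_mono nhdsWithin_le_nhds,
      (hline.eventually (hu.continuousAt.eventually_ne hu0)).filter_mono nhdsWithin_le_nhds]
      with t h1 h2 h3
    rw [h2]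
    exact mul_ne_zero (pow_ne_zero _ h1) h3
  set A : ℂ × P → ℂ := fun z => D z * fieldDeriv ξ f z - f z * fieldDeriv ξ D z + e z * D z * f z
    with hA
  have hAa : AnalyticAt ℂ A 0 := ((hD.mul (hf.fieldDeriv hξ)).sub (hf.mul (hD.fieldDeriv hξ))).add
    ((he.mul hD).mul hf)
  -- The right hand side is A / D², so the denominator here is D ^ 2.
  obtain ⟨K, hK, hAK⟩ := exists_analyticAt_of_fiberwise (e := v) hAa (hD.pow 2)
    (by simpa using hDv) (by simpa using hdense)
    (by
      filter_upwards [hκ] with z hz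
      obtain ⟨κ, h1, h2⟩ := hz
      refine ⟨κ, h1, ?_⟩
      filter_upwards [h2] with p hp h0
      exact hp (by simpa using h0))
  have hDe : ∀ᶠ t : ℂ in 𝓝[≠] 0, D (t • ((0 : ℂ), v)) ≠ 0 := by
    simpa [Prod.smul_mk] using hDv
  -- The linear form is ε, which is constant along the transverse direction v of the fibre.
  refine exists_analyticAt_eq_mul hf hD hDe (ContinuousLinearMap.fst ℂ ℂ P) rfl fun n => ?_
  set ε := toGerm (fun z : ℂ × P => z.1) analyticAt_fst with hε
  have hgs : AnalyticAt ℂ (fun z : ℂ × P => g z.2) 0 := by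
    have h1 : AnalyticAt ℂ g ((0 : ℂ × P).2) := hg
    exact h1.fun_comp analyticAt_snd
  have hus : AnalyticAt ℂ (fun z : ℂ × P => u z.2) 0 := by
    have h1 : AnalyticAt ℂ u ((0 : ℂ × P).2) := hu
    exact h1.fun_comp analyticAt_snd
  have hgnz : ¬ ∀ᶠ p in 𝓝 (0 : P), g p = 0 := by
    intro h
    have h1 : ∀ᶠ t : ℂ in 𝓝[≠] 0, g (t • v) = 0 :=
      (hline.eventually h).filter_mono nhdsWithin_le_nhds
    obtain ⟨t, h2, h3⟩ := (h1.and hgv).exists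
    exact h3 h2
  have hfstP : ∀ F : ℂ × P → ℂ, AnalyticAt ℂ F 0 → AnalyticAt ℂ (fun p : P => F (0, p)) 0 := by
    intro F hF
    have h1 : AnalyticAt ℂ F ((fun p : P => ((0 : ℂ), p)) 0) := hF
    exact h1.fun_comp (analyticAt_const.prod analyticAt_id)
  have main := exists_eq_mul_add_pow_mul (δ := germDerivation ξ hξ) (ε := ε) (g := toGerm _ hgs)
    (u := toGerm _ hus) (D := toGerm D hD) (f := toGerm f hf) (e := toGerm e he) (K := toGerm K hK)
    (m := m) ?_ ?_ ?_ ?_ (isUnit_toGerm _ hu0) ?_ ?_ ?_ ?_ n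
  · obtain ⟨q, r, h⟩ := main
    obtain ⟨q, hq, rfl⟩ := exists_toGerm q
    obtain ⟨r, hr, rfl⟩ := exists_toGerm r
    rw [hε, toGerm_pow, toGerm_mul, toGerm_mul, toGerm_add, toGerm_eq_iff] at h
    exact ⟨q, r, hq, hr, h⟩
  · rw [hε, germDerivation_toGerm, toGerm_zero, toGerm_eq_iff]
    refine Eventually.of_forall fun z => ?_
    rw [fieldDeriv, fderiv_fst]
    exact hξ0 z
  · intro a ha
    obtain ⟨a, haa, rfl⟩ := exists_toGerm a
    rw [hε, toGerm_mul, toGerm_zero, toGerm_eq_iff] at ha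
    rw [toGerm_zero, toGerm_eq_iff]
    refine (eventually_eq_zero_or_of_mul analyticAt_fst haa ha).resolve_left fun h => ?_
    have h1 : Tendsto (fun t : ℂ => (t, (0 : P))) (𝓝[≠] 0) (𝓝 0) := by
      have h2 : Continuous fun t : ℂ => (t, (0 : P)) := by fun_prop
      exact (h2.tendsto 0).mono_left nhdsWithin_le_nhds
    obtain ⟨t, h3, h4⟩ := ((h1.eventually h).and self_mem_nhdsWithin).exists
    exact h4 h3
  · intro a b hab
    obtain ⟨a, ha, rfl⟩ := exists_toGerm a
    obtain ⟨b, hb, rfl⟩ := exists_toGerm b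
    rw [toGerm_mul, hε, toGerm_fst_dvd_iff] at hab
    rw [hε, toGerm_fst_dvd_iff, toGerm_fst_dvd_iff]
    exact eventually_eq_zero_or_of_mul (hfstP a ha) (hfstP b hb) hab
  · rw [hε, toGerm_fst_dvd_iff]
    exact hgnz
  · rw [germDerivation_toGerm]
    refine isUnit_toGerm _ ?_
    have h1 : HasFDerivAt (fun z : ℂ × P => g z.2)
        ((fderiv ℂ g 0).comp (ContinuousLinearMap.snd ℂ ℂ P)) 0 := by
      have h2 : HasFDerivAt g (fderiv ℂ g 0) ((0 : ℂ × P).2) := hg.differentiableAt.hasFDerivAt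
      exact h2.comp (0 : ℂ × P) hasFDerivAt_snd
    rw [fieldDeriv, h1.fderiv]
    exact hgξ
  · intro j hj
    rw [natCast_eq_toGerm, natCast_eq_toGerm, toGerm_sub]
    refine isUnit_toGerm _ (sub_ne_zero.2 ?_)
    exact_mod_cast hj.ne
  · rw [toGerm_pow, toGerm_mul, toGerm_sub, hε, toGerm_fst_dvd_iff]
    filter_upwards [hDg] with p hp
    simp [hp]
  · rw [germDerivation_toGerm, germDerivation_toGerm, toGerm_mul, toGerm_mul, toGerm_mul,
      toGerm_mul, toGerm_sub, toGerm_add, toGerm_pow, toGerm_mul, toGerm_eq_iff]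
    exact hAK

end Extension

/-! ### Binary forms, resultants and discriminants. -/

section Forms

lemma formEval_of_fst_ne_zero {n : ℕ} {F : ℂ[X]} (hF : F.natDegree ≤ n) {v : ℂ × ℂ}
    (hv : v.1 ≠ 0) : formEval n F v = v.1 ^ n * F.eval (v.2 / v.1) := by
  rw [eval_eq_sum_range' (Nat.lt_succ_of_le hF), Finset.mul_sum, formEval]
  refine Finset.sum_congr rfl fun i hi => ?_
  have hi' : i ≤ n := Nat.lt_succ_iff.1 (Finset.mem_range.1 hi)
  obtain ⟨j, rfl⟩ := Nat.exists_eq_add_of_le hi'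
  rw [Nat.add_sub_cancel_left, pow_add, div_pow]
  field_simp

lemma formEval_of_fst_eq_zero {n : ℕ} {F : ℂ[X]} {v : ℂ × ℂ} (hv : v.1 = 0) :
    formEval n F v = F.coeff n * v.2 ^ n := by
  rw [formEval, Finset.sum_range_succ, Finset.sum_eq_zero, hv]
  · simp
  · intro i hi
    have : n - i ≠ 0 := by have := Finset.mem_range.1 hi; lia
    simp [hv, this]

lemma formEval_mul {m n : ℕ} {F G : ℂ[X]} (hF : F.natDegree ≤ m) (hG : G.natDegree ≤ n)
    (v : ℂ × ℂ) : formEval (m + n) (F * G) v = formEval m F v * formEval n G v := by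
  by_cases hv : v.1 = 0
  · rw [formEval_of_fst_eq_zero hv, formEval_of_fst_eq_zero hv, formEval_of_fst_eq_zero hv,
      coeff_mul_add_eq_of_natDegree_le hF hG]
    ring
  · rw [formEval_of_fst_ne_zero (natDegree_mul_le_of_le hF hG) hv, formEval_of_fst_ne_zero hF hv,
      formEval_of_fst_ne_zero hG hv, eval_mul]
    ring

lemma formEval_linear (a b : ℂ) (v : ℂ × ℂ) : formEval 1 (C a + C b * X) v = a * v.1 + b * v.2 := by
  simp [formEval, Finset.sum_range_succ, coeff_X, coeff_C]

lemma formEval_C_mul (n : ℕ) (c : ℂ) (F : ℂ[X]) (v : ℂ × ℂ) :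
    formEval n (C c * F) v = c * formEval n F v := by
  simp [formEval, Finset.mul_sum, mul_assoc]

lemma formEval_add (n : ℕ) (F G : ℂ[X]) (v : ℂ × ℂ) :
    formEval n (F + G) v = formEval n F v + formEval n G v := by
  simp [formEval, add_mul, Finset.sum_add_distrib]

lemma natDegree_linear_le (a b : ℂ) : (C a + C b * X).natDegree ≤ 1 := by
  compute_degree

lemma natDegree_prod_linear_le {ι : Type*} (s : Finset ι) (a : ι → ℂ × ℂ) :
    (∏ j ∈ s, (C (a j).1 + C (a j).2 * X)).natDegree ≤ s.card := by
  refine (natDegree_prod_le _ _).trans ?_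
  refine (Finset.sum_le_sum fun i _ => natDegree_linear_le _ _).trans ?_
  simp

lemma formEval_prod_linear {ι : Type*} (s : Finset ι) (a : ι → ℂ × ℂ) (v : ℂ × ℂ) :
    formEval s.card (∏ j ∈ s, (C (a j).1 + C (a j).2 * X)) v
      = ∏ j ∈ s, ((a j).1 * v.1 + (a j).2 * v.2) := by
  classical
  induction s using Finset.induction_on with
  | empty => simp [formEval]
  | insert i s hi ih =>
    rw [Finset.prod_insert hi, Finset.card_insert_of_notMem hi, add_comm s.card,
      formEval_mul (natDegree_linear_le _ _) (natDegree_prod_linear_le s a), ih,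
      Finset.prod_insert hi, formEval_linear]

lemma exists_formEval_ne_zero {n : ℕ} {F : ℂ[X]} (hF : F.natDegree ≤ n) (h0 : F ≠ 0) :
    ∃ v, formEval n F v ≠ 0 := by
  obtain ⟨x, hx⟩ : ∃ x, F.eval x ≠ 0 := by
    by_contra! h
    exact h0 (Polynomial.funext (by simpa using h))
  refine ⟨(1, x), ?_⟩
  rw [formEval_of_fst_ne_zero hF one_ne_zero]
  simpa using hx

/-- If the resultant of two binary forms does not vanish, then every form is a combination of them. -/
lemma exists_mul_add_mul_eq {m n : ℕ} (hmn : m + n ≠ 0) {F G : ℂ[X]} (hF : F.natDegree ≤ m)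
    (hG : G.natDegree ≤ n) (hR : resultant F G m n ≠ 0) {H : ℂ[X]} (hH : H.natDegree ≤ m + n) :
    ∃ a b : ℂ[X], a.natDegree ≤ m ∧ b.natDegree ≤ n ∧ F * b + G * a = H := by
  -- The adjugate of the Sylvester matrix, divided by the resultant, solves the problem for
  -- polynomials of degree less than m + n.
  have low : ∀ H : ℂ[X], H ∈ degreeLT ℂ (m + n) →
      ∃ a b : ℂ[X], a ∈ degreeLT ℂ m ∧ b ∈ degreeLT ℂ n ∧ F * b + G * a = H := by
    intro H hH
    have h := congrArg (fun T => ((T ⟨H, hH⟩ : degreeLT ℂ (m + n)) : ℂ[X]))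
      (sylveserMap_comp_adjSylvester F G hF hG)
    simp only [LinearMap.comp_apply, sylvesterMap_apply_coe, LinearMap.smul_apply,
      LinearMap.id_apply, SetLike.val_smul] at h
    set p := adjSylvester F G (m := m) (n := n) ⟨H, hH⟩
    refine ⟨(resultant F G m n)⁻¹ • (p.1 : ℂ[X]), (resultant F G m n)⁻¹ • (p.2 : ℂ[X]),
      Submodule.smul_mem _ _ p.1.2, Submodule.smul_mem _ _ p.2.2, ?_⟩
    rw [mul_smul_comm, mul_smul_comm, ← smul_add, h, smul_smul, inv_mul_cancel₀ hR, one_smul]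
  have hdeg : ∀ {a : ℂ[X]} {k : ℕ}, a ∈ degreeLT ℂ k → a.natDegree ≤ k ∧ (X * a).natDegree ≤ k := by
    intro a k ha
    by_cases h0 : a = 0
    · simp [h0]
    rw [mem_degreeLT, degree_eq_natDegree h0, Nat.cast_lt] at ha
    refine ⟨ha.le, ?_⟩
    rw [natDegree_X_mul h0]
    exact ha
  -- A form of degree m + n has one more coefficient than the Sylvester system handles: split H into
  -- its constant term and X times the rest.
  obtain ⟨a₀, b₀, ha₀, hb₀, h₀⟩ := low (C (H.coeff 0)) (by
    rw [mem_degreeLT]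
    exact degree_C_le.trans_lt (by exact_mod_cast Nat.pos_of_ne_zero hmn))
  obtain ⟨a₁, b₁, ha₁, hb₁, h₁⟩ := low H.divX (by
    rw [mem_degreeLT]
    by_cases h0 : H.divX = 0
    · rw [h0, degree_zero]; exact WithBot.bot_lt_coe _
    · rw [degree_eq_natDegree h0, Nat.cast_lt, natDegree_divX_eq_natDegree_tsub_one]
      lia)
  refine ⟨a₀ + X * a₁, b₀ + X * b₁, natDegree_add_le_of_degree_le (hdeg ha₀).1 (hdeg ha₁).2,
    natDegree_add_le_of_degree_le (hdeg hb₀).1 (hdeg hb₁).2, ?_⟩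
  conv_rhs => rw [← divX_mul_X_add H]
  linear_combination h₀ + X * h₁

lemma isCoprime_of_resultant_ne_zero {m n : ℕ} (hmn : m + n ≠ 0) {F G : ℂ[X]}
    (hF : F.natDegree ≤ m) (hG : G.natDegree ≤ n) (hR : resultant F G m n ≠ 0) :
    IsCoprime F G := by
  obtain ⟨a, b, -, -, h⟩ := exists_mul_add_mul_eq hmn hF hG hR (H := 1) (by simp)
  exact ⟨b, a, by linear_combination h⟩

/-- A common zero would kill every form of degree m + n, in particular dx ^ (m + n) and dy ^ (m +
n), encoded by 1 and X ^ (m + n). -/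
lemma eq_zero_of_formEval_eq_zero {m n : ℕ} (hmn : m + n ≠ 0) {F G : ℂ[X]}
    (hF : F.natDegree ≤ m) (hG : G.natDegree ≤ n) (hR : resultant F G m n ≠ 0) {v : ℂ × ℂ}
    (hFv : formEval m F v = 0) (hGv : formEval n G v = 0) : v = 0 := by
  have h : ∀ H : ℂ[X], H.natDegree ≤ m + n → formEval (m + n) H v = 0 := by
    intro H hH
    obtain ⟨a, b, ha, hb, rfl⟩ := exists_mul_add_mul_eq hmn hF hG hR hH
    rw [formEval_add, formEval_mul hF hb, mul_comm G a, formEval_mul ha hG, hFv, hGv]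
    simp
  have h1 : v.1 = 0 := by
    by_contra h1
    have := h 1 (by simp)
    rw [formEval_of_fst_ne_zero (by simp) h1] at this
    simp [h1] at this
  have h2 := h (X ^ (m + n)) (by simp)
  rw [formEval_of_fst_eq_zero h1] at h2
  rw [coeff_X_pow_self, one_mul] at h2
  exact Prod.ext h1 (pow_eq_zero_iff hmn |>.1 h2)

lemma formDiscr_zero (F : ℂ[X]) : formDiscr 0 F = 1 := by
  simp [formDiscr]

lemma formDiscr_two (F : ℂ[X]) :
    formDiscr 2 F = F.coeff 1 ^ 2 - 4 * F.coeff 0 * F.coeff 2 := by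
  have h0 : ∀ G : ℂ[X], (X * G).coeff 0 = 0 := fun G => by simp
  have h1 : ∀ G : ℂ[X], (X * G).coeff 1 = G.coeff 0 := fun G => coeff_X_mul G 0
  rw [formDiscr, resultant]
  have : sylvester (((2 : ℕ) : ℂ[X]) * F - X * derivative F) (derivative F) 1 1 =
    !![F.coeff 1, 2 * F.coeff 0; 2 * F.coeff 2, F.coeff 1] := by
    ext i j
    rw [← C_eq_natCast]
    fin_cases i <;> fin_cases j <;>
    simp [sylvester, Fin.addCases, coeff_derivative, h0, h1]
    all_goals ring
  change (sylvester _ _ 1 1).det = _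
  rw [this]
  change Matrix.det !![F.coeff 1, 2 * F.coeff 0; 2 * F.coeff 2, F.coeff 1] = _
  rw [Matrix.det_fin_two_of]
  ring

/-- The discriminant in terms of the resultant with the derivative, for a form of exact degree. -/
lemma natCast_mul_leadingCoeff_mul_formDiscr {n : ℕ} {F : ℂ[X]} (hF : F.natDegree = n) (hn : n ≠ 0) :
    (-1) ^ (n - 1) * (n * F.leadingCoeff) * formDiscr n F
      = (n : ℂ) ^ (n - 1) * resultant F (derivative F) n (n - 1) := by
  obtain ⟨n, rfl⟩ := Nat.exists_eq_succ_of_ne_zero hn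
  simp only [Nat.succ_eq_add_one, Nat.add_sub_cancel] at *
  have hd : (derivative F).natDegree ≤ n := (natDegree_derivative_le F).trans (by lia)
  have hlow : (((n + 1 : ℕ) : ℂ[X]) * F - X * derivative F).natDegree ≤ n := by
    rw [natDegree_le_iff_coeff_eq_zero]
    intro k hk
    rw [coeff_sub, ← C_eq_natCast, coeff_C_mul]
    obtain ⟨k, rfl⟩ : ∃ j, k = j + 1 := ⟨k - 1, by lia⟩
    rw [coeff_X_mul, coeff_derivative]
    rcases Nat.eq_or_lt_of_le (Nat.lt_succ_iff.1 hk) with h | h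
    · subst h; push_cast; ring
    · rw [coeff_eq_zero_of_natDegree_lt (by lia)]; simp
  have h1 := resultant_succ_left_deg _ (derivative F) n n hlow
  -- Adding a multiple of F' does not change the resultant with F'; counting the first partial
  -- derivative in degree n + 1 instead of n brings in the leading coefficient of F'.
  have h2 : resultant (((n + 1 : ℕ) : ℂ[X]) * F - X * derivative F) (derivative F) (n + 1) n
      = resultant (((n + 1 : ℕ) : ℂ[X]) * F) (derivative F) (n + 1) n := by
    have := resultant_add_mul_left (((n + 1 : ℕ) : ℂ[X]) * F) (derivative F) (-X) (n + 1) n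
      (by rw [natDegree_neg, natDegree_X]; lia) hd
    rw [← this]
    congr 1
    ring
  rw [h2, ← C_eq_natCast, resultant_C_mul_left, coeff_derivative] at h1
  rw [formDiscr, Nat.add_sub_cancel, ← C_eq_natCast, h1, leadingCoeff, hF]
  push_cast
  ring

/-- Multiplicativity of the resultant, with (F G)' congruent to F' G modulo F and to F G' modulo G.
-/
lemma resultant_derivative_mul {m n : ℕ} (hm : m ≠ 0) (hn : n ≠ 0) {F G : ℂ[X]}
    (hF : F.natDegree = m) (hG : G.natDegree = n) :
    resultant (F * G) (derivative (F * G)) (m + n) (m + n - 1)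
      = (-1) ^ (m * n) * resultant F (derivative F) m (m - 1)
        * resultant G (derivative G) n (n - 1) * resultant F G m n ^ 2 := by
  have hF' : (derivative F).natDegree = m - 1 := by rw [natDegree_derivative, hF]
  have hG' : (derivative G).natDegree = n - 1 := by rw [natDegree_derivative, hG]
  have hd : (derivative (F * G)).natDegree ≤ m + n - 1 :=
    (natDegree_derivative_le _).trans (by have := natDegree_mul_le (p := F) (q := G); lia)
  have h1 := resultant_mul_left F G (derivative (F * G)) (m + n - 1) hd
  rw [hF, hG] at h1
  have h2 : resultant F (derivative (F * G)) m (m + n - 1)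
      = resultant F (derivative F) m (m - 1) * resultant F G m n := by
    have h3 := resultant_mul_right F (derivative F) G m hF.le
    rw [hF', hG] at h3
    rw [← h3, derivative_mul, resultant_add_mul_right _ _ _ _ _ (by lia) hF.le]
    congr 1
    lia
  have h4 : resultant G (derivative (F * G)) n (m + n - 1)
      = resultant G (derivative G) n (n - 1) * resultant G F n m := by
    have h3 := resultant_mul_right G (derivative G) F n hG.le
    rw [hG', hF] at h3
    rw [← h3, derivative_mul, add_comm, mul_comm F, mul_comm (derivative F),
      resultant_add_mul_right _ _ _ _ _ (by lia) hG.le]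
    congr 1
    lia
  rw [h1, h2, h4, resultant_comm G F, mul_comm n m]
  ring

lemma exists_formDiscr_mul_of_natDegree_eq {m n : ℕ} (hm : m ≠ 0) (hn : n ≠ 0) :
    ∃ c : ℂ, c ≠ 0 ∧ ∀ F G : ℂ[X], F.natDegree = m → G.natDegree = n →
      formDiscr (m + n) (F * G)
        = c * formDiscr m F * formDiscr n G * resultant F G m n ^ 2 := by
  have hm' : (m : ℂ) ≠ 0 := by exact_mod_cast hm
  have hn' : (n : ℂ) ≠ 0 := by exact_mod_cast hn
  have hmn' : ((m + n : ℕ) : ℂ) ≠ 0 := by exact_mod_cast (by lia : m + n ≠ 0)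
  have hsq : ∀ k : ℕ, ((-1 : ℂ) ^ k) ≠ 0 := fun k => pow_ne_zero _ (by norm_num)
  -- The constant collects the signs and powers of the degrees relating `formDiscr` to the resultant
  -- with the derivative, for F, G and F G; the leading coefficients cancel.
  refine ⟨((m + n : ℕ) : ℂ) ^ (m + n - 1) * (-1) ^ (m * n) * ((-1) ^ (m - 1) * m)
    * ((-1) ^ (n - 1) * n) / ((-1) ^ (m + n - 1) * ((m + n : ℕ) : ℂ) * (m : ℂ) ^ (m - 1)
      * (n : ℂ) ^ (n - 1)), ?_, ?_⟩
  · simp [hm', hn', hsq, -Nat.cast_add, hmn']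
  intro F G hF hG
  have hF0 : F ≠ 0 := by rintro rfl; simp at hF; exact hm hF.symm
  have hG0 : G ≠ 0 := by rintro rfl; simp at hG; exact hn hG.symm
  have hlF := leadingCoeff_ne_zero.2 hF0
  have hlG := leadingCoeff_ne_zero.2 hG0
  have e1 := natCast_mul_leadingCoeff_mul_formDiscr hF hm
  have e2 := natCast_mul_leadingCoeff_mul_formDiscr hG hn
  have e3 := natCast_mul_leadingCoeff_mul_formDiscr (n := m + n) (F := F * G)
    (by rw [natDegree_mul hF0 hG0, hF, hG]) (by lia)
  rw [resultant_derivative_mul hm hn hF hG, leadingCoeff_mul] at e3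
  rw [← mul_right_inj' (mul_ne_zero hlF hlG)]
  have hA : (-1 : ℂ) ^ (m + n - 1) * ((m + n : ℕ) : ℂ) * (m : ℂ) ^ (m - 1) * (n : ℂ) ^ (n - 1) ≠ 0 :=
    mul_ne_zero (mul_ne_zero (mul_ne_zero (hsq _) hmn') (pow_ne_zero _ hm')) (pow_ne_zero _ hn')
  rw [← mul_right_inj' hA]
  generalize hr1 : resultant F (derivative F) m (m - 1) = r1 at *
  generalize hr2 : resultant G (derivative G) n (n - 1) = r2 at *
  generalize hr3 : resultant F G m n = r3 at *
  generalize formDiscr (m + n) (F * G) = d at *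
  generalize formDiscr m F = d1 at *
  generalize formDiscr n G = d2 at *
  have hcancel : ∀ A B : ℂ, A ≠ 0 → A * (B / A) = B := fun A B h => by field_simp
  rw [div_mul_eq_mul_div, div_mul_eq_mul_div, div_mul_eq_mul_div, mul_div_assoc',
    hcancel _ _ hA]
  linear_combination (m : ℂ) ^ (m - 1) * (n : ℂ) ^ (n - 1) * e3
    - ((m + n : ℕ) : ℂ) ^ (m + n - 1) * (-1) ^ (m * n) * r3 ^ 2 * ((n : ℂ) ^ (n - 1) * r2) * e1
    - ((m + n : ℕ) : ℂ) ^ (m + n - 1) * (-1) ^ (m * n) * r3 ^ 2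
      * ((-1) ^ (m - 1) * (m * F.leadingCoeff) * d1) * e2

end Forms

/-! ### Analytic families of binary forms and their factorization. -/

section AnalyticForms

variable {E : Type*} [NormedAddCommGroup E] [NormedSpace ℂ E] {p : E}

lemma analyticAt_coeff_mul {F G : E → ℂ[X]} (hF : ∀ i, AnalyticAt ℂ (fun q => (F q).coeff i) p)
    (hG : ∀ i, AnalyticAt ℂ (fun q => (G q).coeff i) p) (i : ℕ) :
    AnalyticAt ℂ (fun q => (F q * G q).coeff i) p := by
  simp only [coeff_mul]
  exact Finset.analyticAt_fun_sum _ fun x _ => (hF x.1).mul (hG x.2)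

lemma analyticAt_resultant {F G : E → ℂ[X]} (m n : ℕ)
    (hF : ∀ i, AnalyticAt ℂ (fun q => (F q).coeff i) p)
    (hG : ∀ i, AnalyticAt ℂ (fun q => (G q).coeff i) p) :
    AnalyticAt ℂ (fun q => resultant (F q) (G q) m n) p := by
  simp only [resultant, Matrix.det_apply']
  refine Finset.analyticAt_fun_sum _ fun σ _ => analyticAt_const.mul
    (Finset.analyticAt_fun_prod _ fun i _ => ?_)
  simp only [sylvester, Matrix.of_apply]
  refine Fin.addCases (fun j => ?_) (fun j => ?_) i
  · simp only [Fin.addCases_left]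
    split_ifs
    · exact hG _
    · exact analyticAt_const
  · simp only [Fin.addCases_right]
    split_ifs
    · exact hF _
    · exact analyticAt_const

lemma analyticAt_formDiscr (n : ℕ) {F : E → ℂ[X]}
    (hF : ∀ i, AnalyticAt ℂ (fun q => (F q).coeff i) p) :
    AnalyticAt ℂ (fun q => formDiscr n (F q)) p := by
  have hd : ∀ i, AnalyticAt ℂ (fun q => (derivative (F q)).coeff i) p := by
    intro i
    simp only [coeff_derivative]
    exact (hF _).mul analyticAt_const
  refine analyticAt_resultant _ _ (fun i => ?_) hd
  simp only [← C_eq_natCast, coeff_sub, coeff_C_mul]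
  refine (analyticAt_const.mul (hF i)).sub ?_
  cases i with
  | zero => simpa using analyticAt_const
  | succ i => simpa only [coeff_X_mul] using hd i

lemma analyticAt_formEval (n : ℕ) {F : E → ℂ[X]} {v : E → ℂ × ℂ}
    (hF : ∀ i, AnalyticAt ℂ (fun q => (F q).coeff i) p) (hv : AnalyticAt ℂ v p) :
    AnalyticAt ℂ (fun q => formEval n (F q) (v q)) p := by
  simp only [formEval]
  exact Finset.analyticAt_fun_sum _ fun i _ =>
    ((hF i).mul ((analyticAt_fst.fun_comp hv).pow _)).mul ((analyticAt_snd.fun_comp hv).pow _)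

/-- The discriminant of a product of binary forms. -/
theorem exists_formDiscr_mul {m n : ℕ} (hm : m ≠ 0) (hn : n ≠ 0) :
    ∃ c : ℂ, c ≠ 0 ∧ ∀ F G : ℂ[X], F.natDegree ≤ m → G.natDegree ≤ n →
      formDiscr (m + n) (F * G)
        = c * formDiscr m F * formDiscr n G * resultant F G m n ^ 2 := by
  obtain ⟨c, hc, h⟩ := exists_formDiscr_mul_of_natDegree_eq hm hn
  refine ⟨c, hc, fun F G hF hG => ?_⟩
  -- Adding t X ^ k makes the degrees exact for small t ≠ 0, and both sides of the identity are
  -- continuous at t = 0.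
  let pert : ℕ → ℂ[X] → ℂ → ℂ[X] := fun k H t => H + C t * X ^ k
  have hcoeff : ∀ k H i, AnalyticAt ℂ (fun t => (pert k H t).coeff i) 0 := by
    intro k H i
    simp only [pert, coeff_add, coeff_C_mul]
    exact analyticAt_const.add (analyticAt_id.mul analyticAt_const)
  have hdeg : ∀ k H, H.natDegree ≤ k → ∀ᶠ t in 𝓝[≠] (0 : ℂ), (pert k H t).natDegree = k := by
    intro k H hH
    have h1 : ∀ᶠ t in 𝓝[≠] (0 : ℂ), t ≠ -H.coeff k := by
      by_cases h0 : H.coeff k = 0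
      · simp only [h0, neg_zero]
        exact self_mem_nhdsWithin
      · exact (continuousAt_id.eventually_ne (x := (0 : ℂ))
          (by simpa using h0)).filter_mono nhdsWithin_le_nhds
    filter_upwards [h1] with t ht
    refine natDegree_eq_of_le_of_coeff_ne_zero ?_ ?_
    · exact natDegree_add_le_of_degree_le hH (natDegree_C_mul_X_pow_le t k)
    · simp only [pert, coeff_add, coeff_C_mul, coeff_X_pow_self, mul_one]
      exact fun h => ht (eq_neg_of_add_eq_zero_right h)
  have hpert0 : ∀ k H, pert k H 0 = H := fun k H => by simp [pert]
  have t1 : Tendsto (fun t => formDiscr (m + n) (pert m F t * pert n G t)) (𝓝[≠] 0)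
      (𝓝 (formDiscr (m + n) (F * G))) := by
    have := (analyticAt_formDiscr (m + n)
      (analyticAt_coeff_mul (hcoeff m F) (hcoeff n G))).continuousAt.tendsto
    simp only [hpert0] at this
    exact this.mono_left nhdsWithin_le_nhds
  have t2 : Tendsto (fun t => c * formDiscr m (pert m F t) * formDiscr n (pert n G t)
      * resultant (pert m F t) (pert n G t) m n ^ 2) (𝓝[≠] 0)
      (𝓝 (c * formDiscr m F * formDiscr n G * resultant F G m n ^ 2)) := by
    have := (((analyticAt_const (v := c)).mul (analyticAt_formDiscr m (hcoeff m F))).mul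
      (analyticAt_formDiscr n (hcoeff n G))).mul
      ((analyticAt_resultant m n (hcoeff m F) (hcoeff n G)).pow 2)
    have := this.continuousAt.tendsto
    simp only [Pi.mul_apply, Pi.pow_apply, hpert0] at this
    rw [hpert0, hpert0] at this
    exact this.mono_left nhdsWithin_le_nhds
  refine tendsto_nhds_unique t1 (t2.congr' ?_)
  filter_upwards [hdeg m F hF, hdeg n G hG] with t h1 h2
  exact (h _ _ h1 h2).symm

/-- The polynomial with given coefficients. -/
def ofCoeffs (n : ℕ) : (Fin (n + 1) → ℂ) →ₗ[ℂ] ℂ[X] where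
  toFun a := ∑ i, C (a i) * X ^ (i : ℕ)
  map_add' a b := by simp [add_mul, Finset.sum_add_distrib]
  map_smul' c a := by simp [Finset.smul_sum, smul_eq_C_mul, mul_assoc]

lemma ofCoeffs_apply (n : ℕ) (a : Fin (n + 1) → ℂ) :
    ofCoeffs n a = ∑ i, C (a i) * X ^ (i : ℕ) := rfl

lemma natDegree_ofCoeffs_le (n : ℕ) (a : Fin (n + 1) → ℂ) : (ofCoeffs n a).natDegree ≤ n := by
  rw [ofCoeffs_apply]
  exact natDegree_sum_le_of_forall_le Finset.univ (fun i : Fin (n + 1) => C (a i) * X ^ (i : ℕ))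
    fun i _ => (natDegree_C_mul_X_pow_le _ _).trans (Nat.lt_succ_iff.1 i.2)

lemma ofCoeffs_coeff {n : ℕ} {F : ℂ[X]} (hF : F.natDegree ≤ n) :
    ofCoeffs n (fun i => F.coeff i) = F := by
  rw [ofCoeffs_apply, Fin.sum_univ_eq_sum_range (fun i => C (F.coeff i) * X ^ i) (n + 1)]
  exact (as_sum_range_C_mul_X_pow' F (Nat.lt_succ_of_le hF)).symm

lemma hasFDerivAt_mul_zero {V : Type*} [NormedAddCommGroup V] [NormedSpace ℂ V] (L M : V →L[ℂ] ℂ) :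
    HasFDerivAt (fun y => L y * M y) (0 : V →L[ℂ] ℂ) 0 := by
  have h3 : (L 0 • M + M 0 • L : V →L[ℂ] ℂ) = 0 := by
    ext y
    simp
  exact ((L.hasFDerivAt (x := (0 : V))).mul (M.hasFDerivAt (x := (0 : V)))).congr_fderiv h3

/-- In the smoothness scale of `ContDiffAt`, the order `⊤` means analytic, so the inverse function
theorem of this order gives an analytic inverse. -/
lemma exists_analyticAt_rightInverse {V : Type*} [NormedAddCommGroup V] [NormedSpace ℂ V]
    [CompleteSpace V] {Ψ : V → V} {a : V} (hΨa : AnalyticAt ℂ Ψ a)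
    (hΨd : HasFDerivAt Ψ ((ContinuousLinearEquiv.refl ℂ V : V ≃L[ℂ] V) : V →L[ℂ] V) a) :
    ∃ inv : V → V, AnalyticAt ℂ inv (Ψ a) ∧ inv (Ψ a) = a ∧ ∀ᶠ y in 𝓝 (Ψ a), Ψ (inv y) = y := by
  have hc : ContDiffAt ℂ ⊤ Ψ a := hΨa.contDiffAt
  have hne : (⊤ : WithTop ℕ∞) ≠ 0 := WithTop.top_ne_zero
  exact ⟨hc.localInverse hΨd hne, (hc.to_localInverse hΨd hne).analyticAt,
    hc.localInverse_apply_image hΨd hne,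
    (hc.hasStrictFDerivAt' hΨd hne).eventually_right_inverse⟩

set_option maxHeartbeats 1000000 in
/-- A family of binary forms whose value at one point is the product of two forms without common
factor is near this point the product of two families. -/
theorem AnalyticFormAt.exists_eq_mul {m n : ℕ} (hmn : m + n ≠ 0) {W : E → ℂ[X]}
    (hW : AnalyticFormAt (m + n) W p) {F₀ G₀ : ℂ[X]} (hF₀ : F₀.natDegree ≤ m)
    (hG₀ : G₀.natDegree ≤ n) (hWp : W p = F₀ * G₀) (hR : resultant F₀ G₀ m n ≠ 0) :
    ∃ F G : E → ℂ[X], AnalyticFormAt m F p ∧ AnalyticFormAt n G p ∧ F p = F₀ ∧ G p = G₀ ∧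
      ∀ᶠ q in 𝓝 p, W q = F q * G q := by
  let V := Fin (m + n + 1) → ℂ
  -- The differential of multiplication at (F₀, G₀), on coefficients. It is onto because the
  -- resultant is nonzero, but not injective: constants can be moved between the factors.
  let DL : (Fin (m + 1) → ℂ) × (Fin (n + 1) → ℂ) →ₗ[ℂ] V := LinearMap.pi fun l =>
    lcoeff ℂ l ∘ₗ ((LinearMap.mulLeft ℂ F₀ ∘ₗ ofCoeffs n ∘ₗ LinearMap.snd ℂ _ _)
      + (LinearMap.mulLeft ℂ G₀ ∘ₗ ofCoeffs m ∘ₗ LinearMap.fst ℂ _ _))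
  have hDL : ∀ x l, DL x l = (F₀ * ofCoeffs n x.2 + G₀ * ofCoeffs m x.1).coeff l := fun x l => rfl
  have hsurj : Function.Surjective DL := by
    intro y
    obtain ⟨a, b, ha, hb, hab⟩ := exists_mul_add_mul_eq hmn hF₀ hG₀ hR
      (natDegree_ofCoeffs_le (m + n) y)
    refine ⟨(fun i => a.coeff i, fun i => b.coeff i), ?_⟩
    ext l
    rw [hDL]
    simp only
    rw [ofCoeffs_coeff ha, ofCoeffs_coeff hb, hab, ofCoeffs_apply, finsetSum_coeff]
    simp only [coeff_C_mul, coeff_X_pow]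
    rw [Finset.sum_eq_single l]
    · simp
    · intro b _ hb
      have : (l : ℕ) ≠ b := fun h => hb (Fin.ext h.symm)
      simp [this]
    · simp
  -- A linear section removes this ambiguity: multiplication restricted to its image has the
  -- identity as differential.
  obtain ⟨S, hS⟩ := LinearMap.exists_rightInverse_of_surjective DL (LinearMap.range_eq_top.2 hsurj)
  have hS' : ∀ y : V, DL (S y) = y := fun y => congrArg (fun T => T y) hS
  let f : V → ℂ[X] := fun y => ofCoeffs m (S y).1
  let g : V → ℂ[X] := fun y => ofCoeffs n (S y).2
  have hf : ∀ i, ∃ L : V →L[ℂ] ℂ, ∀ y, (f y).coeff i = L y := fun i =>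
    ⟨(lcoeff ℂ i ∘ₗ ofCoeffs m ∘ₗ LinearMap.fst ℂ _ _ ∘ₗ S).toContinuousLinearMap, fun y => rfl⟩
  have hg : ∀ i, ∃ L : V →L[ℂ] ℂ, ∀ y, (g y).coeff i = L y := fun i =>
    ⟨(lcoeff ℂ i ∘ₗ ofCoeffs n ∘ₗ LinearMap.snd ℂ _ _ ∘ₗ S).toContinuousLinearMap, fun y => rfl⟩
  have hfa : ∀ i y, AnalyticAt ℂ (fun y => (f y).coeff i) y := by
    intro i y
    obtain ⟨L, hL⟩ := hf i
    simp only [hL]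
    exact L.analyticAt y
  have hga : ∀ i y, AnalyticAt ℂ (fun y => (g y).coeff i) y := by
    intro i y
    obtain ⟨L, hL⟩ := hg i
    simp only [hL]
    exact L.analyticAt y
  let Ψ : V → V := fun y l => ((F₀ + f y) * (G₀ + g y)).coeff l
  have hΨ : ∀ y l, Ψ y l = (F₀ * G₀).coeff l + y l + (f y * g y).coeff l := by
    intro y l
    have h1 := congrFun (hS' y) l
    rw [hDL] at h1
    conv_rhs => rw [← h1]
    simp only [Ψ, f, g]
    rw [← coeff_add, ← coeff_add]
    congr 1
    ring
  have hΨa : AnalyticAt ℂ Ψ 0 := by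
    rw [analyticAt_pi_iff]
    intro l
    refine analyticAt_coeff_mul (fun i => ?_) (fun i => ?_) l
    · simp only [coeff_add]
      exact analyticAt_const.add (hfa i 0)
    · simp only [coeff_add]
      exact analyticAt_const.add (hga i 0)
  have hΨd : HasFDerivAt Ψ ((ContinuousLinearEquiv.refl ℂ V : V ≃L[ℂ] V) : V →L[ℂ] V) 0 := by
    rw [hasFDerivAt_pi']
    intro l
    have h1 : HasFDerivAt (fun y => (f y * g y).coeff l) (0 : V →L[ℂ] ℂ) 0 := by
      simp only [coeff_mul]
      have h2 : ∀ x ∈ Finset.HasAntidiagonal.antidiagonal (l : ℕ), HasFDerivAt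
          (fun y => (f y).coeff x.1 * (g y).coeff x.2) (0 : V →L[ℂ] ℂ) 0 := by
        intro x _
        obtain ⟨L, hL⟩ := hf x.1
        obtain ⟨M, hM⟩ := hg x.2
        simp only [hL, hM]
        exact hasFDerivAt_mul_zero L M
      simpa using HasFDerivAt.fun_sum h2
    have h3 : HasFDerivAt (fun y : V => (F₀ * G₀).coeff l + y l)
        (ContinuousLinearMap.proj l : V →L[ℂ] ℂ) 0 :=
      (ContinuousLinearMap.proj (R := ℂ) (φ := fun _ : Fin (m + n + 1) => ℂ) l).hasFDerivAt.const_add _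
    have h4 := h3.add h1
    rw [add_zero] at h4
    refine h4.congr_of_eventuallyEq (Eventually.of_forall fun y => ?_)
    exact hΨ y l
  obtain ⟨inv, hinva, hinv0, hright⟩ := exists_analyticAt_rightInverse hΨa hΨd
  let w : E → V := fun q l => (W q).coeff l
  have hwa : AnalyticAt ℂ w p := by
    rw [analyticAt_pi_iff]
    exact fun l => hW.2 l
  have hwp : w p = Ψ 0 := by
    ext l
    rw [hΨ]
    have h0 : f 0 = 0 := by simp [f]
    rw [h0]
    simp only [w, hWp, zero_mul, coeff_zero, add_zero]
    exact (add_zero _).symm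
  have hia : AnalyticAt ℂ (fun q => inv (w q)) p := by
    rw [← hwp] at hinva
    exact hinva.fun_comp hwa
  refine ⟨fun q => F₀ + f (inv (w q)), fun q => G₀ + g (inv (w q)), ⟨?_, ?_⟩, ⟨?_, ?_⟩, ?_, ?_, ?_⟩
  · exact Eventually.of_forall fun q =>
      natDegree_add_le_of_degree_le hF₀ (natDegree_ofCoeffs_le _ _)
  · intro i
    simp only [coeff_add]
    exact analyticAt_const.add ((hfa i _).fun_comp hia)
  · exact Eventually.of_forall fun q =>
      natDegree_add_le_of_degree_le hG₀ (natDegree_ofCoeffs_le _ _)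
  · intro i
    simp only [coeff_add]
    exact analyticAt_const.add ((hga i _).fun_comp hia)
  · simp [hwp, hinv0, f]
  · simp [hwp, hinv0, g]
  · have h1 := hwa.continuousAt.tendsto
    rw [hwp] at h1
    filter_upwards [h1.eventually hright, hW.1] with q hq hdeg
    have h2 : ((F₀ + f (inv (w q))) * (G₀ + g (inv (w q)))).natDegree ≤ m + n :=
      natDegree_mul_le_of_le
        (natDegree_add_le_of_degree_le hF₀ (natDegree_ofCoeffs_le _ _))
        (natDegree_add_le_of_degree_le hG₀ (natDegree_ofCoeffs_le _ _))
    rw [← ofCoeffs_coeff hdeg, ← ofCoeffs_coeff h2]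
    exact congrArg _ hq.symm

/-- The vector on which a `1`-form at a point vanishes. -/
def kerVec (a : ℂ × ℂ) : ℂ × ℂ := (a.2, -a.1)

/-- A drop of degree is a root at infinity: the linear factor is then dx, encoded by (1, 0). -/
lemma exists_eq_linear_mul {n : ℕ} {F : ℂ[X]} (hF : F.natDegree ≤ n + 1) :
    ∃ (a : ℂ × ℂ) (G : ℂ[X]), a ≠ 0 ∧ G.natDegree ≤ n ∧ F = (C a.1 + C a.2 * X) * G := by
  rcases Nat.lt_or_ge n F.natDegree with h | h
  · obtain ⟨r, hr⟩ := Complex.exists_root (f := F) (natDegree_pos_iff_degree_pos.1 (by lia))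
    obtain ⟨G, hG⟩ := dvd_iff_isRoot.2 hr
    refine ⟨(-r, 1), G, by simp, ?_, ?_⟩
    · have hG0 : G ≠ 0 := by
        rintro rfl
        simp [hG] at h
      rw [hG, natDegree_mul (X_sub_C_ne_zero r) hG0, natDegree_X_sub_C] at hF
      lia
    · rw [hG]
      simp only [map_neg, map_one, one_mul]
      ring
  · exact ⟨(1, 0), F, by simp, h, by simp⟩

/-- A family of binary forms with nonzero discriminant is a product of families of linear forms. -/
theorem AnalyticFormAt.exists_eq_prod {n : ℕ} {W : E → ℂ[X]} (hW : AnalyticFormAt n W p)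
    (h0 : W p ≠ 0) (hd : formDiscr n (W p) ≠ 0) :
    ∃ (u : E → ℂ) (a : Fin n → E → ℂ × ℂ), AnalyticAt ℂ u p ∧ u p ≠ 0 ∧
      (∀ j, AnalyticAt ℂ (a j) p) ∧ (∀ i j, i ≠ j → wedge (a i p) (a j p) ≠ 0) ∧
      ∀ᶠ q in 𝓝 p, W q = C (u q) * ∏ j, (C (a j q).1 + C (a j q).2 * X) := by
  induction n generalizing W with
  | zero =>
    refine ⟨fun q => (W q).coeff 0, Fin.elim0, hW.2 0, ?_, fun j => j.elim0, fun j => j.elim0, ?_⟩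
    · intro (h : (W p).coeff 0 = 0)
      refine h0 ?_
      rw [eq_C_of_natDegree_le_zero hW.1.self_of_nhds, h, C_0]
    · filter_upwards [hW.1] with q hq
      simpa using eq_C_of_natDegree_le_zero hq
  | succ n ih =>
    obtain ⟨a, G, ha, hG, hWa⟩ := exists_eq_linear_mul hW.1.self_of_nhds
    have hG0 : G ≠ 0 := by rintro rfl; exact h0 (by rw [hWa, mul_zero])
    have hres : resultant (C a.1 + C a.2 * X) G 1 n ≠ 0 ∧ formDiscr n G ≠ 0 := by
      -- The discriminant of a product is available for factors of positive degree only.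
      rcases Nat.eq_zero_or_pos n with rfl | hn
      · rw [formDiscr_zero, resultant_zero_right_deg, pow_one]
        refine ⟨fun h => hG0 ?_, one_ne_zero⟩
        rw [eq_C_of_natDegree_le_zero hG, h, C_0]
      · obtain ⟨c, hc, h⟩ := exists_formDiscr_mul one_ne_zero hn.ne'
        rw [hWa, add_comm n 1, h _ _ (natDegree_linear_le _ _) hG] at hd
        simp only [ne_eq, mul_eq_zero, not_or, pow_eq_zero_iff two_ne_zero] at hd
        exact ⟨hd.2, hd.1.2⟩
    have hW' : AnalyticFormAt (1 + n) W p := by rwa [add_comm 1 n]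
    obtain ⟨L, H, hL, hH, hLp, hHp, hWLH⟩ := hW'.exists_eq_mul (by lia) (natDegree_linear_le _ _)
      hG hWa hres.1
    obtain ⟨u, b, hu, hu0, hb, hbd, hHb⟩ := ih hH (by rwa [hHp]) (by rw [hHp]; exact hres.2)
    let l : E → ℂ × ℂ := fun q => ((L q).coeff 0, (L q).coeff 1)
    have hlp : l p = a := by
      simp only [l, hLp]
      ext <;> simp
    have hGeval : ∀ j, formEval n G (kerVec (b j p)) = 0 := by
      intro j
      rw [← hHp, hHb.self_of_nhds, formEval_C_mul]
      have := formEval_prod_linear Finset.univ (fun j => b j p) (kerVec (b j p))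
      rw [Finset.card_univ, Fintype.card_fin] at this
      rw [this, Finset.prod_eq_zero (Finset.mem_univ j), mul_zero]
      simp only [kerVec]
      ring
    -- If the new linear form were proportional to a factor of G, they would have a common kernel
    -- vector, against the nonvanishing of their resultant.
    have hwedge : ∀ j, wedge a (b j p) ≠ 0 := by
      intro j h
      have h1 : formEval 1 (C a.1 + C a.2 * X) (kerVec (b j p)) = 0 := by
        rw [formEval_linear]
        simp only [wedge, kerVec] at *
        linear_combination h
      have h2 := eq_zero_of_formEval_eq_zero (by lia) (natDegree_linear_le _ _) hG hres.1 h1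
        (hGeval j)
      have h3 : (∏ j, (C (b j p).1 + C (b j p).2 * X)) = 0 := by
        refine Finset.prod_eq_zero (Finset.mem_univ j) ?_
        simp only [kerVec, Prod.mk_eq_zero, neg_eq_zero] at h2
        simp [h2.1, h2.2]
      have h4 := hHb.self_of_nhds
      rw [h3, mul_zero, hHp] at h4
      exact hG0 h4
    have hswap : ∀ x y, wedge x y = -wedge y x := fun x y => by simp only [wedge]; ring
    refine ⟨u, Fin.cons l b, hu, hu0, ?_, ?_, ?_⟩
    · intro j
      refine Fin.cases ?_ (fun j => ?_) j
      · exact (hL.2 0).prod (hL.2 1)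
      · exact hb j
    · intro i j
      refine Fin.cases ?_ (fun i => ?_) i <;> refine Fin.cases ?_ (fun j => ?_) j
      · simp
      · intro _
        simpa [hlp] using hwedge j
      · intro _
        rw [hswap]
        simpa [hlp] using hwedge i
      · intro hij
        simpa using hbd i j (fun h => hij (by rw [h]))
    · filter_upwards [hWLH, hHb, hL.1] with q h1 h2 h3
      rw [h1, h2, Fin.prod_univ_succ]
      simp only [Fin.cons_zero, Fin.cons_succ, l]
      have : L q = C ((L q).coeff 0) + C ((L q).coeff 1) * X := by
        conv_lhs => rw [eq_X_add_C_of_natDegree_le_one h3]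
        ring
      rw [← this]
      ring

end AnalyticForms

/-! ### Exterior calculus in two variables. -/

section Calculus

/-- The differential of a function, as a `1`-form. -/
def grad (f : ℂ × ℂ → ℂ) (p : ℂ × ℂ) : ℂ × ℂ := (fderiv ℂ f p (1, 0), fderiv ℂ f p (0, 1))

lemma fderiv_apply_eq_grad (f : ℂ × ℂ → ℂ) (p v : ℂ × ℂ) :
    fderiv ℂ f p v = v.1 * (grad f p).1 + v.2 * (grad f p).2 := by
  have : v = v.1 • ((1 : ℂ), (0 : ℂ)) + v.2 • ((0 : ℂ), (1 : ℂ)) := by ext <;> simp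
  conv_lhs => rw [this, map_add, map_smul, map_smul]
  rfl

lemma fderiv_kerVec (f : ℂ × ℂ → ℂ) (p a : ℂ × ℂ) :
    fderiv ℂ f p (kerVec a) = wedge (grad f p) a := by
  rw [fderiv_apply_eq_grad]
  simp only [kerVec, wedge]
  ring

lemma grad_congr {f g : ℂ × ℂ → ℂ} {p : ℂ × ℂ} (h : f =ᶠ[𝓝 p] g) : grad f p = grad g p := by
  rw [grad, grad, h.fderiv_eq]

lemma grad_mul {f g : ℂ × ℂ → ℂ} {p : ℂ × ℂ} (hf : DifferentiableAt ℂ f p)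
    (hg : DifferentiableAt ℂ g p) :
    grad (fun q => f q * g q) p = f p • grad g p + g p • grad f p := by
  rw [grad, fderiv_fun_mul hf hg]
  rfl

lemma grad_inv {f : ℂ × ℂ → ℂ} {p : ℂ × ℂ} (hf : DifferentiableAt ℂ f p) (h0 : f p ≠ 0) :
    grad (fun q => (f q)⁻¹) p = (-((f p) ^ 2)⁻¹) • grad f p := by
  have h := (hasDerivAt_inv h0).comp_hasFDerivAt p hf.hasFDerivAt
  have h' : fderiv ℂ (fun q => (f q)⁻¹) p = (-((f p) ^ 2)⁻¹) • fderiv ℂ f p := h.fderiv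
  rw [grad, h']
  rfl

lemma extD_congr {α β : ℂ × ℂ → ℂ × ℂ} {p : ℂ × ℂ} (h : α =ᶠ[𝓝 p] β) : extD α p = extD β p := by
  have h1 : (fun q => (α q).1) =ᶠ[𝓝 p] fun q => (β q).1 := h.fun_comp Prod.fst
  have h2 : (fun q => (α q).2) =ᶠ[𝓝 p] fun q => (β q).2 := h.fun_comp Prod.snd
  rw [extD, extD, h1.fderiv_eq, h2.fderiv_eq]

lemma extD_add {α β : ℂ × ℂ → ℂ × ℂ} {p : ℂ × ℂ} (hα : DifferentiableAt ℂ α p)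
    (hβ : DifferentiableAt ℂ β p) :
    extD (fun q => α q + β q) p = extD α p + extD β p := by
  simp only [extD, Prod.fst_add, Prod.snd_add]
  rw [fderiv_fun_add hα.fst hβ.fst, fderiv_fun_add hα.snd hβ.snd]
  simp only [add_apply]
  ring

lemma extD_smul {f : ℂ × ℂ → ℂ} {α : ℂ × ℂ → ℂ × ℂ} {p : ℂ × ℂ} (hf : DifferentiableAt ℂ f p)
    (hα : DifferentiableAt ℂ α p) :
    extD (fun q => f q • α q) p = f p * extD α p + wedge (grad f p) (α p) := by
  simp only [extD, Prod.smul_fst, Prod.smul_snd, smul_eq_mul]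
  rw [fderiv_fun_mul hf hα.fst, fderiv_fun_mul hf hα.snd]
  simp only [add_apply, smul_apply, smul_eq_mul, wedge, grad]
  ring

lemma extD_const_smul (c : ℂ) {α : ℂ × ℂ → ℂ × ℂ} {p : ℂ × ℂ} (hα : DifferentiableAt ℂ α p) :
    extD (fun q => c • α q) p = c * extD α p := by
  rw [extD_smul (differentiableAt_const c) hα]
  simp [grad, wedge]

lemma extD_neg {α : ℂ × ℂ → ℂ × ℂ} {p : ℂ × ℂ} (hα : DifferentiableAt ℂ α p) :
    extD (fun q => -α q) p = -extD α p := by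
  have := extD_const_smul (-1) hα
  simpa using this

lemma extD_sum {ι : Type*} (s : Finset ι) {α : ι → ℂ × ℂ → ℂ × ℂ} {p : ℂ × ℂ}
    (hα : ∀ i ∈ s, DifferentiableAt ℂ (α i) p) :
    extD (fun q => ∑ i ∈ s, α i q) p = ∑ i ∈ s, extD (α i) p := by
  classical
  induction s using Finset.induction_on with
  | empty => simp [extD]
  | insert i s hi ih =>
    simp only [Finset.sum_insert hi]
    rw [extD_add (hα i (Finset.mem_insert_self i s)), ih]
    · exact fun j hj => hα j (Finset.mem_insert_of_mem hj)
    · exact DifferentiableAt.fun_sum fun j hj => hα j (Finset.mem_insert_of_mem hj)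

lemma _root_.AnalyticAt.grad {f : ℂ × ℂ → ℂ} {p : ℂ × ℂ} (hf : AnalyticAt ℂ f p) :
    AnalyticAt ℂ (grad f) p :=
  (((ContinuousLinearMap.apply ℂ ℂ ((1 : ℂ), (0 : ℂ))).analyticAt _).fun_comp hf.fderiv).prod
    (((ContinuousLinearMap.apply ℂ ℂ ((0 : ℂ), (1 : ℂ))).analyticAt _).fun_comp hf.fderiv)

lemma extD_grad {f : ℂ × ℂ → ℂ} {p : ℂ × ℂ} (hf : AnalyticAt ℂ f p) : extD (grad f) p = 0 := by
  have hd : DifferentiableAt ℂ (fderiv ℂ f) p := hf.fderiv.differentiableAt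
  have h : ∀ v : ℂ × ℂ, fderiv ℂ (fun q => fderiv ℂ f q v) p
      = (fderiv ℂ (fderiv ℂ f) p).flip v := by
    intro v
    rw [fderiv_clm_apply hd (differentiableAt_const v)]
    simp
  have hs : IsSymmSndFDerivAt ℂ f p := hf.contDiffAt.isSymmSndFDerivAt (n := ⊤) (by simp)
  simp only [extD, grad]
  rw [h, h]
  simp only [ContinuousLinearMap.flip_apply]
  rw [hs.eq, sub_self]

/-- Logarithmic differentials are closed. This makes curvature independent of the normalization of
the 1-forms, and removes the term (1/2) d log D from the curvature formula. -/
lemma extD_inv_smul_grad {f : ℂ × ℂ → ℂ} {p : ℂ × ℂ} (hf : AnalyticAt ℂ f p) (h0 : f p ≠ 0) :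
    extD (fun q => (f q)⁻¹ • grad f q) p = 0 := by
  have hi : AnalyticAt ℂ (fun q => (f q)⁻¹) p := hf.inv h0
  rw [extD_smul hi.differentiableAt hf.grad.differentiableAt, extD_grad hf,
    grad_inv hf.differentiableAt h0]
  simp [wedge]
  ring

lemma _root_.AnalyticAt.wedge {E : Type*} [NormedAddCommGroup E] [NormedSpace ℂ E]
    {α β : E → ℂ × ℂ} {p : E} (hα : AnalyticAt ℂ α p) (hβ : AnalyticAt ℂ β p) :
    AnalyticAt ℂ (fun q => wedge (α q) (β q)) p :=
  ((analyticAt_fst.fun_comp hα).mul (analyticAt_snd.fun_comp hβ)).sub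
    ((analyticAt_snd.fun_comp hα).mul (analyticAt_fst.fun_comp hβ))

lemma wedge_swap (a b : ℂ × ℂ) : wedge a b = -wedge b a := by simp only [wedge]; ring

lemma wedge_self (a : ℂ × ℂ) : wedge a a = 0 := by simp only [wedge]; ring

lemma wedge_smul_right (c : ℂ) (a b : ℂ × ℂ) : wedge a (c • b) = c * wedge a b := by
  simp only [wedge, Prod.smul_fst, Prod.smul_snd, smul_eq_mul]; ring

lemma wedge_smul_left (c : ℂ) (a b : ℂ × ℂ) : wedge (c • a) b = c * wedge a b := by
  simp only [wedge, Prod.smul_fst, Prod.smul_snd, smul_eq_mul]; ring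

lemma wedge_add_left (a a' b : ℂ × ℂ) : wedge (a + a') b = wedge a b + wedge a' b := by
  simp only [wedge, Prod.fst_add, Prod.snd_add]; ring

lemma wedge_sub_left (a a' b : ℂ × ℂ) : wedge (a - a') b = wedge a b - wedge a' b := by
  simp only [wedge, Prod.fst_sub, Prod.snd_sub]; ring

lemma wedge_add_right (a b b' : ℂ × ℂ) : wedge a (b + b') = wedge a b + wedge a b' := by
  simp only [wedge, Prod.fst_add, Prod.snd_add]; ring

/-- The covector `η` with `η ∧ a = A` and `η ∧ b = B`. -/
def solveForm (a b : ℂ × ℂ) (A B : ℂ) : ℂ × ℂ := (wedge a b)⁻¹ • (B • a - A • b)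

lemma eq_solveForm {a b η : ℂ × ℂ} {A B : ℂ} (h : wedge a b ≠ 0) (hA : wedge η a = A)
    (hB : wedge η b = B) : η = solveForm a b A B := by
  rw [solveForm, eq_inv_smul_iff₀ h, ← hA, ← hB]
  ext <;> simp only [wedge, Prod.smul_fst, Prod.smul_snd, smul_eq_mul, Prod.fst_sub,
    Prod.snd_sub] <;> ring

lemma analyticAt_solveForm {E : Type*} [NormedAddCommGroup E] [NormedSpace ℂ E]
    {a b : E → ℂ × ℂ} {A B : E → ℂ} {p : E} (ha : AnalyticAt ℂ a p) (hb : AnalyticAt ℂ b p)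
    (hA : AnalyticAt ℂ A p) (hB : AnalyticAt ℂ B p) (h : wedge (a p) (b p) ≠ 0) :
    AnalyticAt ℂ (fun q => solveForm (a q) (b q) (A q) (B q)) p :=
  ((ha.wedge hb).inv h).smul ((hB.smul ha).sub (hA.smul hb))

end Calculus

/-! ### The forms η and the curvature of 3-webs. -/

section EtaForms

variable {α β γ η : ℂ × ℂ → ℂ × ℂ} {p : ℂ × ℂ}

/-- The equation `d (δ α) = η ∧ δ α` in terms of `η ∧ α`. -/
lemma EtaEq.wedge_eq (h : EtaEq α β γ η p) (hα : AnalyticAt ℂ α p) (hβ : AnalyticAt ℂ β p)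
    (hγ : AnalyticAt ℂ γ p) (h0 : wedge (β p) (γ p) ≠ 0) :
    ∀ᶠ q in 𝓝 p, wedge (η q) (α q) = extD α q
      + wedge (grad (fun z => wedge (β z) (γ z)) q) (α q) / wedge (β q) (γ q) := by
  have hδ := hβ.wedge hγ
  filter_upwards [h, hα.eventually_analyticAt, hδ.eventually_analyticAt,
    hδ.continuousAt.eventually_ne h0] with q h1 h2 h3 h4
  rw [extD_smul h3.differentiableAt h2.differentiableAt, wedge_smul_right] at h1
  field_simp
  linear_combination -h1

lemma IsEta.cycle (h : IsEta α β γ η p) : IsEta β γ α η p := ⟨h.1, h.2.2.1, h.2.2.2, h.2.1⟩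

lemma EtaEq.swap (h : EtaEq α β γ η p) (hα : AnalyticAt ℂ α p) (hβ : AnalyticAt ℂ β p)
    (hγ : AnalyticAt ℂ γ p) : EtaEq α γ β η p := by
  have ha : AnalyticAt ℂ (fun z => wedge (β z) (γ z) • α z) p := (hβ.wedge hγ).smul hα
  have hz : (fun z => wedge (γ z) (β z) • α z) = fun z => -(wedge (β z) (γ z) • α z) := by
    ext1 z
    rw [wedge_swap, neg_smul]
  filter_upwards [h, ha.eventually_analyticAt] with q h1 h2
  rw [hz, extD_neg h2.differentiableAt, h1, wedge_smul_right, wedge_smul_right,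
    wedge_swap (γ q) (β q)]
  ring

lemma IsEta.swap (h : IsEta α β γ η p) (hα : AnalyticAt ℂ α p) (hβ : AnalyticAt ℂ β p)
    (hγ : AnalyticAt ℂ γ p) : IsEta β α γ η p :=
  ⟨h.1, h.2.2.1.swap hβ hγ hα, h.2.1.swap hα hβ hγ, h.2.2.2.swap hγ hα hβ⟩

/-- Each of the three products δ α is multiplied by the same function F = f g h, so η changes by dF
/ F. -/
lemma EtaEq.scale {f g h : ℂ × ℂ → ℂ} (H : EtaEq α β γ η p) (hα : AnalyticAt ℂ α p)
    (hβ : AnalyticAt ℂ β p) (hγ : AnalyticAt ℂ γ p) {F : ℂ × ℂ → ℂ} (hF : AnalyticAt ℂ F p)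
    (hF0 : F p ≠ 0) (hfgh : ∀ q, F q = f q * g q * h q) :
    EtaEq (fun q => f q • α q) (fun q => g q • β q) (fun q => h q • γ q)
      (fun q => η q + (F q)⁻¹ • grad F q) p := by
  have ha : AnalyticAt ℂ (fun z => wedge (β z) (γ z) • α z) p := (hβ.wedge hγ).smul hα
  have hz : ∀ z, wedge (g z • β z) (h z • γ z) • f z • α z
      = F z • (wedge (β z) (γ z) • α z) := by
    intro z
    rw [wedge_smul_left, wedge_smul_right, hfgh, smul_smul, smul_smul]
    ring_nf
  filter_upwards [H, ha.eventually_analyticAt, hF.eventually_analyticAt,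
    hF.continuousAt.eventually_ne hF0] with q h1 h2 h3 h4
  simp only [hz]
  rw [extD_smul h3.differentiableAt h2.differentiableAt, h1, wedge_add_left, wedge_smul_left]
  rw [wedge_smul_right (F q), wedge_smul_right (F q)]
  field_simp

lemma IsEta.scale {f g h : ℂ × ℂ → ℂ} (H : IsEta α β γ η p) (hα : AnalyticAt ℂ α p)
    (hβ : AnalyticAt ℂ β p) (hγ : AnalyticAt ℂ γ p) {F : ℂ × ℂ → ℂ} (hF : AnalyticAt ℂ F p)
    (hF0 : F p ≠ 0) (hfgh : ∀ q, F q = f q * g q * h q) :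
    IsEta (fun q => f q • α q) (fun q => g q • β q) (fun q => h q • γ q)
      (fun q => η q + (F q)⁻¹ • grad F q) p :=
  ⟨H.1.add ((hF.inv hF0).smul hF.grad), H.2.1.scale hα hβ hγ hF hF0 hfgh,
    H.2.2.1.scale hβ hγ hα hF hF0 (fun q => by rw [hfgh]; ring),
    H.2.2.2.scale hγ hα hβ hF hF0 (fun q => by rw [hfgh]; ring)⟩

lemma EtaEq.congr {α' β' γ' : ℂ × ℂ → ℂ × ℂ} (h : EtaEq α β γ η p) (hα : α =ᶠ[𝓝 p] α')
    (hβ : β =ᶠ[𝓝 p] β') (hγ : γ =ᶠ[𝓝 p] γ') : EtaEq α' β' γ' η p := by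
  have h1 : ∀ᶠ q in 𝓝 p, wedge (β q) (γ q) • α q = wedge (β' q) (γ' q) • α' q := by
    filter_upwards [hα, hβ, hγ] with q h1 h2 h3
    rw [h1, h2, h3]
  filter_upwards [h, h1.eventually_nhds] with q h2 h3
  rw [← h3.self_of_nhds, ← h2]
  exact (extD_congr h3).symm

/-- The `3`-web defined by `α`, `β`, `γ` has curvature `κ` at `p`. -/
def HasTripleCurvature (α β γ : ℂ × ℂ → ℂ × ℂ) (p : ℂ × ℂ) (κ : ℂ) : Prop :=
  ∃ η, IsEta α β γ η p ∧ κ = extD η p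

lemma HasTripleCurvature.cycle {κ : ℂ} (h : HasTripleCurvature α β γ p κ) :
    HasTripleCurvature β γ α p κ := by
  obtain ⟨η, h1, h2⟩ := h
  exact ⟨η, h1.cycle, h2⟩

lemma HasTripleCurvature.swap {κ : ℂ} (h : HasTripleCurvature α β γ p κ)
    (hα : AnalyticAt ℂ α p) (hβ : AnalyticAt ℂ β p) (hγ : AnalyticAt ℂ γ p) :
    HasTripleCurvature β α γ p κ := by
  obtain ⟨η, h1, h2⟩ := h
  exact ⟨η, h1.swap hα hβ hγ, h2⟩

lemma HasTripleCurvature.scale {κ : ℂ} {f g h : ℂ × ℂ → ℂ} (H : HasTripleCurvature α β γ p κ)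
    (hα : AnalyticAt ℂ α p) (hβ : AnalyticAt ℂ β p) (hγ : AnalyticAt ℂ γ p)
    (hf : AnalyticAt ℂ f p) (hg : AnalyticAt ℂ g p) (hh : AnalyticAt ℂ h p)
    (hf0 : f p ≠ 0) (hg0 : g p ≠ 0) (hh0 : h p ≠ 0) :
    HasTripleCurvature (fun q => f q • α q) (fun q => g q • β q) (fun q => h q • γ q) p κ := by
  obtain ⟨η, h1, h2⟩ := H
  have hF : AnalyticAt ℂ (fun q => f q * g q * h q) p := (hf.mul hg).mul hh
  have hF0 : (fun q => f q * g q * h q) p ≠ 0 := mul_ne_zero (mul_ne_zero hf0 hg0) hh0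
  refine ⟨_, h1.scale hα hβ hγ hF hF0 (fun q => rfl), ?_⟩
  have hi : AnalyticAt ℂ (fun q => (f q * g q * h q)⁻¹ • grad (fun q => f q * g q * h q) q) p :=
    (hF.inv hF0).smul hF.grad
  rw [extD_add h1.1.differentiableAt hi.differentiableAt, extD_inv_smul_grad hF hF0, add_zero, h2]

lemma HasTripleCurvature.congr {κ : ℂ} {α' β' γ' : ℂ × ℂ → ℂ × ℂ}
    (h : HasTripleCurvature α β γ p κ) (hα : α =ᶠ[𝓝 p] α') (hβ : β =ᶠ[𝓝 p] β')
    (hγ : γ =ᶠ[𝓝 p] γ') : HasTripleCurvature α' β' γ' p κ := by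
  obtain ⟨η, h1, h2⟩ := h
  exact ⟨η, ⟨h1.1, h1.2.1.congr hα hβ hγ, h1.2.2.1.congr hβ hγ hα, h1.2.2.2.congr hγ hα hβ⟩, h2⟩

/-- Two foliations that coincide with given ones up to units have the same curvature. -/
lemma HasTripleCurvature.of_wedge_eq_zero {κ : ℂ} {f g h : ℂ × ℂ → ℂ} {α' β' γ' : ℂ × ℂ → ℂ × ℂ}
    (H : HasTripleCurvature α' β' γ' p κ)
    (hα : AnalyticAt ℂ α p) (hβ : AnalyticAt ℂ β p) (hγ : AnalyticAt ℂ γ p)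
    (hf : AnalyticAt ℂ f p) (hg : AnalyticAt ℂ g p) (hh : AnalyticAt ℂ h p)
    (hf0 : f p ≠ 0) (hg0 : g p ≠ 0) (hh0 : h p ≠ 0)
    (ha : ∀ᶠ q in 𝓝 p, α' q = f q • α q) (hb : ∀ᶠ q in 𝓝 p, β' q = g q • β q)
    (hc : ∀ᶠ q in 𝓝 p, γ' q = h q • γ q) : HasTripleCurvature α β γ p κ := by
  have H1 := H.congr ha hb hc
  have H2 := H1.scale (hf.smul hα) (hg.smul hβ) (hh.smul hγ) (hf.inv hf0) (hg.inv hg0)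
    (hh.inv hh0) (inv_ne_zero hf0) (inv_ne_zero hg0) (inv_ne_zero hh0)
  refine H2.congr ?_ ?_ ?_
  · filter_upwards [hf.continuousAt.eventually_ne hf0] with q hq
    exact inv_smul_smul₀ hq _
  · filter_upwards [hg.continuousAt.eventually_ne hg0] with q hq
    exact inv_smul_smul₀ hq _
  · filter_upwards [hh.continuousAt.eventually_ne hh0] with q hq
    exact inv_smul_smul₀ hq _

/-- The form `η` of a `3`-web of regular foliations. -/
def tripleForm (α β γ : ℂ × ℂ → ℂ × ℂ) (q : ℂ × ℂ) : ℂ × ℂ :=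
  solveForm (α q) (β q)
    (extD α q + wedge (grad (fun z => wedge (β z) (γ z)) q) (α q) / wedge (β q) (γ q))
    (extD β q + wedge (grad (fun z => wedge (γ z) (α z)) q) (β q) / wedge (γ q) (α q))

/-- Two of the three equations prescribe the products of η with two independent 1-forms, hence η
itself. -/
lemma HasTripleCurvature.eq_extD_tripleForm {κ : ℂ} (h : HasTripleCurvature α β γ p κ)
    (hα : AnalyticAt ℂ α p) (hβ : AnalyticAt ℂ β p) (hγ : AnalyticAt ℂ γ p)
    (hαβ : wedge (α p) (β p) ≠ 0) (hβγ : wedge (β p) (γ p) ≠ 0) (hγα : wedge (γ p) (α p) ≠ 0) :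
    κ = extD (tripleForm α β γ) p := by
  obtain ⟨η, h1, rfl⟩ := h
  refine extD_congr ?_
  filter_upwards [h1.2.1.wedge_eq hα hβ hγ hβγ, h1.2.2.1.wedge_eq hβ hγ hα hγα,
    (hα.wedge hβ).continuousAt.eventually_ne hαβ] with q h2 h3 h4
  exact eq_solveForm h4 h2 h3

/-- The sum of the forms `η` of the two `3`-webs formed by `μ`, `ν` and one of the foliations of the
`2`-web `V`. -/
def pairForm (V : ℂ × ℂ → ℂ[X]) (μ ν : ℂ × ℂ → ℂ × ℂ) (q : ℂ × ℂ) : ℂ × ℂ :=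
  solveForm (μ q) (ν q)
    (2 * extD μ q + wedge (grad (fun z => formEval 2 (V z) (kerVec (ν z))) q) (μ q)
      / formEval 2 (V q) (kerVec (ν q)))
    (2 * extD ν q + wedge (grad (fun z => formEval 2 (V z) (kerVec (μ z))) q) (ν q)
      / formEval 2 (V q) (kerVec (μ q)))

lemma formEval_two_kerVec (a b m : ℂ × ℂ) :
    formEval 2 ((C a.1 + C a.2 * X) * (C b.1 + C b.2 * X)) (kerVec m)
      = wedge a m * wedge b m := by
  rw [show (2 : ℕ) = 1 + 1 from rfl, formEval_mul (natDegree_linear_le _ _)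
    (natDegree_linear_le _ _), formEval_linear, formEval_linear]
  simp only [kerVec, wedge]
  ring

/-- The foliations α and β of V are not analytic at the discriminant, but the sum over both is
symmetric in them: the logarithmic differentials of α ∧ ν and β ∧ ν add up to that of V evaluated on
the kernel of ν. The result involves the coefficients of V only and has no pole where μ and ν are
transverse to each other and to V. -/
lemma add_eq_extD_pairForm {V : ℂ × ℂ → ℂ[X]} {μ ν : ℂ × ℂ → ℂ × ℂ} {κ κ' : ℂ}
    (hV : ∀ᶠ q in 𝓝 p, V q = (C (α q).1 + C (α q).2 * X) * (C (β q).1 + C (β q).2 * X))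
    (h : HasTripleCurvature α μ ν p κ) (h' : HasTripleCurvature β μ ν p κ')
    (hα : AnalyticAt ℂ α p) (hβ : AnalyticAt ℂ β p) (hμ : AnalyticAt ℂ μ p)
    (hν : AnalyticAt ℂ ν p) (hμν : wedge (μ p) (ν p) ≠ 0)
    (hμ0 : formEval 2 (V p) (kerVec (μ p)) ≠ 0) (hν0 : formEval 2 (V p) (kerVec (ν p)) ≠ 0) :
    κ + κ' = extD (pairForm V μ ν) p := by
  obtain ⟨η, h1, rfl⟩ := h
  obtain ⟨η', h1', rfl⟩ := h'
  rw [← extD_add h1.1.differentiableAt h1'.1.differentiableAt]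
  refine extD_congr ?_
  have key : ∀ m : ℂ × ℂ → ℂ × ℂ, AnalyticAt ℂ m p → formEval 2 (V p) (kerVec (m p)) ≠ 0 →
      wedge (α p) (m p) ≠ 0 ∧ wedge (β p) (m p) ≠ 0 ∧
      ∀ᶠ q in 𝓝 p, wedge (α q) (m q) ≠ 0 ∧ wedge (β q) (m q) ≠ 0 ∧
        formEval 2 (V q) (kerVec (m q)) = wedge (α q) (m q) * wedge (β q) (m q) ∧
        grad (fun z => formEval 2 (V z) (kerVec (m z))) q
          = wedge (α q) (m q) • grad (fun z => wedge (β z) (m z)) q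
            + wedge (β q) (m q) • grad (fun z => wedge (α z) (m z)) q := by
    intro m hm hm0
    have hVm : ∀ᶠ q in 𝓝 p, formEval 2 (V q) (kerVec (m q))
        = wedge (α q) (m q) * wedge (β q) (m q) := by
      filter_upwards [hV] with q hq
      rw [hq, formEval_two_kerVec]
    rw [hVm.self_of_nhds, mul_ne_zero_iff] at hm0
    refine ⟨hm0.1, hm0.2, ?_⟩
    filter_upwards [hVm.eventually_nhds, (hα.wedge hm).continuousAt.eventually_ne hm0.1,
      (hβ.wedge hm).continuousAt.eventually_ne hm0.2, (hα.wedge hm).eventually_analyticAt,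
      (hβ.wedge hm).eventually_analyticAt] with q e1 e2 e3 e4 e5
    refine ⟨e2, e3, e1.self_of_nhds, ?_⟩
    rw [grad_congr e1, grad_mul e4.differentiableAt e5.differentiableAt]
  have gneg : ∀ (a b : ℂ × ℂ → ℂ × ℂ) (q : ℂ × ℂ), grad (fun z => wedge (a z) (b z)) q
      = -grad (fun z => wedge (b z) (a z)) q := by
    intro a b q
    have : (fun z => wedge (a z) (b z)) = fun z => -wedge (b z) (a z) := by
      ext1 z; rw [wedge_swap]
    rw [this, grad, grad, fderiv_fun_neg]
    rfl
  obtain ⟨a1, b1, k1⟩ := key μ hμ hμ0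
  obtain ⟨a2, b2, k2⟩ := key ν hν hν0
  have n1 : ∀ {a b : ℂ × ℂ}, wedge a b ≠ 0 → wedge b a ≠ 0 := fun h => by
    rw [wedge_swap]; exact neg_ne_zero.2 h
  filter_upwards [h1.2.2.1.wedge_eq hμ hν hα (n1 a2), h1'.2.2.1.wedge_eq hμ hν hβ (n1 b2),
    h1.2.2.2.wedge_eq hν hα hμ a1, h1'.2.2.2.wedge_eq hν hβ hμ b1, k1, k2,
    (hμ.wedge hν).continuousAt.eventually_ne hμν] with q e1 e2 e3 e4 e5 e6 e7
  refine eq_solveForm e7 ?_ ?_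
  · obtain ⟨d1, d2, d3, d4⟩ := e6
    rw [wedge_add_left, e1, e2, d3, d4, gneg ν α, gneg ν β, wedge_swap (ν q) (α q),
      wedge_swap (ν q) (β q), wedge_add_left, wedge_smul_left, wedge_smul_left]
    have hn : ∀ a b : ℂ × ℂ, wedge (-a) b = -wedge a b := fun a b => by
      simp only [wedge, Prod.fst_neg, Prod.snd_neg]; ring
    rw [hn, hn]
    field_simp
    ring
  · obtain ⟨d1, d2, d3, d4⟩ := e5
    rw [wedge_add_left, e3, e4, d3, d4, wedge_add_left, wedge_smul_left, wedge_smul_left]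
    field_simp
    ring

/-- Twice the bilinear form associated with the quadratic form `F`, at the vector `v`. -/
def polarForm (F : ℂ[X]) (v : ℂ × ℂ) : ℂ × ℂ :=
  (2 * F.coeff 0 * v.1 + F.coeff 1 * v.2, F.coeff 1 * v.1 + 2 * F.coeff 2 * v.2)

/-- The pairing of a covector and a vector. -/
def pairing (a v : ℂ × ℂ) : ℂ := a.1 * v.1 + a.2 * v.2

/-- The holomorphic part of the form `η` of the `3`-web formed by the `2`-web `V` and the foliation
`μ`, with respect to a vector `e` on which the form `V` does not vanish. -/
def mixedForm (V : ℂ × ℂ → ℂ[X]) (μ : ℂ × ℂ → ℂ × ℂ) (e : ℂ × ℂ) (q : ℂ × ℂ) : ℂ × ℂ :=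
  solveForm (polarForm (V q) (kerVec (μ q))) (μ q)
    (extD (fun z => polarForm (V z) (kerVec (μ z))) q
      + wedge (kerVec (μ q)) e * wedge (grad (fun z => formDiscr 2 (V z)) q) (kerVec e)
        / (2 * pairing (polarForm (V q) e) e))
    (extD μ q)

/-- The coefficient of `μ` in the polar part of the form `η` of the `3`-web formed by the `2`-web
`V` and the foliation `μ`. -/
def polarCoeff (V : ℂ × ℂ → ℂ[X]) (μ : ℂ × ℂ → ℂ × ℂ) (e : ℂ × ℂ) (q : ℂ × ℂ) : ℂ :=
  pairing (polarForm (V q) (kerVec (μ q))) e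
    / (2 * wedge (polarForm (V q) (kerVec (μ q))) (μ q) * pairing (polarForm (V q) e) e)

lemma analyticAt_polarForm {E : Type*} [NormedAddCommGroup E] [NormedSpace ℂ E]
    {V : E → ℂ[X]} {v : E → ℂ × ℂ} {z : E} (hV : ∀ i, AnalyticAt ℂ (fun q => (V q).coeff i) z)
    (hv : AnalyticAt ℂ v z) : AnalyticAt ℂ (fun q => polarForm (V q) (v q)) z :=
  (((analyticAt_const.mul (hV 0)).mul (analyticAt_fst.fun_comp hv)).add
    ((hV 1).mul (analyticAt_snd.fun_comp hv))).prod
  (((hV 1).mul (analyticAt_fst.fun_comp hv)).add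
    ((analyticAt_const.mul (hV 2)).mul (analyticAt_snd.fun_comp hv)))

lemma _root_.AnalyticAt.kerVec {E : Type*} [NormedAddCommGroup E] [NormedSpace ℂ E]
    {v : E → ℂ × ℂ} {z : E} (hv : AnalyticAt ℂ v z) : AnalyticAt ℂ (fun q => kerVec (v q)) z :=
  (analyticAt_snd.fun_comp hv).prod (analyticAt_fst.fun_comp hv).neg

lemma _root_.AnalyticAt.pairing {E : Type*} [NormedAddCommGroup E] [NormedSpace ℂ E]
    {a v : E → ℂ × ℂ} {z : E} (ha : AnalyticAt ℂ a z) (hv : AnalyticAt ℂ v z) :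
    AnalyticAt ℂ (fun q => pairing (a q) (v q)) z :=
  ((analyticAt_fst.fun_comp ha).mul (analyticAt_fst.fun_comp hv)).add
    ((analyticAt_snd.fun_comp ha).mul (analyticAt_snd.fun_comp hv))

/-! ### Joint analyticity in (ε, x, y) of forms built by differentiation along the fibres. -/

section Families

variable {F : ℂ × (ℂ × ℂ) → ℂ} {μ ν ρ : ℂ × (ℂ × ℂ) → ℂ × ℂ} {z : ℂ × (ℂ × ℂ)}

lemma fderiv_slice {G : Type*} [NormedAddCommGroup G] [NormedSpace ℂ G]
    {F : ℂ × (ℂ × ℂ) → G} {z : ℂ × (ℂ × ℂ)} (hF : DifferentiableAt ℂ F z)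
    (v : ℂ × ℂ) : fderiv ℂ (fun p => F (z.1, p)) z.2 v = fderiv ℂ F z (0, v) := by
  have h1 : HasFDerivAt (fun p : ℂ × ℂ => (z.1, p)) (ContinuousLinearMap.inr ℂ ℂ (ℂ × ℂ)) z.2 :=
    hasFDerivAt_prodMk_right z.1 z.2
  have h2 : HasFDerivAt F (fderiv ℂ F z) ((fun p : ℂ × ℂ => (z.1, p)) z.2) := hF.hasFDerivAt
  have h3 : HasFDerivAt (fun p => F (z.1, p)) _ z.2 := h2.comp z.2 h1
  rw [h3.fderiv]
  rfl

lemma analyticAt_slice {G : Type*} [NormedAddCommGroup G] [NormedSpace ℂ G]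
    {F : ℂ × (ℂ × ℂ) → G} {z : ℂ × (ℂ × ℂ)} (hF : AnalyticAt ℂ F z) :
    AnalyticAt ℂ (fun p => F (z.1, p)) z.2 := by
  have h1 : AnalyticAt ℂ F ((fun p : ℂ × ℂ => (z.1, p)) z.2) := hF
  exact h1.fun_comp (analyticAt_const.prod analyticAt_id)

lemma analyticAt_fderiv_apply (hF : AnalyticAt ℂ F z) (v : ℂ × (ℂ × ℂ)) :
    AnalyticAt ℂ (fun w => fderiv ℂ F w v) z :=
  ((ContinuousLinearMap.apply ℂ ℂ v).analyticAt _).fun_comp hF.fderiv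

lemma analyticAt_grad_slice (hF : AnalyticAt ℂ F z) :
    AnalyticAt ℂ (fun w : ℂ × (ℂ × ℂ) => grad (fun p => F (w.1, p)) w.2) z := by
  refine ((analyticAt_fderiv_apply hF (0, (1, 0))).prod
    (analyticAt_fderiv_apply hF (0, (0, 1)))).congr ?_
  filter_upwards [hF.eventually_analyticAt] with w hw
  rw [grad, fderiv_slice hw.differentiableAt, fderiv_slice hw.differentiableAt]

lemma analyticAt_extD_slice (hμ : AnalyticAt ℂ μ z) :
    AnalyticAt ℂ (fun w : ℂ × (ℂ × ℂ) => extD (fun p => μ (w.1, p)) w.2) z := by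
  have h1 : AnalyticAt ℂ (fun w => (μ w).1) z := analyticAt_fst.fun_comp hμ
  have h2 : AnalyticAt ℂ (fun w => (μ w).2) z := analyticAt_snd.fun_comp hμ
  refine ((analyticAt_fderiv_apply h2 (0, (1, 0))).sub
    (analyticAt_fderiv_apply h1 (0, (0, 1)))).congr ?_
  filter_upwards [h1.eventually_analyticAt, h2.eventually_analyticAt] with w hw1 hw2
  rw [extD, fderiv_slice (F := fun w => (μ w).1) hw1.differentiableAt,
    fderiv_slice (F := fun w => (μ w).2) hw2.differentiableAt]
  rfl

lemma analyticAt_tripleForm_slice (hμ : AnalyticAt ℂ μ z) (hν : AnalyticAt ℂ ν z)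
    (hρ : AnalyticAt ℂ ρ z) (hμν : wedge (μ z) (ν z) ≠ 0) (hνρ : wedge (ν z) (ρ z) ≠ 0)
    (hρμ : wedge (ρ z) (μ z) ≠ 0) :
    AnalyticAt ℂ (fun w : ℂ × (ℂ × ℂ) => tripleForm (fun p => μ (w.1, p)) (fun p => ν (w.1, p))
      (fun p => ρ (w.1, p)) w.2) z :=
  analyticAt_solveForm hμ hν
    ((analyticAt_extD_slice hμ).add
      (((analyticAt_grad_slice (hν.wedge hρ)).wedge hμ).div (hν.wedge hρ) hνρ))
    ((analyticAt_extD_slice hν).add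
      (((analyticAt_grad_slice (hρ.wedge hμ)).wedge hν).div (hρ.wedge hμ) hρμ)) hμν

variable {V : ℂ × (ℂ × ℂ) → ℂ[X]}

lemma analyticAt_pairForm_slice (hV : ∀ i, AnalyticAt ℂ (fun q => (V q).coeff i) z)
    (hμ : AnalyticAt ℂ μ z) (hν : AnalyticAt ℂ ν z) (hμν : wedge (μ z) (ν z) ≠ 0)
    (hμ0 : formEval 2 (V z) (kerVec (μ z)) ≠ 0) (hν0 : formEval 2 (V z) (kerVec (ν z)) ≠ 0) :
    AnalyticAt ℂ (fun w : ℂ × (ℂ × ℂ) => pairForm (fun p => V (w.1, p)) (fun p => μ (w.1, p))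
      (fun p => ν (w.1, p)) w.2) z :=
  analyticAt_solveForm hμ hν
    ((analyticAt_const.mul (analyticAt_extD_slice hμ)).add
      (((analyticAt_grad_slice (analyticAt_formEval 2 hV hν.kerVec)).wedge hμ).div
        (analyticAt_formEval 2 hV hν.kerVec) hν0))
    ((analyticAt_const.mul (analyticAt_extD_slice hν)).add
      (((analyticAt_grad_slice (analyticAt_formEval 2 hV hμ.kerVec)).wedge hν).div
        (analyticAt_formEval 2 hV hμ.kerVec) hμ0)) hμν

lemma analyticAt_mixedForm_slice (hV : ∀ i, AnalyticAt ℂ (fun q => (V q).coeff i) z)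
    (hμ : AnalyticAt ℂ μ z) {e : ℂ × ℂ}
    (hμ0 : wedge (polarForm (V z) (kerVec (μ z))) (μ z) ≠ 0)
    (he : pairing (polarForm (V z) e) e ≠ 0) :
    AnalyticAt ℂ (fun w : ℂ × (ℂ × ℂ) => mixedForm (fun p => V (w.1, p)) (fun p => μ (w.1, p)) e
      w.2) z := by
  have hp := analyticAt_polarForm hV hμ.kerVec
  refine analyticAt_solveForm hp hμ ((analyticAt_extD_slice hp).add ?_)
    (analyticAt_extD_slice hμ) hμ0
  exact ((hμ.kerVec.wedge analyticAt_const).mul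
    ((analyticAt_grad_slice (analyticAt_formDiscr 2 hV)).wedge analyticAt_const)).div
    (analyticAt_const.mul ((analyticAt_polarForm hV analyticAt_const).pairing analyticAt_const))
    (mul_ne_zero two_ne_zero he)

lemma analyticAt_polarCoeff {E : Type*} [NormedAddCommGroup E] [NormedSpace ℂ E]
    {V : E → ℂ[X]} {μ : E → ℂ × ℂ} {z : E} (hV : ∀ i, AnalyticAt ℂ (fun q => (V q).coeff i) z)
    (hμ : AnalyticAt ℂ μ z) {e : ℂ × ℂ}
    (hμ0 : wedge (polarForm (V z) (kerVec (μ z))) (μ z) ≠ 0)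
    (he : pairing (polarForm (V z) e) e ≠ 0) :
    AnalyticAt ℂ (fun q => pairing (polarForm (V q) (kerVec (μ q))) e
      / (2 * wedge (polarForm (V q) (kerVec (μ q))) (μ q) * pairing (polarForm (V q) e) e)) z :=
  ((analyticAt_polarForm hV hμ.kerVec).pairing analyticAt_const).div
    ((analyticAt_const.mul ((analyticAt_polarForm hV hμ.kerVec).wedge hμ)).mul
      ((analyticAt_polarForm hV analyticAt_const).pairing analyticAt_const))
    (mul_ne_zero (mul_ne_zero two_ne_zero hμ0) he)

end Families

lemma linear_mul_linear (a b : ℂ × ℂ) : (C a.1 + C a.2 * X) * (C b.1 + C b.2 * X)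
    = C (a.1 * b.1) + C (a.1 * b.2 + a.2 * b.1) * X + C (a.2 * b.2) * X ^ 2 := by
  simp only [map_mul, map_add]
  ring

lemma coeff_quadratic (x y z : ℂ) : (C x + C y * X + C z * X ^ 2).coeff 0 = x ∧
    (C x + C y * X + C z * X ^ 2).coeff 1 = y ∧ (C x + C y * X + C z * X ^ 2).coeff 2 = z := by
  refine ⟨?_, ?_, ?_⟩ <;> simp [coeff_X, coeff_C]

lemma polarForm_mul_kerVec (a b m : ℂ × ℂ) :
    polarForm ((C a.1 + C a.2 * X) * (C b.1 + C b.2 * X)) (kerVec m)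
      = wedge b m • a + wedge a m • b := by
  obtain ⟨h0, h1, h2⟩ := coeff_quadratic (a.1 * b.1) (a.1 * b.2 + a.2 * b.1) (a.2 * b.2)
  rw [linear_mul_linear, polarForm, h0, h1, h2]
  ext <;> simp only [kerVec, wedge, Prod.fst_add, Prod.snd_add, Prod.smul_fst, Prod.smul_snd,
    smul_eq_mul] <;> ring

lemma formDiscr_two_mul (a b : ℂ × ℂ) :
    formDiscr 2 ((C a.1 + C a.2 * X) * (C b.1 + C b.2 * X)) = wedge a b * wedge a b := by
  obtain ⟨h0, h1, h2⟩ := coeff_quadratic (a.1 * b.1) (a.1 * b.2 + a.2 * b.1) (a.2 * b.2)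
  rw [linear_mul_linear, formDiscr_two, h0, h1, h2]
  simp only [wedge]
  ring

/-- The symmetric matrix of the polarization has determinant minus the discriminant. Hence all polar
forms of V are proportional where D = 0. -/
lemma wedge_polarForm (F : ℂ[X]) (v e : ℂ × ℂ) :
    wedge (polarForm F v) (polarForm F e) = -formDiscr 2 F * wedge v e := by
  rw [formDiscr_two]
  simp only [wedge, polarForm]
  ring

/-- With δ the coefficient of α ∧ β, D = δ², so η ∧ μ is dμ plus (1/2) d log D ∧ μ; and the product
of η with P, the polar form at the kernel of μ, has no pole. These determine η. Subtracting the
closed form (1/2) d log D leaves a polar part along μ, proportional to dD ∧ P / D. Since all polar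
forms are proportional modulo D, P can be replaced there by the polar form ω at the fixed vector e,
which does not depend on μ. -/
lemma eq_extD_mixedForm {V : ℂ × ℂ → ℂ[X]} {μ : ℂ × ℂ → ℂ × ℂ} {e : ℂ × ℂ} {κ : ℂ}
    (hV : ∀ᶠ q in 𝓝 p, V q = (C (α q).1 + C (α q).2 * X) * (C (β q).1 + C (β q).2 * X))
    (hVa : ∀ i, AnalyticAt ℂ (fun q => (V q).coeff i) p)
    (h : HasTripleCurvature α β μ p κ) (hα : AnalyticAt ℂ α p) (hβ : AnalyticAt ℂ β p)
    (hμ : AnalyticAt ℂ μ p) (hD : formDiscr 2 (V p) ≠ 0)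
    (hμ0 : wedge (polarForm (V p) (kerVec (μ p))) (μ p) ≠ 0)
    (he : pairing (polarForm (V p) e) e ≠ 0) :
    κ = extD (mixedForm V μ e) p
      + extD (fun q => (wedge (grad (fun z => formDiscr 2 (V z)) q) (polarForm (V q) e)
          / formDiscr 2 (V q)) • (polarCoeff V μ e q • μ q)) p := by
  obtain ⟨η, h1, rfl⟩ := h
  have hδ := hα.wedge hβ
  have hDa := analyticAt_formDiscr 2 hVa
  have hpol := analyticAt_polarForm hVa hμ.kerVec
  have hωa : AnalyticAt ℂ (fun q => polarForm (V q) e) p :=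
    analyticAt_polarForm hVa analyticAt_const
  have hDδ : ∀ᶠ q in 𝓝 p, formDiscr 2 (V q) = wedge (α q) (β q) * wedge (α q) (β q) := by
    filter_upwards [hV] with q hq
    rw [hq, formDiscr_two_mul]
  have hδ0 : wedge (α p) (β p) ≠ 0 := by
    intro h0
    rw [hDδ.self_of_nhds, h0, mul_zero] at hD
    exact hD rfl
  have hpolV : ∀ᶠ q in 𝓝 p, polarForm (V q) (kerVec (μ q))
      = wedge (β q) (μ q) • α q + -(wedge (μ q) (α q) • β q) := by
    filter_upwards [hV] with q hq
    rw [hq, polarForm_mul_kerVec, wedge_swap (μ q) (α q), neg_smul, neg_neg]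
  have e1 : ∀ᶠ q in 𝓝 p, wedge (η q) (μ q) = extD μ q
      + wedge (grad (fun z => formDiscr 2 (V z)) q) (μ q) / (2 * formDiscr 2 (V q)) := by
    filter_upwards [h1.2.2.2.wedge_eq hμ hα hβ hδ0, hDδ.eventually_nhds, hδ.eventually_analyticAt,
      hδ.continuousAt.eventually_ne hδ0] with q g1 g2 g3 g4
    rw [g1, grad_congr g2, g2.self_of_nhds, grad_mul g3.differentiableAt g3.differentiableAt,
      wedge_add_left, wedge_smul_left]
    field_simp
    ring
  -- The polar form at the kernel of μ is the difference of the two products δ α that occur in the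
  -- equations of α and β.
  have e2 : ∀ᶠ q in 𝓝 p, wedge (η q) (polarForm (V q) (kerVec (μ q)))
      = extD (fun z => polarForm (V z) (kerVec (μ z))) q := by
    have a1 : AnalyticAt ℂ (fun z => wedge (β z) (μ z) • α z) p := (hβ.wedge hμ).smul hα
    have a2 : AnalyticAt ℂ (fun z => wedge (μ z) (α z) • β z) p := (hμ.wedge hα).smul hβ
    filter_upwards [h1.2.1, h1.2.2.1, hpolV.eventually_nhds, a1.eventually_analyticAt,
      a2.eventually_analyticAt] with q g1 g2 g3 g4 g5
    have g6 : AnalyticAt ℂ (fun z => -(wedge (μ z) (α z) • β z)) q := g5.neg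
    rw [extD_congr g3, extD_add g4.differentiableAt g6.differentiableAt,
      extD_neg g5.differentiableAt, g1, g2, g3.self_of_nhds, wedge_add_right]
    simp only [wedge, Prod.fst_neg, Prod.snd_neg]
    ring
  -- The result on families is applied to the constant family, at the parameter 0.
  have hmix : AnalyticAt ℂ (mixedForm V μ e) p := by
    have s2 : ∀ {G : Type} [NormedAddCommGroup G] [NormedSpace ℂ G] {f : ℂ × ℂ → G},
        AnalyticAt ℂ f p → AnalyticAt ℂ (fun z : ℂ × (ℂ × ℂ) => f z.2) ((0 : ℂ), p) := by
      intro G _ _ f hf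
      have h1 : AnalyticAt ℂ f (((0 : ℂ), p).2) := hf
      exact h1.fun_comp analyticAt_snd
    exact analyticAt_slice (analyticAt_mixedForm_slice (z := ((0 : ℂ), p))
      (V := fun z => V z.2) (μ := fun z => μ z.2) (fun i => s2 (hVa i)) (s2 hμ) hμ0 he)
  have hpc : AnalyticAt ℂ (polarCoeff V μ e) p := analyticAt_polarCoeff hVa hμ hμ0 he
  have hlog : AnalyticAt ℂ (fun q => (formDiscr 2 (V q))⁻¹ • grad (fun z => formDiscr 2 (V z)) q)
      p := (hDa.inv hD).smul hDa.grad
  have hlog2 : AnalyticAt ℂ (fun q => (1 / 2 : ℂ) •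
      ((formDiscr 2 (V q))⁻¹ • grad (fun z => formDiscr 2 (V z)) q)) p :=
    (analyticAt_const (v := (1 / 2 : ℂ))).smul hlog
  have hqB : AnalyticAt ℂ (fun q => (wedge (grad (fun z => formDiscr 2 (V z)) q)
      (polarForm (V q) e) / formDiscr 2 (V q)) • (polarCoeff V μ e q • μ q)) p :=
    ((hDa.grad.wedge hωa).div hDa hD).smul (hpc.smul hμ)
  have hη : ∀ᶠ q in 𝓝 p, η q = (mixedForm V μ e q + (1 / 2 : ℂ) •
      ((formDiscr 2 (V q))⁻¹ • grad (fun z => formDiscr 2 (V z)) q))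
      + (wedge (grad (fun z => formDiscr 2 (V z)) q)
      (polarForm (V q) e) / formDiscr 2 (V q)) • (polarCoeff V μ e q • μ q) := by
    filter_upwards [e1, e2, (hpol.wedge hμ).continuousAt.eventually_ne hμ0,
      (hωa.pairing analyticAt_const).continuousAt.eventually_ne he,
      hDa.continuousAt.eventually_ne hD] with q g1 g2 g3 g4 g5
    have g6 := wedge_polarForm (V q) (kerVec (μ q)) e
    rw [← sub_eq_iff_eq_add, ← sub_eq_iff_eq_add]
    refine eq_solveForm g3 ?_ ?_
    · have g7 : ∀ x y g : ℂ × ℂ, wedge g y * pairing x e - wedge g x * pairing y e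
          = -wedge x y * wedge g (kerVec e) := by
        intro x y g
        simp only [wedge, pairing, kerVec]
        ring
      have g8 := g7 (polarForm (V q) (kerVec (μ q))) (polarForm (V q) e)
        (grad (fun z => formDiscr 2 (V z)) q)
      rw [g6] at g8
      rw [wedge_sub_left, wedge_sub_left, g2, wedge_smul_left, wedge_smul_left, wedge_smul_left,
        wedge_smul_left, wedge_swap (μ q), polarCoeff]
      field_simp
      linear_combination g8
    · rw [wedge_sub_left, wedge_sub_left, g1, wedge_smul_left, wedge_smul_left, wedge_smul_left,
        wedge_smul_left, wedge_self]
      field_simp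
      ring
  rw [extD_congr hη, extD_add (hmix.differentiableAt.fun_add hlog2.differentiableAt) hqB.differentiableAt,
    extD_add hmix.differentiableAt hlog2.differentiableAt,
    extD_const_smul _ hlog.differentiableAt, extD_inv_smul_grad hDa hD]
  ring

end EtaForms

/-! ### Sums over triples of foliations. -/

section Combinatorics

/-- Relabelling the foliations does not respect the order of the indices; the sum over all triples
of distinct indices is insensitive to this, each increasing triple being counted 3! times. -/
lemma six_mul_sum_lt {n : ℕ} (f : Fin n → Fin n → Fin n → ℂ)
    (hswap : ∀ r s t, r ≠ s → s ≠ t → t ≠ r → f s r t = f r s t)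
    (hcycle : ∀ r s t, r ≠ s → s ≠ t → t ≠ r → f s t r = f r s t) :
    6 * ∑ r, ∑ s, ∑ t, (if r < s ∧ s < t then f r s t else 0)
      = ∑ r, ∑ s, ∑ t, if r ≠ s ∧ s ≠ t ∧ t ≠ r then f r s t else 0 := by
  let P : Fin n → Fin n → Fin n → ℂ := fun r s t => if r < s ∧ s < t then f r s t else 0
  have hP : ∀ r s t, (if r ≠ s ∧ s ≠ t ∧ t ≠ r then f r s t else 0)
      = P r s t + P s t r + P t r s + P s r t + P r t s + P t s r := by
    intro r s t
    by_cases h : r ≠ s ∧ s ≠ t ∧ t ≠ r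
    · have e1 := hswap r s t h.1 h.2.1 h.2.2
      have e2 := hcycle r s t h.1 h.2.1 h.2.2
      have e3 := hcycle s t r h.2.1 h.2.2 h.1
      have e4 := hswap t r s h.2.2 h.1 h.2.1
      have e5 := hswap s t r h.2.1 h.2.2 h.1
      rw [if_pos h]
      obtain ⟨h1, h2, h3⟩ := h
      simp only [P]
      rcases lt_or_gt_of_ne h1 with a | a <;> rcases lt_or_gt_of_ne h2 with b | b <;>
        rcases lt_or_gt_of_ne h3 with c | c <;> first
        | exact absurd (a.trans (b.trans c)) (lt_irrefl _)
        | exact absurd (c.trans (b.trans a)) (lt_irrefl _)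
        | simp [a, b, c, a.not_gt, b.not_gt, c.not_gt, e1, e2, e3, e4, e5]
    · rw [if_neg h]
      simp only [P]
      rw [if_neg, if_neg, if_neg, if_neg, if_neg, if_neg]
      · simp
      all_goals
        rintro ⟨a, b⟩
        refine h ⟨?_, ?_, ?_⟩ <;> rintro rfl <;>
          first | exact lt_irrefl _ a | exact lt_irrefl _ b | exact lt_irrefl _ (a.trans b)
  simp only [hP, Finset.sum_add_distrib]
  have q2 : ∑ r, ∑ s, ∑ t, P s t r = ∑ r, ∑ s, ∑ t, P r s t := by
    rw [Finset.sum_comm]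
    refine Finset.sum_congr rfl fun s _ => Finset.sum_comm
  have q4 : ∑ r, ∑ s, ∑ t, P s r t = ∑ r, ∑ s, ∑ t, P r s t := Finset.sum_comm
  have q5 : ∑ r, ∑ s, ∑ t, P r t s = ∑ r, ∑ s, ∑ t, P r s t :=
    Finset.sum_congr rfl fun s _ => Finset.sum_comm
  have q3 : ∑ r, ∑ s, ∑ t, P t r s = ∑ r, ∑ s, ∑ t, P r s t := by
    have : ∀ r : Fin n, ∑ s, ∑ t, P t r s = ∑ t, ∑ s, P t r s := fun r => Finset.sum_comm
    simp only [this]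
    exact Finset.sum_comm
  have q6 : ∑ r, ∑ s, ∑ t, P t s r = ∑ r, ∑ s, ∑ t, P r s t := by
    rw [← q2]
    exact Finset.sum_congr rfl fun r _ => Finset.sum_comm
  rw [q2, q3, q4, q5, q6]
  ring

/-- The two foliations of V together with a third one occur in 6 orders. One foliation of V has 3
possible positions beside a pair (i, j), whose own order is already summed over. -/
lemma sum_triples_bool_sum {κ : Type*} [Fintype κ] (g : Bool ⊕ κ → Bool ⊕ κ → Bool ⊕ κ → ℂ)
    (hswap : ∀ r s t, g s r t = g r s t) (hcycle : ∀ r s t, g s t r = g r s t)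
    (h0 : ∀ r s, g r r s = 0) :
    ∑ r, ∑ s, ∑ t, g r s t
      = 6 * ∑ i, g (Sum.inl true) (Sum.inl false) (Sum.inr i)
        + 3 * ∑ i, ∑ j, (g (Sum.inl true) (Sum.inr i) (Sum.inr j)
          + g (Sum.inl false) (Sum.inr i) (Sum.inr j))
        + ∑ i, ∑ j, ∑ l, g (Sum.inr i) (Sum.inr j) (Sum.inr l) := by
  have h1 : ∀ r s, g r s r = 0 := fun r s => by rw [hcycle r r s]; exact h0 r s
  have h2 : ∀ r s, g s r r = 0 := fun r s => by rw [← hcycle, h0]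
  have c1 : ∀ b i c, g (Sum.inl b) (Sum.inr i) (Sum.inl c)
      = g (Sum.inl c) (Sum.inl b) (Sum.inr i) := fun b i c => hcycle _ _ _
  have c2 : ∀ b i c, g (Sum.inr i) (Sum.inl b) (Sum.inl c)
      = g (Sum.inl b) (Sum.inl c) (Sum.inr i) := fun b i c => (hcycle _ _ _).symm
  have c3 : ∀ b i j, g (Sum.inr i) (Sum.inl b) (Sum.inr j)
      = g (Sum.inl b) (Sum.inr i) (Sum.inr j) := fun b i j => hswap _ _ _
  have c4 : ∀ b i j, g (Sum.inr i) (Sum.inr j) (Sum.inl b)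
      = g (Sum.inl b) (Sum.inr i) (Sum.inr j) := fun b i j => hcycle _ _ _
  have c5 : ∀ i, g (Sum.inl false) (Sum.inl true) (Sum.inr i)
      = g (Sum.inl true) (Sum.inl false) (Sum.inr i) := fun i => hswap _ _ _
  have c6 : ∀ b c d, g (Sum.inl b) (Sum.inl c) (Sum.inl d) = 0 := by
    intro b c d
    cases b <;> cases c <;> cases d <;> simp [h0, h1, h2]
  simp only [Fintype.sum_sum_type, Fintype.sum_bool, c1, c2, c3, c4, c5, c6, h0,
    Finset.sum_add_distrib, Finset.sum_const_zero]
  ring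

end Combinatorics

/-! ### The curvature computed in an arbitrary decomposition. -/

section Decompositions

lemma exists_eventually_eq_zero_of_prod {E ι : Type*} [NormedAddCommGroup E] [NormedSpace ℂ E]
    {p : E} (s : Finset ι) {f : ι → E → ℂ} (hf : ∀ i ∈ s, AnalyticAt ℂ (f i) p)
    (h : ∀ᶠ q in 𝓝 p, ∏ i ∈ s, f i q = 0) : ∃ i ∈ s, ∀ᶠ q in 𝓝 p, f i q = 0 := by
  classical
  induction s using Finset.induction_on with
  | empty => simpa using h.self_of_nhds
  | insert i s hi ih =>
    simp only [Finset.prod_insert hi] at h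
    have hs : ∀ j ∈ s, AnalyticAt ℂ (f j) p := fun j hj => hf j (Finset.mem_insert_of_mem hj)
    rcases eventually_eq_zero_or_of_mul (hf i (Finset.mem_insert_self i s))
      (Finset.analyticAt_fun_prod s hs) h with h1 | h1
    · exact ⟨i, Finset.mem_insert_self i s, h1⟩
    · obtain ⟨j, hj, hj'⟩ := ih hs h1
      exact ⟨j, Finset.mem_insert_of_mem hj, hj'⟩

lemma wedge_eq_zero_trans {a b c : ℂ × ℂ} (hb : b ≠ 0) (h1 : wedge b a = 0) (h2 : wedge b c = 0) :
    wedge a c = 0 := by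
  simp only [wedge] at *
  by_cases h : b.1 = 0
  · have h' : b.2 ≠ 0 := fun h' => hb (Prod.ext h h')
    refine (mul_eq_zero.1 (?_ : b.2 * _ = 0)).resolve_left h'
    linear_combination a.2 * h2 - c.2 * h1
  · refine (mul_eq_zero.1 (?_ : b.1 * _ = 0)).resolve_left h
    linear_combination a.1 * h2 - c.1 * h1

lemma exists_pairing_ne_zero {a : ℂ × ℂ} (ha : a ≠ 0) : ∃ e, pairing a e ≠ 0 := by
  by_cases h : a.1 = 0
  · exact ⟨(0, 1), by simpa [pairing] using fun h' => ha (Prod.ext h h')⟩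
  · exact ⟨(1, 0), by simpa [pairing] using h⟩

lemma exists_eq_smul_of_wedge_eq_zero {p : ℂ × ℂ} {α β : ℂ × ℂ → ℂ × ℂ} (hα : AnalyticAt ℂ α p)
    (hβ : AnalyticAt ℂ β p) (hα0 : α p ≠ 0) (hβ0 : β p ≠ 0)
    (h : ∀ᶠ q in 𝓝 p, wedge (α q) (β q) = 0) :
    ∃ f : ℂ × ℂ → ℂ, AnalyticAt ℂ f p ∧ f p ≠ 0 ∧ ∀ᶠ q in 𝓝 p, α q = f q • β q := by
  obtain ⟨e, he⟩ := exists_pairing_ne_zero hβ0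
  have h1 := hβ.pairing (analyticAt_const (v := e))
  have h2 : ∀ᶠ q in 𝓝 p, α q = (pairing (α q) e / pairing (β q) e) • β q := by
    filter_upwards [h, h1.continuousAt.eventually_ne he] with q hq hq'
    rw [div_eq_inv_mul, mul_smul, eq_inv_smul_iff₀ hq']
    simp only [wedge] at hq
    ext <;> simp only [pairing, Prod.smul_fst, Prod.smul_snd, smul_eq_mul]
    · linear_combination e.2 * hq
    · linear_combination -e.1 * hq
  refine ⟨_, (hα.pairing analyticAt_const).div h1 he, fun h0 => hα0 ?_, h2⟩
  have h3 : pairing (α p) e / pairing (β p) e = 0 := h0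
  rw [h2.self_of_nhds, h3, zero_smul]

lemma ne_zero_of_wedge_ne_zero {a b : ℂ × ℂ} (h : wedge a b ≠ 0) : a ≠ 0 := by
  rintro rfl
  simp [wedge] at h

/-- The curvature of a web in terms of an arbitrary decomposition. -/
lemma HasCurvatureAt.eq_sum {ι : Type*} [Fintype ι] [DecidableEq ι] {n : ℕ} {W : ℂ × ℂ → ℂ[X]}
    {p : ℂ × ℂ} {κ : ℂ} (h : HasCurvatureAt n W p κ) (hcard : Fintype.card ι = n)
    {a : ι → ℂ × ℂ → ℂ × ℂ} {u : ℂ × ℂ → ℂ} (ha : ∀ i, AnalyticAt ℂ (a i) p) (hu0 : u p ≠ 0)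
    (ha0 : ∀ i, a i p ≠ 0) (haw : ∀ i j, i ≠ j → wedge (a i p) (a j p) ≠ 0)
    (hW : ∀ᶠ q in 𝓝 p, W q = C (u q) * ∏ i, (C (a i q).1 + C (a i q).2 * X)) :
    (∀ i j l, i ≠ j → j ≠ l → l ≠ i →
      HasTripleCurvature (a i) (a j) (a l) p (extD (tripleForm (a i) (a j) (a l)) p)) ∧
    6 * κ = ∑ i, ∑ j, ∑ l, if i ≠ j ∧ j ≠ l ∧ l ≠ i
      then extD (tripleForm (a i) (a j) (a l)) p else 0 := by
  obtain ⟨ω, η, hω, hWω, hη, rfl⟩ := h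
  have hω0 : ∀ j, ω j p ≠ 0 := by
    intro j hj
    have h1 := hWω.self_of_nhds
    rw [Finset.prod_eq_zero (Finset.mem_univ j) (by simp [hj]), hW.self_of_nhds, mul_eq_zero,
      C_eq_zero, Finset.prod_eq_zero_iff] at h1
    rcases h1 with h1 | ⟨i, -, h1⟩
    · exact hu0 h1
    · refine ha0 i (Prod.ext ?_ ?_)
      · simpa using congrArg (fun F => F.coeff 0) h1
      · simpa [coeff_C] using congrArg (fun F => F.coeff 1) h1
  -- Both products vanish on the kernel of a i, so the product over j of ω j ∧ a i is identically
  -- zero; as germs have no zero divisors, one factor is identically zero.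
  have hmatch : ∀ i, ∃ j, ∀ᶠ q in 𝓝 p, wedge (ω j q) (a i q) = 0 := by
    intro i
    have : ∀ᶠ q in 𝓝 p, ∏ j, wedge (ω j q) (a i q) = 0 := by
      filter_upwards [hW, hWω] with q h1 h2
      have e1 := formEval_prod_linear Finset.univ (fun j => ω j q) (kerVec (a i q))
      have e2 := formEval_prod_linear Finset.univ (fun j => a j q) (kerVec (a i q))
      rw [Finset.card_univ, Fintype.card_fin] at e1
      rw [Finset.card_univ, hcard] at e2
      rw [← h2, h1, formEval_C_mul, e2, Finset.prod_eq_zero (Finset.mem_univ i), mul_zero] at e1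
      · rw [e1]
        refine Finset.prod_congr rfl fun j _ => ?_
        simp only [wedge, kerVec]
        ring
      · simp only [kerVec]
        ring
    obtain ⟨j, -, hj⟩ := exists_eventually_eq_zero_of_prod _ (fun j _ => (hω j).wedge (ha i)) this
    exact ⟨j, hj⟩
  choose τ hτ using hmatch
  -- Two factors matched with the same ω would be proportional to each other at p.
  have hinj : Function.Injective τ := by
    intro i j hij
    by_contra hne
    refine haw i j hne (wedge_eq_zero_trans (hω0 (τ i)) (hτ i).self_of_nhds ?_)
    rw [hij]
    exact (hτ j).self_of_nhds
  have hbij : Function.Bijective τ :=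
    (Fintype.bijective_iff_injective_and_card τ).2 ⟨hinj, by rw [hcard, Fintype.card_fin]⟩
  have hscale : ∀ i, ∃ f : ℂ × ℂ → ℂ, AnalyticAt ℂ f p ∧ f p ≠ 0 ∧
      ∀ᶠ q in 𝓝 p, ω (τ i) q = f q • a i q := fun i =>
    exists_eq_smul_of_wedge_eq_zero (hω _) (ha i) (hω0 _) (ha0 i) (hτ i)
  choose f hf hf0 hfa using hscale
  let T : ι → ι → ι → ℂ := fun i j l => extD (tripleForm (a i) (a j) (a l)) p
  have huniq : ∀ {i j l κ}, i ≠ j → j ≠ l → l ≠ i → HasTripleCurvature (a i) (a j) (a l) p κ →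
      κ = T i j l := fun h1 h2 h3 h =>
    h.eq_extD_tripleForm (ha _) (ha _) (ha _) (haw _ _ h1) (haw _ _ h2) (haw _ _ h3)
  have htrans : ∀ {i j l κ}, HasTripleCurvature (ω (τ i)) (ω (τ j)) (ω (τ l)) p κ →
      HasTripleCurvature (a i) (a j) (a l) p κ := fun h =>
    h.of_wedge_eq_zero (ha _) (ha _) (ha _) (hf _) (hf _) (hf _) (hf0 _) (hf0 _) (hf0 _)
      (hfa _) (hfa _) (hfa _)
  have hlt : ∀ {r s t}, r < s → s < t → HasTripleCurvature (ω r) (ω s) (ω t) p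
      (extD (η r s t) p) := fun h1 h2 => ⟨_, hη _ _ _ h1 h2, rfl⟩
  have hex : ∀ r s t, r ≠ s → s ≠ t → t ≠ r → ∃ κ, HasTripleCurvature (ω r) (ω s) (ω t) p κ := by
    intro r s t h1 h2 h3
    rcases lt_or_gt_of_ne h1 with b1 | b1 <;> rcases lt_or_gt_of_ne h2 with b2 | b2 <;>
      rcases lt_or_gt_of_ne h3 with b3 | b3
    · exact absurd (b1.trans (b2.trans b3)) (lt_irrefl _)
    · exact ⟨_, hlt b1 b2⟩
    · exact ⟨_, (hlt b3 b1).cycle⟩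
    · exact ⟨_, ((hlt b3 b2).swap (hω _) (hω _) (hω _)).cycle⟩
    · exact ⟨_, (hlt b2 b3).cycle.cycle⟩
    · exact ⟨_, (hlt b1 b3).swap (hω _) (hω _) (hω _)⟩
    · exact ⟨_, ((hlt b2 b1).swap (hω _) (hω _) (hω _)).cycle.cycle⟩
    · exact absurd (b1.trans (b3.trans b2)) (lt_irrefl _)
  have hT : ∀ i j l, i ≠ j → j ≠ l → l ≠ i → HasTripleCurvature (a i) (a j) (a l) p (T i j l) := by
    intro i j l h1 h2 h3
    obtain ⟨κ, hκ⟩ := hex (τ i) (τ j) (τ l) (hinj.ne h1) (hinj.ne h2) (hinj.ne h3)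
    have := htrans hκ
    rwa [← huniq h1 h2 h3 this]
  refine ⟨hT, ?_⟩
  let e : ι ≃ Fin n := Equiv.ofBijective τ hbij
  have he : ∀ i, e i = τ i := fun i => rfl
  let f' : Fin n → Fin n → Fin n → ℂ := fun r s t => T (e.symm r) (e.symm s) (e.symm t)
  have hsum : ∀ r s t, (if r < s ∧ s < t then extD (η r s t) p else 0)
      = if r < s ∧ s < t then f' r s t else 0 := by
    intro r s t
    split_ifs with h
    · have h' := hlt h.1 h.2
      refine huniq (e.symm.injective.ne h.1.ne) (e.symm.injective.ne h.2.ne)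
        (e.symm.injective.ne (h.1.trans h.2).ne') (htrans ?_)
      rwa [← he, ← he, ← he, e.apply_symm_apply, e.apply_symm_apply, e.apply_symm_apply]
    · rfl
  simp only [hsum]
  -- The matching τ need not be increasing, so the sum is symmetrized before it is reindexed.
  rw [six_mul_sum_lt f']
  · rw [← e.sum_comp]
    refine Finset.sum_congr rfl fun i _ => ?_
    rw [← e.sum_comp]
    refine Finset.sum_congr rfl fun j _ => ?_
    rw [← e.sum_comp]
    refine Finset.sum_congr rfl fun l _ => ?_
    simp only [f', e.symm_apply_apply, e.injective.ne_iff]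
    rfl
  · intro r s t h1 h2 h3
    have n1 := e.symm.injective.ne h1
    have n2 := e.symm.injective.ne h2
    have n3 := e.symm.injective.ne h3
    exact (huniq n1.symm n3.symm n2.symm ((hT _ _ _ n1 n2 n3).swap (ha _) (ha _) (ha _))).symm
  · intro r s t h1 h2 h3
    have n1 := e.symm.injective.ne h1
    have n2 := e.symm.injective.ne h2
    have n3 := e.symm.injective.ne h3
    exact (huniq n2 n3 n1 ((hT _ _ _ n1 n2 n3).cycle)).symm

end Decompositions

/-! ### The regular and polar parts of the curvature of V ⊠ μ₁ ⊠ ⋯ ⊠ μₖ. -/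

section CurvatureFormula

variable {k : ℕ}

/-- The part of the sum of the forms `η` of the web `V ⊠ μ₁ ⊠ ⋯ ⊠ μₖ` that is holomorphic at a point
of the discriminant of the `2`-web `V` which `V` is transverse to the `μᵢ` at. -/
def regularForm (V : ℂ × ℂ → ℂ[X]) (μ : Fin k → ℂ × ℂ → ℂ × ℂ) (e : ℂ × ℂ) (q : ℂ × ℂ) : ℂ × ℂ :=
  (∑ i, mixedForm V (μ i) e q
    + (1 / 2 : ℂ) • ∑ i, ∑ j, if i ≠ j then pairForm V (μ i) (μ j) q else 0)
    + (1 / 6 : ℂ) • ∑ i, ∑ j, ∑ l,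
      if i ≠ j ∧ j ≠ l ∧ l ≠ i then tripleForm (μ i) (μ j) (μ l) q else 0

/-- The polar part of the sum of the forms `η`, up to a scalar factor. -/
def polarPart (V : ℂ × ℂ → ℂ[X]) (μ : Fin k → ℂ × ℂ → ℂ × ℂ) (e : ℂ × ℂ) (q : ℂ × ℂ) : ℂ × ℂ :=
  ∑ i, polarCoeff V (μ i) e q • μ i q

lemma wedge_polarForm_kerVec_self (F : ℂ[X]) (m : ℂ × ℂ) :
    wedge (polarForm F (kerVec m)) m = 2 * formEval 2 F (kerVec m) := by
  simp only [formEval, Finset.sum_range_succ, Finset.sum_range_zero, wedge, polarForm, kerVec]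
  ring

lemma pairing_polarForm_self (F : ℂ[X]) (e : ℂ × ℂ) :
    pairing (polarForm F e) e = 2 * formEval 2 F e := by
  simp only [formEval, Finset.sum_range_succ, Finset.sum_range_zero, pairing, polarForm]
  ring

lemma analyticAt_regularForm_slice {V : ℂ × (ℂ × ℂ) → ℂ[X]} {μ : Fin k → ℂ × (ℂ × ℂ) → ℂ × ℂ}
    {e : ℂ × ℂ} {z : ℂ × (ℂ × ℂ)} (hV : ∀ i, AnalyticAt ℂ (fun q => (V q).coeff i) z)
    (hμ : ∀ i, AnalyticAt ℂ (μ i) z) (hμw : ∀ i j, i ≠ j → wedge (μ i z) (μ j z) ≠ 0)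
    (hμ0 : ∀ i, formEval 2 (V z) (kerVec (μ i z)) ≠ 0) (he : formEval 2 (V z) e ≠ 0) :
    AnalyticAt ℂ (fun w : ℂ × (ℂ × ℂ) =>
      regularForm (fun p => V (w.1, p)) (fun i p => μ i (w.1, p)) e w.2) z := by
  have he' : pairing (polarForm (V z) e) e ≠ 0 := by
    rw [pairing_polarForm_self]
    exact mul_ne_zero two_ne_zero he
  have hμ1 : ∀ i, wedge (polarForm (V z) (kerVec (μ i z))) (μ i z) ≠ 0 := fun i => by
    rw [wedge_polarForm_kerVec_self]
    exact mul_ne_zero two_ne_zero (hμ0 i)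
  refine AnalyticAt.fun_add (AnalyticAt.fun_add
    (Finset.analyticAt_fun_sum _ fun i _ => analyticAt_mixedForm_slice hV (hμ i) (hμ1 i) he')
    (analyticAt_const.fun_smul (Finset.analyticAt_fun_sum _ fun i _ =>
      Finset.analyticAt_fun_sum _ fun j _ => ?_)))
    (analyticAt_const.fun_smul (Finset.analyticAt_fun_sum _ fun i _ =>
      Finset.analyticAt_fun_sum _ fun j _ => Finset.analyticAt_fun_sum _ fun l _ => ?_))
  · by_cases h : i ≠ j
    · simp only [if_pos h]
      exact analyticAt_pairForm_slice hV (hμ i) (hμ j) (hμw i j h) (hμ0 i) (hμ0 j)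
    · simp only [if_neg h]
      exact analyticAt_const
  · by_cases h : i ≠ j ∧ j ≠ l ∧ l ≠ i
    · simp only [if_pos h]
      exact analyticAt_tripleForm_slice (hμ i) (hμ j) (hμ l) (hμw _ _ h.1) (hμw _ _ h.2.1)
        (hμw _ _ h.2.2)
    · simp only [if_neg h]
      exact analyticAt_const

lemma analyticAt_polarPart_slice {V : ℂ × (ℂ × ℂ) → ℂ[X]} {μ : Fin k → ℂ × (ℂ × ℂ) → ℂ × ℂ}
    {e : ℂ × ℂ} {z : ℂ × (ℂ × ℂ)} (hV : ∀ i, AnalyticAt ℂ (fun q => (V q).coeff i) z)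
    (hμ : ∀ i, AnalyticAt ℂ (μ i) z)
    (hμ0 : ∀ i, formEval 2 (V z) (kerVec (μ i z)) ≠ 0) (he : formEval 2 (V z) e ≠ 0) :
    AnalyticAt ℂ (fun w : ℂ × (ℂ × ℂ) =>
      polarPart (fun p => V (w.1, p)) (fun i p => μ i (w.1, p)) e w.2) z := by
  refine Finset.analyticAt_fun_sum _ fun i _ => AnalyticAt.fun_smul ?_ (hμ i)
  refine analyticAt_polarCoeff hV (hμ i) ?_ ?_
  · rw [wedge_polarForm_kerVec_self]
    exact mul_ne_zero two_ne_zero (hμ0 i)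
  · rw [pairing_polarForm_self]
    exact mul_ne_zero two_ne_zero he

lemma analyticAt_comp_snd {G : Type*} [NormedAddCommGroup G] [NormedSpace ℂ G] {p : ℂ × ℂ}
    {f : ℂ × ℂ → G} (hf : AnalyticAt ℂ f p) :
    AnalyticAt ℂ (fun z : ℂ × (ℂ × ℂ) => f z.2) ((0 : ℂ), p) := by
  have h1 : AnalyticAt ℂ f (((0 : ℂ), p).2) := hf
  exact h1.fun_comp analyticAt_snd

lemma AnalyticFormAt.exists_eq_linear_mul_linear {V : ℂ × ℂ → ℂ[X]} {p : ℂ × ℂ}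
    (hV : AnalyticFormAt 2 V p) (hD : formDiscr 2 (V p) ≠ 0) :
    ∃ α β : ℂ × ℂ → ℂ × ℂ, AnalyticAt ℂ α p ∧ AnalyticAt ℂ β p ∧
      ∀ᶠ q in 𝓝 p, V q = (C (α q).1 + C (α q).2 * X) * (C (β q).1 + C (β q).2 * X) := by
  have h0 : V p ≠ 0 := fun h => hD (by simp [h, formDiscr_two])
  obtain ⟨u, a, hu, -, ha, -, h⟩ := hV.exists_eq_prod h0 hD
  refine ⟨fun q => u q • a 0 q, a 1, hu.smul (ha 0), ha 1, ?_⟩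
  filter_upwards [h] with q hq
  rw [hq, Fin.prod_univ_two]
  simp only [Prod.smul_fst, Prod.smul_snd, smul_eq_mul, map_mul]
  ring

lemma extD_ite (c : Prop) [Decidable c] (F : ℂ × ℂ → ℂ × ℂ) (p : ℂ × ℂ) :
    extD (fun q => if c then F q else 0) p = if c then extD F p else 0 := by
  split_ifs
  · rfl
  · simp [extD]

/-- The triples are sorted by the number of foliations taken from V. None or one, the latter summed
over both foliations, contributes without pole; two contribute `mixedForm` and a polar part with the
same scalar factor for every i. -/
theorem HasCurvatureAt.eq_extD {V W : ℂ × ℂ → ℂ[X]} {μ : Fin k → ℂ × ℂ → ℂ × ℂ} {e : ℂ × ℂ}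
    {u : ℂ × ℂ → ℂ} {p : ℂ × ℂ} {κ : ℂ} (h : HasCurvatureAt (k + 2) W p κ)
    (hV : AnalyticFormAt 2 V p) (hD : formDiscr 2 (V p) ≠ 0) (hμ : ∀ i, AnalyticAt ℂ (μ i) p)
    (hμw : ∀ i j, i ≠ j → wedge (μ i p) (μ j p) ≠ 0)
    (hμ0 : ∀ i, formEval 2 (V p) (kerVec (μ i p)) ≠ 0) (he : formEval 2 (V p) e ≠ 0)
    (hu0 : u p ≠ 0)
    (hW : ∀ᶠ q in 𝓝 p, W q = V q * (C (u q) * ∏ i, (C (μ i q).1 + C (μ i q).2 * X))) :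
    κ = extD (regularForm V μ e) p
      + extD (fun q => (wedge (grad (fun z => formDiscr 2 (V z)) q) (polarForm (V q) e)
          / formDiscr 2 (V q)) • polarPart V μ e q) p := by
  obtain ⟨α, β, hα, hβ, hVαβ⟩ := hV.exists_eq_linear_mul_linear hD
  have hVp := hVαβ.self_of_nhds
  have hαβ : wedge (α p) (β p) ≠ 0 := by
    intro h0
    rw [hVp, formDiscr_two_mul, h0, mul_zero] at hD
    exact hD rfl
  have hαμ : ∀ i, wedge (α p) (μ i p) ≠ 0 ∧ wedge (β p) (μ i p) ≠ 0 := fun i => by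
    have := hμ0 i
    rwa [hVp, formEval_two_kerVec, mul_ne_zero_iff] at this
  have he' : pairing (polarForm (V p) e) e ≠ 0 := by
    rw [pairing_polarForm_self]
    exact mul_ne_zero two_ne_zero he
  have hμ1 : ∀ i, wedge (polarForm (V p) (kerVec (μ i p))) (μ i p) ≠ 0 := fun i => by
    rw [wedge_polarForm_kerVec_self]
    exact mul_ne_zero two_ne_zero (hμ0 i)
  have hswap : ∀ {a b : ℂ × ℂ}, wedge a b ≠ 0 → wedge b a ≠ 0 := fun h => by
    rw [wedge_swap]; exact neg_ne_zero.2 h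
  -- The booleans index the two local foliations of V, which exist only away from the discriminant.
  let a : Bool ⊕ Fin k → ℂ × ℂ → ℂ × ℂ := Sum.elim (fun b => cond b α β) μ
  have ha : ∀ i, AnalyticAt ℂ (a i) p := by
    rintro (b | i)
    · cases b
      exacts [hβ, hα]
    · exact hμ i
  have haw : ∀ i j, i ≠ j → wedge (a i p) (a j p) ≠ 0 := by
    rintro (b | i) (c | j) hne
    · cases b <;> cases c
      exacts [absurd rfl hne, hswap hαβ, hαβ, absurd rfl hne]
    · cases b
      exacts [(hαμ j).2, (hαμ j).1]
    · cases c
      exacts [hswap (hαμ i).2, hswap (hαμ i).1]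
    · exact hμw i j fun h => hne (congrArg Sum.inr h)
  have ha0 : ∀ i, a i p ≠ 0 := by
    rintro (b | i)
    · cases b
      exacts [ne_zero_of_wedge_ne_zero (hswap hαβ), ne_zero_of_wedge_ne_zero hαβ]
    · exact ne_zero_of_wedge_ne_zero (hswap (hαμ i).1)
  obtain ⟨hT, hsum⟩ := h.eq_sum (a := a) (u := u) (by simp [add_comm]) ha hu0 ha0 haw (by
    filter_upwards [hW, hVαβ] with q h1 h2
    rw [h1, h2, Fintype.prod_sum_type, Fintype.prod_bool]
    simp only [a, Sum.elim_inl, Sum.elim_inr, cond_true, cond_false]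
    ring)
  let T : Bool ⊕ Fin k → Bool ⊕ Fin k → Bool ⊕ Fin k → ℂ := fun i j l =>
    extD (tripleForm (a i) (a j) (a l)) p
  have huniq : ∀ {i j l κ}, i ≠ j → j ≠ l → l ≠ i → HasTripleCurvature (a i) (a j) (a l) p κ →
      κ = T i j l := fun h1 h2 h3 h =>
    h.eq_extD_tripleForm (ha _) (ha _) (ha _) (haw _ _ h1) (haw _ _ h2) (haw _ _ h3)
  rw [sum_triples_bool_sum] at hsum
  rotate_left
  · intro r s t
    by_cases h : r ≠ s ∧ s ≠ t ∧ t ≠ r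
    · rw [if_pos h, if_pos ⟨h.1.symm, h.2.2.symm, h.2.1.symm⟩]
      exact (huniq h.1.symm h.2.2.symm h.2.1.symm
        ((hT _ _ _ h.1 h.2.1 h.2.2).swap (ha _) (ha _) (ha _))).symm
    · rw [if_neg h, if_neg]
      exact fun h' => h ⟨h'.1.symm, h'.2.2.symm, h'.2.1.symm⟩
  · intro r s t
    by_cases h : r ≠ s ∧ s ≠ t ∧ t ≠ r
    · rw [if_pos h, if_pos ⟨h.2.1, h.2.2, h.1⟩]
      exact (huniq h.2.1 h.2.2 h.1 (hT _ _ _ h.1 h.2.1 h.2.2).cycle).symm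
    · rw [if_neg h, if_neg]
      exact fun h' => h ⟨h'.2.2, h'.1, h'.2.1⟩
  · intro r s
    exact if_neg fun h => h.1 rfl
  have t1 : ∀ i, (if (Sum.inl true : Bool ⊕ Fin k) ≠ Sum.inl false ∧
      (Sum.inl false : Bool ⊕ Fin k) ≠ Sum.inr i ∧ (Sum.inr i : Bool ⊕ Fin k) ≠ Sum.inl true
      then extD (tripleForm (a (Sum.inl true)) (a (Sum.inl false)) (a (Sum.inr i))) p else 0)
      = extD (mixedForm V (μ i) e) p
      + extD (fun q => (wedge (grad (fun z => formDiscr 2 (V z)) q) (polarForm (V q) e)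
          / formDiscr 2 (V q)) • (polarCoeff V (μ i) e q • μ i q)) p := by
    intro i
    rw [if_pos (by simp)]
    have h1 := hT (Sum.inl true) (Sum.inl false) (Sum.inr i) (by simp) (by simp) (by simp)
    exact eq_extD_mixedForm hVαβ hV.2 h1 hα hβ (hμ i) hD (hμ1 i) he'
  have t2 : ∀ i j, ((if (Sum.inl true : Bool ⊕ Fin k) ≠ Sum.inr i ∧
      (Sum.inr i : Bool ⊕ Fin k) ≠ Sum.inr j ∧ (Sum.inr j : Bool ⊕ Fin k) ≠ Sum.inl true
      then extD (tripleForm (a (Sum.inl true)) (a (Sum.inr i)) (a (Sum.inr j))) p else 0)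
      + if (Sum.inl false : Bool ⊕ Fin k) ≠ Sum.inr i ∧
      (Sum.inr i : Bool ⊕ Fin k) ≠ Sum.inr j ∧ (Sum.inr j : Bool ⊕ Fin k) ≠ Sum.inl false
      then extD (tripleForm (a (Sum.inl false)) (a (Sum.inr i)) (a (Sum.inr j))) p else 0)
      = extD (fun q => if i ≠ j then pairForm V (μ i) (μ j) q else 0) p := by
    intro i j
    rw [extD_ite]
    by_cases h : i ≠ j
    · rw [if_pos (by simpa using h), if_pos (by simpa using h), if_pos h]
      exact add_eq_extD_pairForm hVαβ (hT (Sum.inl true) (Sum.inr i) (Sum.inr j)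
        (by simp) (by simpa using h) (by simp)) (hT (Sum.inl false) (Sum.inr i) (Sum.inr j)
        (by simp) (by simpa using h) (by simp)) hα hβ (hμ i) (hμ j) (hμw i j h) (hμ0 i) (hμ0 j)
    · rw [if_neg (by simpa using h), if_neg (by simpa using h), if_neg h, add_zero]
  have t3 : ∀ i j l, (if (Sum.inr i : Bool ⊕ Fin k) ≠ Sum.inr j ∧
      (Sum.inr j : Bool ⊕ Fin k) ≠ Sum.inr l ∧ (Sum.inr l : Bool ⊕ Fin k) ≠ Sum.inr i
      then extD (tripleForm (a (Sum.inr i)) (a (Sum.inr j)) (a (Sum.inr l))) p else 0)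
      = extD (fun q => if i ≠ j ∧ j ≠ l ∧ l ≠ i then tripleForm (μ i) (μ j) (μ l) q else 0) p := by
    intro i j l
    rw [extD_ite]
    simp only [ne_eq, Sum.inr.injEq]
    rfl
  simp only [t1, t2, t3] at hsum
  have s1 : ∀ i, DifferentiableAt ℂ (mixedForm V (μ i) e) p := fun i =>
    (analyticAt_slice (analyticAt_mixedForm_slice (z := ((0 : ℂ), p)) (V := fun z => V z.2)
      (μ := fun z => μ i z.2) (fun i => analyticAt_comp_snd (hV.2 i))
      (analyticAt_comp_snd (hμ i)) (hμ1 i) he')).differentiableAt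
  have s2 : ∀ i j, DifferentiableAt ℂ (fun q => if i ≠ j then pairForm V (μ i) (μ j) q else 0)
      p := by
    intro i j
    by_cases h : i ≠ j
    · simp only [if_pos h]
      exact (analyticAt_slice (analyticAt_pairForm_slice (z := ((0 : ℂ), p)) (V := fun z => V z.2)
        (μ := fun z => μ i z.2) (ν := fun z => μ j z.2) (fun i => analyticAt_comp_snd (hV.2 i))
        (analyticAt_comp_snd (hμ i)) (analyticAt_comp_snd (hμ j)) (hμw i j h) (hμ0 i)
        (hμ0 j))).differentiableAt
    · simp only [if_neg h]
      exact differentiableAt_const _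
  have s3 : ∀ i j l, DifferentiableAt ℂ
      (fun q => if i ≠ j ∧ j ≠ l ∧ l ≠ i then tripleForm (μ i) (μ j) (μ l) q else 0) p := by
    intro i j l
    by_cases h : i ≠ j ∧ j ≠ l ∧ l ≠ i
    · simp only [if_pos h]
      exact (analyticAt_slice (analyticAt_tripleForm_slice (z := ((0 : ℂ), p))
        (μ := fun z => μ i z.2) (ν := fun z => μ j z.2) (ρ := fun z => μ l z.2)
        (analyticAt_comp_snd (hμ i)) (analyticAt_comp_snd (hμ j)) (analyticAt_comp_snd (hμ l))
        (hμw _ _ h.1) (hμw _ _ h.2.1) (hμw _ _ h.2.2))).differentiableAt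
    · simp only [if_neg h]
      exact differentiableAt_const _
  have hDa := analyticAt_formDiscr 2 hV.2
  have s4 : ∀ i, DifferentiableAt ℂ (fun q => (wedge (grad (fun z => formDiscr 2 (V z)) q)
      (polarForm (V q) e) / formDiscr 2 (V q)) • (polarCoeff V (μ i) e q • μ i q)) p := fun i =>
    (((hDa.grad.wedge (analyticAt_polarForm hV.2 analyticAt_const)).div hDa hD).smul
      ((analyticAt_polarCoeff hV.2 (hμ i) (hμ1 i) he').smul (hμ i))).differentiableAt
  have r1 : extD (fun q => (wedge (grad (fun z => formDiscr 2 (V z)) q) (polarForm (V q) e)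
      / formDiscr 2 (V q)) • polarPart V μ e q) p
      = ∑ i, extD (fun q => (wedge (grad (fun z => formDiscr 2 (V z)) q) (polarForm (V q) e)
          / formDiscr 2 (V q)) • (polarCoeff V (μ i) e q • μ i q)) p := by
    simp only [polarPart, Finset.smul_sum]
    exact extD_sum _ fun i _ => s4 i
  have d1 : DifferentiableAt ℂ (fun q => ∑ i, mixedForm V (μ i) e q) p :=
    DifferentiableAt.fun_sum fun i _ => s1 i
  have d2' : ∀ i, DifferentiableAt ℂ (fun q => ∑ j, if i ≠ j then pairForm V (μ i) (μ j) q else 0)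
      p := fun i => DifferentiableAt.fun_sum fun j _ => s2 i j
  have d2 : DifferentiableAt ℂ (fun q => ∑ i, ∑ j, if i ≠ j then pairForm V (μ i) (μ j) q else 0)
      p := DifferentiableAt.fun_sum fun i _ => d2' i
  have d3'' : ∀ i j, DifferentiableAt ℂ (fun q => ∑ l,
      if i ≠ j ∧ j ≠ l ∧ l ≠ i then tripleForm (μ i) (μ j) (μ l) q else 0) p := fun i j =>
    DifferentiableAt.fun_sum fun l _ => s3 i j l
  have d3' : ∀ i, DifferentiableAt ℂ (fun q => ∑ j, ∑ l,
      if i ≠ j ∧ j ≠ l ∧ l ≠ i then tripleForm (μ i) (μ j) (μ l) q else 0) p := fun i =>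
    DifferentiableAt.fun_sum fun j _ => d3'' i j
  have d3 : DifferentiableAt ℂ (fun q => ∑ i, ∑ j, ∑ l,
      if i ≠ j ∧ j ≠ l ∧ l ≠ i then tripleForm (μ i) (μ j) (μ l) q else 0) p :=
    DifferentiableAt.fun_sum fun i _ => d3' i
  have r2 : extD (regularForm V μ e) p = ∑ i, extD (mixedForm V (μ i) e) p
      + (1 / 2) * ∑ i, ∑ j, extD (fun q => if i ≠ j then pairForm V (μ i) (μ j) q else 0) p
      + (1 / 6) * ∑ i, ∑ j, ∑ l, extD (fun q =>
        if i ≠ j ∧ j ≠ l ∧ l ≠ i then tripleForm (μ i) (μ j) (μ l) q else 0) p := by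
    have : regularForm V μ e = fun q => (∑ i, mixedForm V (μ i) e q
      + (1 / 2 : ℂ) • ∑ i, ∑ j, if i ≠ j then pairForm V (μ i) (μ j) q else 0)
      + (1 / 6 : ℂ) • ∑ i, ∑ j, ∑ l,
      if i ≠ j ∧ j ≠ l ∧ l ≠ i then tripleForm (μ i) (μ j) (μ l) q else 0 := rfl
    rw [this, extD_add (d1.fun_add (d2.fun_const_smul (1 / 2 : ℂ))) (d3.fun_const_smul (1 / 6 : ℂ)),
      extD_add d1 (d2.fun_const_smul (1 / 2 : ℂ)), extD_const_smul _ d2, extD_const_smul _ d3,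
      extD_sum _ fun i _ => s1 i, extD_sum _ fun i _ => d2' i, extD_sum _ fun i _ => d3' i]
    simp only [extD_sum _ fun j _ => s2 _ j, extD_sum _ fun j _ => d3'' _ j,
      extD_sum _ fun l _ => s3 _ _ l]
  rw [r1, r2]
  rw [Finset.sum_add_distrib] at hsum
  -- The weights 6, 3 and 1 become the coefficients 1, 1/2 and 1/6 of `regularForm`.
  linear_combination hsum / 6

end CurvatureFormula

/-! ### Divisibility of dD ∧ ω by D in the family. -/

section Divisibility

lemma eventually_slice {P : ℂ × (ℂ × ℂ) → Prop} {z₀ : ℂ × (ℂ × ℂ)} (h : ∀ᶠ z in 𝓝 z₀, P z) :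
    ∀ᶠ z in 𝓝 z₀, ∀ᶠ p in 𝓝 z.2, P (z.1, p) := by
  filter_upwards [h.eventually_nhds] with z hz
  have hc : Tendsto (fun p : ℂ × ℂ => (z.1, p)) (𝓝 z.2) (𝓝 z) :=
    (Continuous.prodMk_right z.1).tendsto' _ _ rfl
  exact hc.eventually hz

lemma AnalyticFormAt.eventually_analyticFormAt {E : Type*} [NormedAddCommGroup E]
    [NormedSpace ℂ E] {n : ℕ} {V : E → ℂ[X]} {z : E} (hV : AnalyticFormAt n V z) :
    ∀ᶠ w in 𝓝 z, AnalyticFormAt n V w := by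
  have h : ∀ᶠ w in 𝓝 z, ∀ i ∈ Finset.range (n + 1), AnalyticAt ℂ (fun q => (V q).coeff i) w :=
    (Finset.eventually_all _).2 fun i _ => (hV.2 i).eventually_analyticAt
  filter_upwards [hV.1.eventually_nhds, h] with w h1 h2
  refine ⟨h1, fun i => ?_⟩
  by_cases hi : i ≤ n
  · exact h2 i (Finset.mem_range.2 (Nat.lt_succ_iff.2 hi))
  · refine (analyticAt_const (v := (0 : ℂ))).congr ?_
    filter_upwards [h1] with q hq
    exact (coeff_eq_zero_of_natDegree_lt (by lia)).symm

lemma AnalyticFormAt.slice {n : ℕ} {V : ℂ × (ℂ × ℂ) → ℂ[X]} {z : ℂ × (ℂ × ℂ)}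
    (hV : AnalyticFormAt n V z) : AnalyticFormAt n (fun p => V (z.1, p)) z.2 :=
  ⟨((Continuous.prodMk_right z.1).tendsto' z.2 z rfl).eventually hV.1,
    fun i => analyticAt_slice (hV.2 i)⟩

/-- The polar form of a degenerate quadratic form vanishes at its isotropic vectors. -/
lemma pairing_polarForm_eq_zero {F : ℂ[X]} (hD : formDiscr 2 F = 0) {v : ℂ × ℂ}
    (hv : formEval 2 F v = 0) (w : ℂ × ℂ) : pairing (polarForm F w) v = 0 := by
  have h : pairing (polarForm F w) v ^ 2 = 4 * formEval 2 F v * formEval 2 F w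
      + formDiscr 2 F * wedge v w ^ 2 := by
    rw [formDiscr_two]
    simp only [formEval, Finset.sum_range_succ, Finset.sum_range_zero, pairing, polarForm, wedge]
    ring
  rw [hD, hv] at h
  simpa using h

lemma pairing_kerVec (a b : ℂ × ℂ) : pairing a (kerVec b) = wedge a b := by
  simp only [pairing, kerVec, wedge]
  ring

lemma wedge_sum_right {ι : Type*} (s : Finset ι) (a : ℂ × ℂ) (f : ι → ℂ × ℂ) :
    wedge a (∑ i ∈ s, f i) = ∑ i ∈ s, wedge a (f i) := by
  simp only [wedge, Prod.fst_sum, Prod.snd_sum, Finset.mul_sum, Finset.sum_sub_distrib]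

/-- At such a point every polar form of V is a multiple of γ. Each term of γ ∧ B then equals the
same nonzero constant, independent of the foliation μ i, so the k terms cannot cancel. -/
lemma wedge_polarPart_ne_zero {k : ℕ} (hk : 1 ≤ k) {V : ℂ × ℂ → ℂ[X]}
    {μ : Fin k → ℂ × ℂ → ℂ × ℂ} {e p γ : ℂ × ℂ} (hγ : γ ≠ 0) (hD : formDiscr 2 (V p) = 0)
    (hγV : formEval 2 (V p) (kerVec γ) = 0)
    (hμ0 : ∀ i, formEval 2 (V p) (kerVec (μ i p)) ≠ 0) (he : formEval 2 (V p) e ≠ 0) :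
    wedge γ (polarPart V μ e p) ≠ 0 := by
  have hpol : ∀ w, wedge (polarForm (V p) w) γ = 0 := fun w => by
    rw [← pairing_kerVec]
    exact pairing_polarForm_eq_zero hD hγV w
  have hprop : ∀ w, ∃ s : ℂ, polarForm (V p) w = s • γ := by
    intro w
    have h := hpol w
    obtain ⟨x, hx⟩ := exists_pairing_ne_zero hγ
    refine ⟨pairing (polarForm (V p) w) x / pairing γ x, ?_⟩
    rw [div_eq_inv_mul, mul_smul, eq_inv_smul_iff₀ hx]
    simp only [wedge] at h
    ext <;> simp only [pairing, Prod.smul_fst, Prod.smul_snd, smul_eq_mul]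
    · linear_combination x.2 * h
    · linear_combination -x.1 * h
  have he' : pairing (polarForm (V p) e) e ≠ 0 := by
    rw [pairing_polarForm_self]
    exact mul_ne_zero two_ne_zero he
  have hps : ∀ (s : ℂ) (a b : ℂ × ℂ), pairing (s • a) b = s * pairing a b := fun s a b => by
    simp only [pairing, Prod.smul_fst, Prod.smul_snd, smul_eq_mul]
    ring
  have hγe : pairing γ e ≠ 0 := by
    obtain ⟨s, hs⟩ := hprop e
    rw [hs, hps] at he'
    exact right_ne_zero_of_mul he'
  have hterm : ∀ i, wedge γ (polarCoeff V (μ i) e p • μ i p)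
      = pairing γ e / (2 * pairing (polarForm (V p) e) e) := by
    intro i
    have hμ1 : wedge (polarForm (V p) (kerVec (μ i p))) (μ i p) ≠ 0 := by
      rw [wedge_polarForm_kerVec_self]
      exact mul_ne_zero two_ne_zero (hμ0 i)
    obtain ⟨s, hs⟩ := hprop (kerVec (μ i p))
    rw [hs, wedge_smul_left, mul_ne_zero_iff] at hμ1
    obtain ⟨hs0, hμ2⟩ := hμ1
    rw [wedge_smul_right, polarCoeff, hs, hps, wedge_smul_left]
    field_simp
  rw [polarPart, wedge_sum_right]
  simp only [hterm, Finset.sum_const, Finset.card_univ, Fintype.card_fin, nsmul_eq_mul]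
  have hk' : (k : ℂ) ≠ 0 := by exact_mod_cast (by lia : k ≠ 0)
  exact mul_ne_zero hk' (div_ne_zero hγe (mul_ne_zero two_ne_zero he'))

lemma kerVec_eq_zero {a : ℂ × ℂ} (h : kerVec a = 0) : a = 0 := by
  have h1 : a.2 = 0 := congrArg Prod.fst h
  have h2 : -a.1 = 0 := congrArg Prod.snd h
  exact Prod.ext (neg_eq_zero.1 h2) h1

lemma fieldDeriv_slice {F : ℂ × (ℂ × ℂ) → ℂ} {B : ℂ × (ℂ × ℂ) → ℂ × ℂ} {z : ℂ × (ℂ × ℂ)}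
    (hF : AnalyticAt ℂ F z) : fieldDeriv (fun w => (0, kerVec (B w))) F z
      = wedge (grad (fun p => F (z.1, p)) z.2) (B z) := by
  rw [fieldDeriv, ← fderiv_slice hF.differentiableAt, fderiv_kerVec]

/-- With f the coefficient of dD ∧ ω, expanding d((f/D) B) = K - dR and multiplying by D² gives the
first order equation for f/D along the kernel of B, with the coefficient of dB as zeroth order term.
The invariance of {g = 0} on the initial fibre enters through the transversality of this kernel. -/
theorem exists_wedge_grad_formDiscr_eq_mul {k : ℕ} (hk : 1 ≤ k) {V G W : ℂ × (ℂ × ℂ) → ℂ[X]}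
    (hV : AnalyticFormAt 2 V 0) (hG : AnalyticFormAt k G 0) (hG0 : G 0 ≠ 0)
    (hGd : formDiscr k (G 0) ≠ 0) (hR : resultant (V 0) (G 0) 2 k ≠ 0)
    (hW : ∀ᶠ z in 𝓝 0, W z = V z * G z)
    (hdense : ∀ᶠ z in 𝓝 (0 : ℂ × (ℂ × ℂ)), ∃ᶠ p in 𝓝 z.2, formDiscr 2 (V (z.1, p)) ≠ 0)
    (hWd : ∀ᶠ z in 𝓝 0, formDiscr 2 (V z) ≠ 0 → formDiscr (k + 2) (W z) ≠ 0)
    (hcurv : ∀ᶠ z : ℂ × (ℂ × ℂ) in 𝓝 0,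
      HolomorphicCurvatureAt (k + 2) (fun p => W (z.1, p)) z.2)
    {g u : ℂ × ℂ → ℂ} {m : ℕ} (hm : m ≠ 0) (hg : AnalyticAt ℂ g 0) (hg0 : g 0 = 0)
    (hdg : fderiv ℂ g 0 ≠ 0) (hu : AnalyticAt ℂ u 0) (hu0 : u 0 ≠ 0)
    (hDg : ∀ᶠ p in 𝓝 0, formDiscr 2 (V (0, p)) = g p ^ m * u p)
    (htan : ∀ v, fderiv ℂ g 0 v = 0 → formEval 2 (V 0) v = 0)
    {e : ℂ × ℂ} (he : formEval 2 (V 0) e ≠ 0) :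
    ∃ q : ℂ × (ℂ × ℂ) → ℂ, AnalyticAt ℂ q 0 ∧ ∀ᶠ z in 𝓝 0,
      wedge (grad (fun p => formDiscr 2 (V (z.1, p))) z.2) (polarForm (V z) e)
        = q z * formDiscr 2 (V z) := by
  obtain ⟨c, μ, hc, hc0, hμ, hμw, hGμ⟩ := hG.exists_eq_prod hG0 hGd
  have hG0' := hGμ.self_of_nhds
  -- Otherwise the kernel of a factor of G would be a common zero of V and G.
  have hμV : ∀ i, formEval 2 (V 0) (kerVec (μ i 0)) ≠ 0 := by
    intro i hi
    have h1 : formEval k (G 0) (kerVec (μ i 0)) = 0 := by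
      have e1 := formEval_prod_linear Finset.univ (fun j => μ j 0) (kerVec (μ i 0))
      rw [Finset.card_univ, Fintype.card_fin] at e1
      rw [hG0', formEval_C_mul, e1, Finset.prod_eq_zero (Finset.mem_univ i), mul_zero]
      simp only [kerVec]
      ring
    have h2 := kerVec_eq_zero (eq_zero_of_formEval_eq_zero (by lia) hV.1.self_of_nhds
      hG.1.self_of_nhds hR hi h1)
    rw [Finset.prod_eq_zero (Finset.mem_univ i) (by simp [h2]), mul_zero] at hG0'
    exact hG0 hG0'
  let D : ℂ × (ℂ × ℂ) → ℂ := fun z => formDiscr 2 (V z)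
  let f : ℂ × (ℂ × ℂ) → ℂ := fun z =>
    wedge (grad (fun p => formDiscr 2 (V (z.1, p))) z.2) (polarForm (V z) e)
  let B : ℂ × (ℂ × ℂ) → ℂ × ℂ := fun w =>
    polarPart (fun p => V (w.1, p)) (fun i p => μ i (w.1, p)) e w.2
  let R : ℂ × (ℂ × ℂ) → ℂ × ℂ := fun w =>
    regularForm (fun p => V (w.1, p)) (fun i p => μ i (w.1, p)) e w.2
  have hD : AnalyticAt ℂ D 0 := analyticAt_formDiscr 2 hV.2
  have hf : AnalyticAt ℂ f 0 :=
    (analyticAt_grad_slice hD).wedge (analyticAt_polarForm hV.2 analyticAt_const)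
  have hB : AnalyticAt ℂ B 0 := analyticAt_polarPart_slice hV.2 hμ hμV he
  have hRa : AnalyticAt ℂ R 0 := analyticAt_regularForm_slice hV.2 hμ hμw hμV he
  have hξ : AnalyticAt ℂ (fun w => ((0 : ℂ), kerVec (B w))) 0 := analyticAt_const.prod hB.kerVec
  have hμw' : ∀ᶠ z in 𝓝 0, ∀ i j, i ≠ j → wedge (μ i z) (μ j z) ≠ 0 := by
    refine eventually_all.2 fun i => eventually_all.2 fun j => ?_
    by_cases h : i = j
    · exact Eventually.of_forall fun z h' => absurd h h'
    · filter_upwards [((hμ i).wedge (hμ j)).continuousAt.eventually_ne (hμw i j h)] with z hz _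
        using hz
  have hμV' : ∀ᶠ z in 𝓝 0, ∀ i, formEval 2 (V z) (kerVec (μ i z)) ≠ 0 :=
    eventually_all.2 fun i =>
      (analyticAt_formEval 2 hV.2 (hμ i).kerVec).continuousAt.eventually_ne (hμV i)
  have he' : ∀ᶠ z in 𝓝 0, formEval 2 (V z) e ≠ 0 :=
    (analyticAt_formEval 2 hV.2 analyticAt_const).continuousAt.eventually_ne he
  have hμa' : ∀ᶠ z in 𝓝 0, ∀ i, AnalyticAt ℂ (μ i) z :=
    eventually_all.2 fun i => (hμ i).eventually_analyticAt
  refine exists_analyticAt_eq_mul_of_transverse hD hf (analyticAt_extD_slice hB) hξ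
    (fun z => rfl) hdense ?_ hg hu hu0 ?_ (hDg.mono fun p hp => hp)
  · have hgood := eventually_slice (hμw'.and (hμV'.and (he'.and (hμa'.and
      (hV.eventually_analyticFormAt.and ((hc.continuousAt.eventually_ne hc0).and
      (hWd.and (hf.eventually_analyticAt.and (hB.eventually_analyticAt.and
      (hD.eventually_analyticAt.and (hW.and hGμ).eventually_nhds))))))))))
    filter_upwards [hcurv, hgood, hRa.eventually_analyticAt] with z ⟨κ, hκ, hκc⟩ hz hRz
    refine ⟨fun p => κ p - extD (fun p => R (z.1, p)) p,
      hκ.sub (analyticAt_slice (analyticAt_extD_slice hRz)), ?_⟩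
    filter_upwards [hz, hκc] with p
      ⟨g1, g2, g3, g4, g5, g6, g7, g8, g9, g10, g11⟩ hp hDp
    have hs : Tendsto (fun q : ℂ × ℂ => (z.1, q)) (𝓝 p) (𝓝 (z.1, p)) :=
      (Continuous.prodMk_right z.1).tendsto p
    have key := (hp (g7 hDp)).eq_extD (V := fun q => V (z.1, q)) (μ := fun i q => μ i (z.1, q))
      (u := fun q => c (z.1, q)) (e := e) g5.slice hDp (fun i => analyticAt_slice (g4 i)) g1 g2 g3
      g6 (by
        filter_upwards [hs.eventually g11] with q hq
        rw [hq.1, hq.2])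
    have g8' : AnalyticAt ℂ (fun q => f (z.1, q)) p := analyticAt_slice g8
    have g9' : AnalyticAt ℂ (fun q => B (z.1, q)) p := analyticAt_slice g9
    have g10' : AnalyticAt ℂ (fun q => D (z.1, q)) p := analyticAt_slice g10
    have gi : AnalyticAt ℂ (fun q => (D (z.1, q))⁻¹) p := g10'.inv hDp
    have hq : (fun q => (wedge (grad (fun q => formDiscr 2 (V (z.1, q))) q)
        (polarForm (V (z.1, q)) e) / formDiscr 2 (V (z.1, q))) •
        polarPart (fun q => V (z.1, q)) (fun i q => μ i (z.1, q)) e q)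
        = fun q => (f (z.1, q) * (D (z.1, q))⁻¹) • B (z.1, q) := rfl
    have hq2 : extD (regularForm (fun q => V (z.1, q)) (fun i q => μ i (z.1, q)) e) p
        = extD (fun p => R (z.1, p)) p := rfl
    rw [hq, hq2, extD_smul (g8'.fun_mul gi).differentiableAt g9'.differentiableAt,
      grad_mul g8'.differentiableAt gi.differentiableAt, grad_inv g10'.differentiableAt hDp,
      wedge_add_left, wedge_smul_left, wedge_smul_left, wedge_smul_left] at key
    rw [fieldDeriv_slice g8, fieldDeriv_slice g10, key]
    have hDp' : D (z.1, p) ≠ 0 := hDp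
    simp only
    field_simp
    ring
  -- The derivative of g along the kernel of B is dg ∧ B.
  · change fderiv ℂ g 0 (kerVec (B 0)) ≠ 0
    rw [fderiv_kerVec]
    have hγ : grad g 0 ≠ 0 := by
      intro h
      refine hdg (ContinuousLinearMap.ext fun v => ?_)
      rw [fderiv_apply_eq_grad, h]
      simp
    refine wedge_polarPart_ne_zero hk hγ ?_ (htan _ ?_) hμV he
    · change formDiscr 2 (V (0, (0 : ℂ × ℂ))) = 0
      rw [hDg.self_of_nhds, hg0, zero_pow hm, zero_mul]
    · rw [fderiv_kerVec, wedge_self]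

end Divisibility

/-! ### Tangency to the discriminant and invariance. -/

section Invariance

/-- If the zero set of `D` is contained in that of `g` and the vector field `X` is tangent to the
divisor of `D`, then `X` is tangent to the zero set of `g`. -/
lemma fderiv_apply_eq_zero_of_tangent {D g q : ℂ × ℂ → ℂ} {X : ℂ × ℂ → ℂ × ℂ} {p : ℂ × ℂ}
    (hD : AnalyticAt ℂ D p) (hg : AnalyticAt ℂ g p) (hq : AnalyticAt ℂ q p)
    (hX : AnalyticAt ℂ X p) (hDX : ∀ᶠ z in 𝓝 p, fderiv ℂ D z (X z) = q z * D z) (hDp : D p = 0)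
    (hDg : ∀ᶠ z in 𝓝 p, D z = 0 → g z = 0) : fderiv ℂ g p (X p) = 0 := by
  -- An integral curve in real time suffices, since only its velocity at p matters.
  have hXc : ContDiffAt ℝ 1 X p := (hX.contDiffAt (n := 1)).restrict_scalars ℝ
  obtain ⟨α, hα0, ε, hε, hα⟩ :=
    hXc.exists_forall_mem_closedBall_exists_eq_forall_mem_Ioo_hasDerivAt₀ 0
  simp only [zero_sub, zero_add] at hα
  have hbound : ∀ᶠ z in 𝓝 p, ‖q z‖ ≤ ‖q p‖ + 1 :=
    (hq.continuousAt.norm.eventually_lt_const (lt_add_one ‖q p‖)).mono fun z hz => hz.le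
  have hαc : Tendsto α (𝓝 0) (𝓝 p) := by
    have h := (hα 0 ⟨by linarith, hε⟩).continuousAt
    rwa [ContinuousAt, hα0] at h
  have hnear : ∀ᶠ t in 𝓝 (0 : ℝ), AnalyticAt ℂ D (α t) ∧
      fderiv ℂ D (α t) (X (α t)) = q (α t) * D (α t) ∧ ‖q (α t)‖ ≤ ‖q p‖ + 1 ∧
      (D (α t) = 0 → g (α t) = 0) :=
    hαc.eventually (hD.eventually_analyticAt.and (hDX.and (hbound.and hDg)))
  obtain ⟨δ, hδ, hball⟩ := Metric.eventually_nhds_iff_ball.1 hnear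
  let b := min (ε / 2) (δ / 2)
  have hb : 0 < b := lt_min (by linarith) (by linarith)
  have hbε : b < ε := (min_le_left _ _).trans_lt (by linarith)
  have hbδ : b < δ := (min_le_right _ _).trans_lt (by linarith)
  have hmem : ∀ t ∈ Set.Icc 0 b, t ∈ Metric.ball (0 : ℝ) δ := by
    intro t ht
    rw [Metric.mem_ball, Real.dist_eq, sub_zero, abs_of_nonneg ht.1]
    exact ht.2.trans_lt hbδ
  have hderiv : ∀ t ∈ Set.Icc 0 b, HasDerivAt (fun t => D (α t)) (q (α t) * D (α t)) t := by
    intro t ht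
    obtain ⟨h1, h2, -, -⟩ := hball t (hmem t ht)
    have h3 := (h1.differentiableAt.hasFDerivAt.restrictScalars ℝ).comp_hasDerivAt t
      (hα t ⟨by linarith [ht.1], ht.2.trans_lt hbε⟩)
    rw [← h2]
    exact h3
  -- Along the curve D solves a linear equation with bounded coefficient and starts at zero, so by
  -- Grönwall's inequality it stays zero, and g with it.
  have hzero := eq_zero_of_abs_deriv_le_mul_abs_self_of_eq_zero_right (K := ‖q p‖ + 1)
    (fun t ht => (hderiv t ht).continuousAt.continuousWithinAt)
    (fun t ht => (hderiv t (Set.Ico_subset_Icc_self ht)).hasDerivWithinAt)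
    (by rw [hα0, hDp]) (fun t ht => by
      rw [norm_mul]
      exact mul_le_mul_of_nonneg_right (hball t (hmem t (Set.Ico_subset_Icc_self ht))).2.2.1
        (norm_nonneg _))
  have hgα : HasDerivAt (fun t => g (α t)) (fderiv ℂ g p (X p)) 0 := by
    have h1 : HasFDerivAt g ((fderiv ℂ g (α 0)).restrictScalars ℝ) (α 0) := by
      rw [hα0]
      exact hg.differentiableAt.hasFDerivAt.restrictScalars ℝ
    have h2 := h1.comp_hasDerivAt 0 (hα 0 ⟨by linarith, hε⟩)
    rw [hα0] at h2
    exact h2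
  have hconst : HasDerivWithinAt (fun t => g (α t)) 0 (Set.Icc 0 b) 0 :=
    (hasDerivWithinAt_const (0 : ℝ) (Set.Icc 0 b) (0 : ℂ)).congr
      (fun t ht => (hball t (hmem t ht)).2.2.2 (hzero t ht))
      ((hball 0 (hmem 0 ⟨le_rfl, hb.le⟩)).2.2.2 (hzero 0 ⟨le_rfl, hb.le⟩))
  exact ((uniqueDiffOn_Icc hb) 0 ⟨le_rfl, hb.le⟩).eq_deriv _ hgα.hasDerivWithinAt hconst

lemma grad_ne_zero {g : ℂ × ℂ → ℂ} {p : ℂ × ℂ} (h : fderiv ℂ g p ≠ 0) : grad g p ≠ 0 := by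
  intro h0
  refine h (ContinuousLinearMap.ext fun v => ?_)
  rw [fderiv_apply_eq_grad, h0]
  simp

lemma pairing_eq_zero_of_wedge_eq_zero {a b v : ℂ × ℂ} (ha : a ≠ 0) (h : wedge a b = 0)
    (hv : pairing a v = 0) : pairing b v = 0 := by
  simp only [wedge, pairing] at *
  by_cases h0 : a.1 = 0
  · have h' : a.2 ≠ 0 := fun h' => ha (Prod.ext h0 h')
    refine (mul_eq_zero.1 (?_ : a.2 * _ = 0)).resolve_left h'
    linear_combination b.2 * hv - v.1 * h
  · refine (mul_eq_zero.1 (?_ : a.1 * _ = 0)).resolve_left h0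
    linear_combination b.1 * hv + v.2 * h

/-- The kernel of the polar form ω of V at e is tangent to the curve, hence ω annihilates the
tangent vector v. Where D = 0, ω(v)² = 4 V(v) V(e), and V(e) ≠ 0, so V(v) = 0. -/
lemma invariantAt_of_wedge_grad_eq_mul {V : ℂ × ℂ → ℂ[X]} {p e : ℂ × ℂ} {q D' : ℂ × ℂ → ℂ}
    (hV : AnalyticFormAt 2 V p) (he : formEval 2 (V p) e ≠ 0) (hq : AnalyticAt ℂ q p)
    (h : ∀ᶠ z in 𝓝 p, wedge (grad (fun z => formDiscr 2 (V z)) z) (polarForm (V z) e)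
      = q z * formDiscr 2 (V z))
    (hD' : ∀ᶠ z in 𝓝 p, D' z = 0 ↔ formDiscr 2 (V z) = 0) : InvariantAt 2 V D' p := by
  intro g hg hgp hdg hDg v hv
  have hω := analyticAt_polarForm hV.2 (analyticAt_const (v := e))
  have hDp : formDiscr 2 (V p) = 0 := hD'.self_of_nhds.1 (hDg.self_of_nhds.2 hgp)
  have h1 : fderiv ℂ g p (kerVec (polarForm (V p) e)) = 0 :=
    fderiv_apply_eq_zero_of_tangent (analyticAt_formDiscr 2 hV.2) hg hq hω.kerVec
      (h.mono fun z hz => by rw [fderiv_kerVec]; exact hz) hDp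
      (by filter_upwards [hD', hDg] with z h2 h3 h4 using h3.1 (h2.2 h4))
  rw [fderiv_kerVec] at h1
  rw [fderiv_apply_eq_grad] at hv
  have h2 : pairing (polarForm (V p) e) v = 0 :=
    pairing_eq_zero_of_wedge_eq_zero (grad_ne_zero hdg) h1 (by
      rw [← hv, pairing]
      ring)
  have h3 : pairing (polarForm (V p) e) v ^ 2 = 4 * formEval 2 (V p) v * formEval 2 (V p) e
      + formDiscr 2 (V p) * wedge v e ^ 2 := by
    rw [formDiscr_two]
    simp only [formEval, Finset.sum_range_succ, Finset.sum_range_zero, pairing, polarForm, wedge]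
    ring
  rw [h2, hDp] at h3
  have h4 : formEval 2 (V p) v * formEval 2 (V p) e = 0 := by linear_combination -h3 / 4
  exact (mul_eq_zero.1 h4).resolve_right he

end Invariance

/-! ### Uniqueness of the factors. -/

section Factors

/-- Coprimality makes F and F' divide each other pointwise, so they differ by a constant at each
point. The ratio of coefficients at an index where F' p does not vanish shows that this constant is
an analytic unit. -/
lemma sameWebAt_of_mul_eq {F F' G G' : ℂ × ℂ → ℂ[X]} {s : ℂ × ℂ → ℂ} {p : ℂ × ℂ}
    (hF : ∀ i, AnalyticAt ℂ (fun q => (F q).coeff i) p)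
    (hF' : ∀ i, AnalyticAt ℂ (fun q => (F' q).coeff i) p) (hF0 : F' p ≠ 0)
    (hs : AnalyticAt ℂ s p) (hs0 : s p ≠ 0)
    (h : ∀ᶠ q in 𝓝 p, F q * G q = C (s q) * (F' q * G' q))
    (hFG' : ∀ᶠ q in 𝓝 p, IsCoprime (F q) (G' q)) (hF'G : ∀ᶠ q in 𝓝 p, IsCoprime (F' q) (G q)) :
    SameWebAt F F' p ∧ SameWebAt G G' p := by
  obtain ⟨i, hi⟩ : ∃ i, (F' p).coeff i ≠ 0 := by
    by_contra! hcon
    exact hF0 (Polynomial.ext hcon)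
  have key : ∀ᶠ q in 𝓝 p, s q ≠ 0 ∧ F' q ≠ 0 ∧ (F q).coeff i / (F' q).coeff i ≠ 0 ∧
      F q = C ((F q).coeff i / (F' q).coeff i) * F' q := by
    filter_upwards [h, hFG', hF'G, hs.continuousAt.eventually_ne hs0,
      (hF' i).continuousAt.eventually_ne hi] with q h1 h2 h3 h4 h5
    have hu : IsUnit (C (s q)) := isUnit_C.2 h4.isUnit
    have d1 : F q ∣ F' q :=
      h2.dvd_of_dvd_mul_right ((hu.dvd_mul_left).1 (Dvd.intro _ h1))
    have d2 : F' q ∣ F q := h3.dvd_of_dvd_mul_right (h1 ▸ ⟨C (s q) * G' q, by ring⟩)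
    obtain ⟨w, hw⟩ := associated_of_dvd_dvd d2 d1
    obtain ⟨r, hr, hr'⟩ := Polynomial.isUnit_iff.1 w.isUnit
    rw [← hr', mul_comm] at hw
    have hc : (F q).coeff i / (F' q).coeff i = r := by
      rw [← hw, coeff_C_mul, mul_div_assoc, div_self h5, mul_one]
    exact ⟨h4, fun h0 => h5 (by rw [h0, coeff_zero]), by rw [hc]; exact hr.ne_zero,
      by rw [hc, hw]⟩
  have hc : AnalyticAt ℂ (fun q => (F q).coeff i / (F' q).coeff i) p := (hF i).div (hF' i) hi
  have hc0 := key.self_of_nhds.2.2.1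
  refine ⟨⟨_, hc, hc0, key.mono fun q hq => hq.2.2.2⟩,
    ⟨fun q => s q / ((F q).coeff i / (F' q).coeff i), hs.div hc hc0, div_ne_zero hs0 hc0, ?_⟩⟩
  filter_upwards [key, h] with q ⟨k1, k2, k3, k4⟩ h1
  rw [k4] at h1
  have h2 : C ((F q).coeff i / (F' q).coeff i) * G q = C (s q) * G' q :=
    mul_left_cancel₀ k2 (by linear_combination h1)
  have h3 : C (s q / ((F q).coeff i / (F' q).coeff i)) * C ((F q).coeff i / (F' q).coeff i)
      = C (s q) := by rw [← C_mul, div_mul_cancel₀ _ k3]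
  have h4 : C ((F q).coeff i / (F' q).coeff i) ≠ 0 := C_ne_zero.2 k3
  refine mul_left_cancel₀ h4 ?_
  rw [h2, ← h3]
  ring

lemma exists_formDiscr_mul_two {k : ℕ} (hk : 1 ≤ k) :
    ∃ c : ℂ, c ≠ 0 ∧ ∀ F G : ℂ[X], F.natDegree ≤ 2 → G.natDegree ≤ k →
      formDiscr (k + 2) (F * G)
        = c * formDiscr 2 F * formDiscr k G * resultant F G 2 k ^ 2 := by
  rw [add_comm k 2]
  exact exists_formDiscr_mul two_ne_zero (by lia)

lemma formDiscr_two_C_mul (c : ℂ) (F : ℂ[X]) : formDiscr 2 (C c * F) = c ^ 2 * formDiscr 2 F := by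
  rw [formDiscr_two, formDiscr_two]
  simp only [coeff_C_mul]
  ring

end Factors

/-- The factors of a deformation of a product of a `2`-web and a `k`-web. -/
lemma isDeformation_of_mul {m n : ℕ} {W₀ : ℂ × ℂ → ℂ[X]} {W F G : ℂ × (ℂ × ℂ) → ℂ[X]}
    (hF : AnalyticFormAt m F 0) (hWF : ∀ᶠ z in 𝓝 0, W z = F z * G z)
    (hW : ∀ᶠ z : ℂ × (ℂ × ℂ) in 𝓝 0, IsWebAt n (fun p => W (z.1, p)) z.2)
    (hd : ∀ᶠ z in 𝓝 0, formDiscr n (W z) ≠ 0 → formDiscr m (F z) ≠ 0)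
    (h0 : SameWebAt (fun p => F (0, p)) W₀ 0) :
    IsDeformation m W₀ (fun ε p => F (ε, p)) := by
  refine ⟨hF, ?_, h0⟩
  filter_upwards [hF.eventually_analyticFormAt, eventually_slice hWF, hW,
    eventually_slice hd] with z h1 h2 h3 h4
  refine ⟨h1.slice, ?_, (h3.2.2.and_eventually h4).mono fun p hp => hp.2 hp.1⟩
  filter_upwards [h3.2.1, h2.filter_mono nhdsWithin_le_nhds] with p h5 h6 h7
  rw [h6, h7, zero_mul] at h5
  exact h5 rfl

end

end PlaneWeb

/-! ### The theorem. -/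

open PlaneWeb

theorem corollary1 (k : ℕ) (hk : 1 ≤ k) (W₂ Wk : ℂ × ℂ → Polynomial ℂ)
    (hW₂ : PlaneWeb.IsWebAt 2 W₂ 0) (hWk : PlaneWeb.IsWebAt k Wk 0)
    (hΔ : PlaneWeb.SameDivisorAt (fun p => PlaneWeb.formDiscr 2 (W₂ p))
      (fun p => PlaneWeb.formDiscr (k + 2) (W₂ p * Wk p)) 0)
    (hsmooth : PlaneWeb.SmoothDivisorAt
      (fun p => PlaneWeb.formDiscr (k + 2) (W₂ p * Wk p)) 0)
    (hinv : ∀ᶠ p in 𝓝 (0 : ℂ × ℂ), PlaneWeb.InvariantAt 2 W₂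
      (fun q => PlaneWeb.formDiscr (k + 2) (W₂ q * Wk q)) p)
    (W : ℂ → ℂ × ℂ → Polynomial ℂ)
    (hW : PlaneWeb.IsDeformation (k + 2) (fun p => W₂ p * Wk p) W)
    (hcurv : ∀ᶠ z : ℂ × (ℂ × ℂ) in 𝓝 0,
      PlaneWeb.HolomorphicCurvatureAt (k + 2) (W z.1) z.2) :
    ∃ V₂ Vk : ℂ → ℂ × ℂ → Polynomial ℂ,
      PlaneWeb.IsDeformation 2 W₂ V₂ ∧
      PlaneWeb.IsDeformation k Wk Vk ∧
      (∀ᶠ z : ℂ × (ℂ × ℂ) in 𝓝 0, W z.1 z.2 = V₂ z.1 z.2 * Vk z.1 z.2) ∧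
      (∀ᶠ z : ℂ × (ℂ × ℂ) in 𝓝 0,
        PlaneWeb.SameDivisorAt (fun p => PlaneWeb.formDiscr 2 (V₂ z.1 p))
          (fun p => PlaneWeb.formDiscr (k + 2) (W z.1 p)) z.2) ∧
      (∀ᶠ z : ℂ × (ℂ × ℂ) in 𝓝 0,
        PlaneWeb.InvariantAt 2 (V₂ z.1)
          (fun p => PlaneWeb.formDiscr (k + 2) (W z.1 p)) z.2) := by
  obtain ⟨c, hc0, hc⟩ := exists_formDiscr_mul_two hk
  obtain ⟨hWa, hWweb, s, hs, hs0, hsW⟩ := hW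
  -- The factors are coprime at the origin.
  have hcop : formDiscr k (Wk 0) ≠ 0 ∧ resultant (W₂ 0) (Wk 0) 2 k ≠ 0 := by
    obtain ⟨u, hu, -, huD⟩ := hΔ
    -- The discriminant of `W₂` is not the zero germ, so it cancels: a unit times disc(Wk) Res² is
    -- 1.
    have h1 : ∀ᶠ q in 𝓝 (0 : ℂ × ℂ), formDiscr 2 (W₂ q)
        * (1 - u q * (c * formDiscr k (Wk q) * resultant (W₂ q) (Wk q) 2 k ^ 2)) = 0 := by
      filter_upwards [huD, hW₂.1.1, hWk.1.1] with q h1 h2 h3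
      rw [hc _ _ h2 h3] at h1
      linear_combination h1
    have h2 := (eventually_eq_zero_or_of_mul (analyticAt_formDiscr 2 hW₂.1.2)
      (analyticAt_const.sub (hu.mul ((analyticAt_const.mul (analyticAt_formDiscr k hWk.1.2)).mul
        ((analyticAt_resultant 2 k hW₂.1.2 hWk.1.2).pow 2)))) h1).resolve_left fun h => by
          obtain ⟨q, hq1, hq2⟩ := (hW₂.2.2.and_eventually h).exists
          exact hq1 hq2
    have h3 : 1 - u 0 * (c * formDiscr k (Wk 0) * resultant (W₂ 0) (Wk 0) 2 k ^ 2) = 0 :=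
      h2.self_of_nhds
    constructor <;> intro h0 <;> rw [h0] at h3 <;> simp at h3
  obtain ⟨hdk, hR⟩ := hcop
  have hWk0 : Wk 0 ≠ 0 := fun h => hR (by rw [h, resultant_zero_right]; simp)
  have hW₂0 : W₂ 0 ≠ 0 := fun h => hR (by rw [h, resultant_zero_left, zero_pow (by lia), zero_mul])
  have hsW0 : W 0 0 = C (s 0) * (W₂ 0 * Wk 0) := hsW.self_of_nhds
  -- The unit between W 0 and W₂ Wk is absorbed, by its value at the origin, into the factor of
  -- degree 2.
  obtain ⟨V, G, hV, hG, hV0, hG0, hVG⟩ := AnalyticFormAt.exists_eq_mul (m := 2) (n := k)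
    (W := fun z : ℂ × (ℂ × ℂ) => W z.1 z.2) (p := 0) (F₀ := C (s 0) * W₂ 0) (G₀ := Wk 0)
    (by lia) (by rw [add_comm]; exact hWa)
    ((natDegree_C_mul_le _ _).trans hW₂.1.1.self_of_nhds) hWk.1.1.self_of_nhds
    (by rw [mul_assoc]; exact hsW0)
    (by rw [resultant_C_mul_left]; exact mul_ne_zero (pow_ne_zero _ hs0) hR)
  have hRV : resultant (V 0) (G 0) 2 k ≠ 0 := by
    rw [hV0, hG0, resultant_C_mul_left]
    exact mul_ne_zero (pow_ne_zero _ hs0) hR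
  have hdG : formDiscr k (G 0) ≠ 0 := by rwa [hG0]
  -- The discriminants.
  let w : ℂ × (ℂ × ℂ) → ℂ := fun z =>
    c * formDiscr k (G z) * resultant (V z) (G z) 2 k ^ 2
  have hwa : AnalyticAt ℂ w 0 := (analyticAt_const.mul (analyticAt_formDiscr k hG.2)).mul
    ((analyticAt_resultant 2 k hV.2 hG.2).pow 2)
  have hw0 : w 0 ≠ 0 := mul_ne_zero (mul_ne_zero hc0 hdG) (pow_ne_zero 2 hRV)
  have hdisc : ∀ᶠ z : ℂ × (ℂ × ℂ) in 𝓝 0, w z ≠ 0 ∧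
      formDiscr (k + 2) (W z.1 z.2) = formDiscr 2 (V z) * w z := by
    filter_upwards [hVG, hV.1, hG.1, hwa.continuousAt.eventually_ne hw0] with z h1 h2 h3 h4
    refine ⟨h4, ?_⟩
    rw [h1, hc _ _ h2 h3]
    ring
  have hd2 : ∀ᶠ z : ℂ × (ℂ × ℂ) in 𝓝 0, formDiscr (k + 2) (W z.1 z.2) ≠ 0 →
      formDiscr 2 (V z) ≠ 0 := by
    filter_upwards [hdisc] with z h1 h2 h3
    rw [h1.2, h3, zero_mul] at h2
    exact h2 rfl
  have hd2' : ∀ᶠ z : ℂ × (ℂ × ℂ) in 𝓝 0, formDiscr 2 (V z) ≠ 0 →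
      formDiscr (k + 2) (W z.1 z.2) ≠ 0 := by
    filter_upwards [hdisc] with z h1 h2
    rw [h1.2]
    exact mul_ne_zero h2 h1.1
  have hdk' : ∀ᶠ z : ℂ × (ℂ × ℂ) in 𝓝 0, formDiscr (k + 2) (W z.1 z.2) ≠ 0 →
      formDiscr k (G z) ≠ 0 :=
    ((analyticAt_formDiscr k hG.2).continuousAt.eventually_ne hdG).mono fun z hz _ => hz
  -- The initial webs.
  have hi : Tendsto (fun p : ℂ × ℂ => ((0 : ℂ), p)) (𝓝 0) (𝓝 0) :=
    (Continuous.prodMk_right (0 : ℂ)).tendsto' _ _ rfl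
  have hVs : AnalyticFormAt 2 (fun p => V (0, p)) 0 := hV.slice
  have hGs : AnalyticFormAt k (fun p => G (0, p)) 0 := hG.slice
  have hcop' : ∀ {F H : ℂ × ℂ → ℂ[X]}, AnalyticFormAt 2 F 0 → AnalyticFormAt k H 0 →
      resultant (F 0) (H 0) 2 k ≠ 0 → ∀ᶠ q in 𝓝 0, IsCoprime (F q) (H q) := by
    intro F H hF hH h
    filter_upwards [hF.1, hH.1,
      (analyticAt_resultant 2 k hF.2 hH.2).continuousAt.eventually_ne h] with q h1 h2 h3
    exact isCoprime_of_resultant_ne_zero (by lia) h1 h2 h3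
  obtain ⟨hV₂, hVk⟩ : SameWebAt (fun p => V (0, p)) W₂ 0 ∧ SameWebAt (fun p => G (0, p)) Wk 0 := by
    refine sameWebAt_of_mul_eq hVs.2 hW₂.1.2 hW₂0 hs hs0 ?_ (hcop' hVs hWk.1 ?_)
      (hcop' hW₂.1 hGs ?_)
    · filter_upwards [hsW, hi.eventually hVG] with q h1 h2
      rw [← h2, h1]
    · change resultant (V 0) (Wk 0) 2 k ≠ 0
      rw [← hG0]
      exact hRV
    · change resultant (W₂ 0) (G 0) 2 k ≠ 0
      rw [hG0]
      exact hR
  refine ⟨fun ε p => V (ε, p), fun ε p => G (ε, p),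
    isDeformation_of_mul (W := fun z => W z.1 z.2) hV hVG hWweb hd2 hV₂,
    isDeformation_of_mul (W := fun z => W z.1 z.2) hG
      (hVG.mono fun z hz => hz.trans (mul_comm _ _)) hWweb hdk' hVk, hVG, ?_, ?_⟩
  · filter_upwards [eventually_slice hdisc, hwa.eventually_analyticAt,
      hwa.continuousAt.eventually_ne hw0] with z h1 h2 h3
    refine ⟨fun p => (w (z.1, p))⁻¹, (analyticAt_slice h2).inv h3, inv_ne_zero h3, ?_⟩
    filter_upwards [h1] with p hp
    rw [hp.2]
    field_simp [hp.1]
  -- On each fibre the discriminant of W is not locally zero, hence neither is D.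
  · have hdense : ∀ᶠ z in 𝓝 (0 : ℂ × (ℂ × ℂ)), ∃ᶠ p in 𝓝 z.2, formDiscr 2 (V (z.1, p)) ≠ 0 := by
      filter_upwards [hWweb, eventually_slice hd2] with z h1 h2
      exact (h1.2.2.and_eventually h2).mono fun p hp => hp.2 hp.1
    obtain ⟨g, m, hg, hg0, hdg, u, hu, hu0, hug⟩ := hsmooth
    obtain ⟨u', hu', hu'0, hΔ'⟩ := hΔ
    obtain ⟨r, hr, hr0, hrV⟩ := hV₂
    have hDg : ∀ᶠ p in 𝓝 (0 : ℂ × ℂ), formDiscr 2 (V (0, p))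
        = g p ^ m * (r p ^ 2 * u' p * u p) := by
      filter_upwards [hug, hΔ', hrV] with p h1 h2 h3
      rw [h3, formDiscr_two_C_mul, h2, h1]
      ring
    -- For m = 0 the discriminant is empty near the origin, also after deformation, and invariance
    -- is vacuous.
    rcases eq_or_ne m 0 with rfl | hm
    · have hD0 : formDiscr 2 (V 0) ≠ 0 := by
        have h := hDg.self_of_nhds
        rw [pow_zero, one_mul] at h
        change formDiscr 2 (V (0, 0)) ≠ 0
        rw [h]
        exact mul_ne_zero (mul_ne_zero (pow_ne_zero 2 hr0) hu'0) hu0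
      filter_upwards [hd2', (analyticAt_formDiscr 2 hV.2).continuousAt.eventually_ne hD0]
        with z h1 h2 f _ hf0 _ hf
      exact absurd (hf.self_of_nhds.2 hf0) (h1 h2)
    · obtain ⟨e, he⟩ := exists_formEval_ne_zero hV.1.self_of_nhds
        (by rw [hV0]; exact mul_ne_zero (C_ne_zero.2 hs0) hW₂0)
      -- Invariance of the initial discriminant is used at the origin, where V and `W₂` are
      -- proportional.
      have htan : ∀ v, fderiv ℂ g 0 v = 0 → formEval 2 (V 0) v = 0 := by
        intro v hv
        rw [hV0, formEval_C_mul, hinv.self_of_nhds g hg hg0 hdg ?_ v hv, mul_zero]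
        filter_upwards [hug, hu.continuousAt.eventually_ne hu0] with p h1 h2
        rw [h1, mul_eq_zero, pow_eq_zero_iff hm]
        exact or_iff_right h2
      obtain ⟨q, hq, hqV⟩ := exists_wedge_grad_formDiscr_eq_mul hk hV hG
        (by rwa [hG0]) hdG hRV hVG hdense hd2' hcurv hm hg hg0 hdg
        (((hr.pow 2).mul hu').mul hu) (mul_ne_zero (mul_ne_zero (pow_ne_zero 2 hr0) hu'0) hu0)
        hDg htan he
      filter_upwards [hV.eventually_analyticFormAt, hq.eventually_analyticAt,
        (analyticAt_formEval 2 hV.2 (analyticAt_const (v := e))).continuousAt.eventually_ne he,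
        eventually_slice hqV, eventually_slice hdisc] with z h1 h2 h3 h4 h5
      refine invariantAt_of_wedge_grad_eq_mul h1.slice h3 (analyticAt_slice h2) h4 ?_
      filter_upwards [h5] with p hp
      rw [hp.2, mul_eq_zero]
      exact or_iff_left hp.1
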